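/- Let $\mathcal A$ be a commutative $\mathbb C$-algebra, $\mathcal C=\mathcal A[[t]]$ with $t=(t_1,t_2,\dots)$, and let $\mathcal R$ be $\mathcal C[[x]]$ or $\mathcal C((x))$, $\partial=\partial/\partial x$. Let $\mathcal E$ be the algebra of microdifferential operators $P=\sum_{k\in\mathbb Z}a_k\partial^k$ ($a_k\in\mathcal R$, $a_k=0$ for $k\gg0$) with the product $$\Bigl(\sum_l a_l\partial^l\Bigr)\Bigl(\sum_m b_m\partial^m\Bigr)=\sum_k\Bigl(\sum_{l+m-r=k,\ r\ge0}\tbinom{l}{r}a_l\,b_m^{(r)}\Bigr)\partial^k ,$$ and put $P_+=\sum_{k\ge0}a_k\partial^k$. Derivatives of operators with respect to time variables are taken coefficientwise. Let $B_n=\partial^n+b_{n,n-1}\partial^{n-1}+\dots+b_{n,0}$ ($n=1,2,\dots$, $b_{n,k}\in\mathcal R$) satisfy the Zakharov–Shabat equations $$\frac{\partial B_n}{\partial t_m}-\frac{\partial B_m}{\partial t_n}+[B_n,B_m]=0\qquad(n,m\ge1).$$ Then there exist a monic first-order operator $L=\partial+u_0+u_{-1}\partial^{-1}+\dots\in\mathcal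 E$, series $\tilde t_n\in\mathcal A[[t]]$ ($n\geq1$) such that $\tilde t_n-t_n$ is a power series in $t_{n+1},t_{n+2},\dots$ without constant term, and $f_0\in\mathcal R$ with $f_0|_{t=0}=0$, such that: 1. the substitution $h(x,t)\mapsto h(x,\tilde t(t))$ is a bijection of $\mathcal R$ onto itself (so $t\mapsto\tilde t$ is a change of coordinates), and in the new time variables $$\frac{\partial L}{\partial\tilde t_n}=[(L^n)_+,L]\qquad(n\ge1);$$ 2. for all $n\ge1$, $$B_n=\tilde B_n+\sum_{k=1}^{n-1}\frac{\partial\tilde t_k}{\partial t_n}\tilde B_k+\frac{\partial f_0}{\partial t_n},\qquad \tilde B_k:=e^{f_0}(L^k)_+e^{-f_0};$$ 3. if $b_{n,n-1}=0$ for all $n\ge1$, then $u_0=0$ (so that $L$ is a Lax operator of the KP hierarchy with respect to the variables $\tilde t$), $\partial f_0=0$, and $\tilde B_n=(L^n)_+$ for all $n$. Here $e^{\pm f_0}=\sum_k(\pm f_0)^k/k!$ is formed in $\mathcal A((x))[[t]]\supset\mathcal R$. -/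

import Mathlib

open scoped Differential

noncomputable section

namespace KP

/-! ### Microdifferential operators over a commutative differential ring -/

section Microdifferential

variable {R : Type*}

/-- The sequences `(a_k)_{k ∈ ℤ}` in `R` with `a_k = 0` for `k ≫ 0`. -/
def boundedAbove (R : Type*) [AddCommGroup R] : AddSubgroup (ℤ → R) where
  carrier := {a | ∃ N : ℤ, ∀ k, N < k → a k = 0}
  zero_mem' := ⟨0, fun _ _ => rfl⟩
  add_mem' := by
    rintro a b ⟨N, hN⟩ ⟨M, hM⟩
    refine ⟨max N M, fun k hk => ?_⟩
    simp [hN k (lt_of_le_of_lt (le_max_left _ _) hk), hM k (lt_of_le_of_lt (le_max_right _ _) hk)]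
  neg_mem' := by
    rintro a ⟨N, hN⟩
    exact ⟨N, fun k hk => by simp [hN k hk]⟩

/-- Microdifferential operators `P = ∑_{k ∈ ℤ} a_k ∂^k`, with `a_k ∈ R` and `a_k = 0` for
`k ≫ 0`, written with the coefficients to the left of the powers of `∂`. -/
def MicroDiff (R : Type*) [AddCommGroup R] : Type _ := boundedAbove R

instance [AddCommGroup R] : AddCommGroup (MicroDiff R) :=
  inferInstanceAs (AddCommGroup (boundedAbove R))

namespace MicroDiff

/-- The coefficient `a_k` of `∂^k` in `P = ∑ a_k ∂^k`. -/
def coeff [AddCommGroup R] (P : MicroDiff R) (k : ℤ) : R := P.1 k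

/-- Apply an additive map to every coefficient. -/
def map [AddCommGroup R] (φ : R →+ R) (P : MicroDiff R) : MicroDiff R :=
  ⟨fun k => φ (P.coeff k), by
    obtain ⟨N, hN⟩ := P.2
    exact ⟨N, fun k hk => by simp [coeff, hN k hk]⟩⟩

/-- The differential operator part `P_+ = ∑_{k ≥ 0} a_k ∂^k`. -/
def plus [AddCommGroup R] (P : MicroDiff R) : MicroDiff R :=
  ⟨fun k => if 0 ≤ k then P.coeff k else 0, by
    obtain ⟨N, hN⟩ := P.2
    exact ⟨N, fun k hk => by simp [coeff, hN k hk]⟩⟩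

/-- The multiplication operator `c = c ∂^0`. -/
def ofFun [AddCommGroup R] (c : R) : MicroDiff R :=
  ⟨fun k => if k = 0 then c else 0, ⟨0, fun _ hk => if_neg hk.ne'⟩⟩

instance [CommRing R] : One (MicroDiff R) := ⟨ofFun 1⟩

/-- The product given by the extended Leibniz rule: the coefficient of `∂^k` in
`(∑ a_l ∂^l) (∑ b_m ∂^m)` is the sum of `binom(l, r) a_l b_m^{(r)}` over all `l, m ∈ ℤ` and
`r ≥ 0` with `l + m - r = k`. Only finitely many terms are non-zero. -/
instance [CommRing R] [Differential R] : Mul (MicroDiff R) where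
  mul P Q := ⟨fun k => ∑ᶠ p : ℤ × ℕ,
      Ring.choose p.1 p.2 • (P.coeff p.1 * (fun b : R => b′)^[p.2] (Q.coeff (k - p.1 + p.2))), by
    obtain ⟨N, hN⟩ := P.2
    obtain ⟨M, hM⟩ := Q.2
    have h0 : ∀ r : ℕ, (fun b : R => b′)^[r] 0 = 0 := fun r => by
      induction r with
      | zero => rfl
      | succ r ih => rw [Function.iterate_succ_apply', ih, map_zero]
    refine ⟨N + M, fun k hk => finsum_eq_zero_of_forall_eq_zero fun p => ?_⟩
    by_cases hp : N < p.1
    · simp [coeff, hN p.1 hp]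
    · simp [coeff, hM (k - p.1 + p.2) (by omega), h0]⟩

instance [CommRing R] [Differential R] : Pow (MicroDiff R) ℕ := ⟨fun P n => npowRec n P⟩

/-- The commutator `[P, Q] = P Q - Q P`. -/
def comm [CommRing R] [Differential R] (P Q : MicroDiff R) : MicroDiff R := P * Q - Q * P

/-- `P = ∂^n + (terms of order < n)`. -/
def IsMonic [CommRing R] (P : MicroDiff R) (n : ℤ) : Prop :=
  P.coeff n = 1 ∧ ∀ k, n < k → P.coeff k = 0

/-- `P` has no negative powers of `∂`. -/
def IsDifferential [CommRing R] (P : MicroDiff R) : Prop := ∀ k < 0, P.coeff k = 0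

end MicroDiff

end Microdifferential

/-! ### Formal functions of `x` and of the times `t_1, t_2, …` -/

section Functions

variable {A : Type*} [CommRing A]

theorem laurent_coeff_mul (f g : LaurentSeries A) (a b n : ℤ) (hf : ∀ i < a, f.coeff i = 0)
    (hg : ∀ i < b, g.coeff i = 0) :
    (f * g).coeff n = ∑ i ∈ Finset.Icc a (n - b), f.coeff i * g.coeff (n - i) := by
  rw [HahnSeries.coeff_mul]
  refine Finset.sum_of_injOn Prod.fst ?_ ?_ ?_ ?_
  · rintro ⟨i, j⟩ h ⟨i', j'⟩ h' e
    simp only [Finset.mem_coe, Finset.mem_antidiagonal] at h h'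
    simp only [Prod.mk.injEq] at e ⊢
    omega
  · rintro ⟨i, j⟩ h
    simp only [Finset.mem_coe, Finset.mem_antidiagonal, HahnSeries.mem_support] at h
    have h1 : a ≤ i := not_lt.1 fun hi => h.1 (hf i hi)
    have h2 : b ≤ j := not_lt.1 fun hi => h.2.1 (hg j hi)
    simp only [Finset.coe_Icc, Set.mem_Icc]
    omega
  · intro i _ hi
    by_contra hne
    refine hi ⟨(i, n - i), ?_, rfl⟩
    simp only [Finset.mem_coe, Finset.mem_antidiagonal, HahnSeries.mem_support]
    exact ⟨left_ne_zero_of_mul hne, right_ne_zero_of_mul hne, by omega⟩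
  · rintro ⟨i, j⟩ h
    simp only [Finset.mem_antidiagonal] at h
    rw [show n - i = j by omega]

theorem laurent_derivative_mul (f g : LaurentSeries A) :
    LaurentSeries.derivative ℤ (f * g) =
      f * LaurentSeries.derivative ℤ g + g * LaurentSeries.derivative ℤ f := by
  have hf : ∀ i < f.order, f.coeff i = 0 := fun i hi => HahnSeries.coeff_eq_zero_of_lt_order hi
  have hg : ∀ i < g.order, g.coeff i = 0 := fun i hi => HahnSeries.coeff_eq_zero_of_lt_order hi
  have hd : ∀ (h : LaurentSeries A) (n : ℤ),
      (LaurentSeries.derivative ℤ h).coeff n = (n + 1) • h.coeff (n + 1) := fun h n => by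
    rw [LaurentSeries.derivative_apply, LaurentSeries.hasseDeriv_coeff]
    simp
  have hdz : ∀ (h : LaurentSeries A), ∀ i < h.order - 1,
      (LaurentSeries.derivative ℤ h).coeff i = 0 := fun h i hi => by
    rw [hd, HahnSeries.coeff_eq_zero_of_lt_order (by omega), smul_zero]
  ext n
  rw [hd, HahnSeries.coeff_add, mul_comm g,
    laurent_coeff_mul f g _ _ _ hf hg, laurent_coeff_mul f _ _ _ _ hf (hdz g),
    laurent_coeff_mul _ g _ _ _ (hdz f) hg, Finset.smul_sum,
    show n - (g.order - 1) = n + 1 - g.order by ring]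
  have hs : ∑ i ∈ Finset.Icc (f.order - 1) (n - g.order),
      (LaurentSeries.derivative ℤ f).coeff i * g.coeff (n - i) =
      ∑ i ∈ Finset.Icc f.order (n + 1 - g.order), (i • f.coeff i) * g.coeff (n + 1 - i) := by
    refine Finset.sum_bij (fun i _ => i + 1) ?_ ?_ ?_ ?_
    · intro i hi
      simp only [Finset.mem_Icc] at hi ⊢
      omega
    · intro i _ j _ h
      omega
    · intro j hj
      simp only [Finset.mem_Icc] at hj
      exact ⟨j - 1, by simp only [Finset.mem_Icc]; omega, by ring⟩
    · intro i _
      rw [hd, show n + 1 - (i + 1) = n - i by ring]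
  rw [hs, ← Finset.sum_add_distrib]
  refine Finset.sum_congr rfl fun i _ => ?_
  rw [hd, show n - i + 1 = n + 1 - i by ring]
  simp only [zsmul_eq_mul]
  push_cast
  ring

/-- Formal functions of `x` and `t = (t_1, t_2, …)`: power series in the variables `t_n`
(`n ≥ 1`) whose coefficients are Laurent series in `x` over `A`. This ring contains both
`A[[t]][[x]]` and `A[[t]]((x))`, see `powerFun` and `laurentFun`. -/
abbrev Fun (A : Type*) [CommRing A] := MvPowerSeries ℕ+ (LaurentSeries A)

/-- The derivative `∂/∂x` of `f ∈ Fun A`, acting on each coefficient in `t`. -/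
def xDeriv (A : Type*) [CommRing A] : Fun A →+ Fun A where
  toFun f := fun α => LaurentSeries.derivative ℤ (MvPowerSeries.coeff α f)
  map_zero' := by
    funext α
    exact map_zero (LaurentSeries.derivative ℤ)
  map_add' f g := by
    funext α
    exact map_add (LaurentSeries.derivative ℤ) _ _

theorem xDeriv_mul (f g : Fun A) : xDeriv A (f * g) = f * xDeriv A g + g * xDeriv A f := by
  classical
  ext1 α
  rw [map_add, mul_comm g, MvPowerSeries.coeff_mul, MvPowerSeries.coeff_mul,
    ← Finset.sum_add_distrib]
  change LaurentSeries.derivative ℤ (MvPowerSeries.coeff α (f * g)) = _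
  rw [MvPowerSeries.coeff_mul, map_sum]
  refine Finset.sum_congr rfl fun p _ => ?_
  rw [laurent_derivative_mul, mul_comm (MvPowerSeries.coeff p.2 g)]
  rfl

/-- An additive map that satisfies the Leibniz rule makes `R` a differential ring. -/
abbrev differentialOf {R : Type*} [CommRing R] (d : R →+ R)
    (hd : ∀ f g, d (f * g) = f * d g + g * d f) : Differential R :=
  ⟨Derivation.mk' d.toIntLinearMap hd⟩

/-- `Fun A` as a differential ring with `∂ = ∂/∂x`. -/
instance : Differential (Fun A) := differentialOf (xDeriv A) xDeriv_mul

/-- The derivation `∂/∂t_n` of `Fun A`. -/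
def tDeriv (n : ℕ+) : Derivation (LaurentSeries A) (Fun A) (Fun A) :=
  MvPowerSeries.pderiv (LaurentSeries A) n

/-- The operator `∂P/∂t_n`, obtained by differentiating the coefficients of `P`. -/
def opDeriv (n : ℕ+) (P : MicroDiff (Fun A)) : MicroDiff (Fun A) :=
  P.map (tDeriv n).toLinearMap.toAddMonoidHom

/-- An element of `A[[t]]`, regarded as a function of `x` and `t` that does not depend on `x`. -/
def ofTimes : MvPowerSeries ℕ+ A →+* Fun A := MvPowerSeries.map HahnSeries.C

/-- The ring `A[[t]]((x))` inside `Fun A`: the functions `∑_n g_n(t) x^n` for a Laurent series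
`g` in `x` with coefficients `g_n ∈ A[[t]]`. -/
def laurentFun (A : Type*) [CommRing A] : Set (Fun A) :=
  {f | ∃ g : LaurentSeries (MvPowerSeries ℕ+ A), ∀ α n,
    (MvPowerSeries.coeff α f).coeff n = MvPowerSeries.coeff α (g.coeff n)}

/-- The ring `A[[t]][[x]]` inside `Fun A`: the functions `∑_{n ≥ 0} g_n(t) x^n` for a power
series `g` in `x` with coefficients `g_n ∈ A[[t]]`. -/
def powerFun (A : Type*) [CommRing A] : Set (Fun A) :=
  {f | ∃ g : PowerSeries (MvPowerSeries ℕ+ A), ∀ α n,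
    (MvPowerSeries.coeff α f).coeff n =
      MvPowerSeries.coeff α ((HahnSeries.ofPowerSeries ℤ _ g).coeff n)}

/-- The exponential `e^f = ∑ f^k / k!`, which converges `t`-adically whenever `f` vanishes at
`t = 0`. -/
def expFun [Algebra ℂ A] (f : Fun A) : Fun A := PowerSeries.subst f (PowerSeries.exp ℂ)

/-- `t̃_n = t_n + O(t_{n+1}, t_{n+2}, …)` for all `n`: the difference `t̃_n - t_n` is a power
series in `t_{n+1}, t_{n+2}, …` without constant term. -/
def IsTriangular (τ : ℕ+ → MvPowerSeries ℕ+ A) : Prop :=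
  ∀ (n : ℕ+) (α : ℕ+ →₀ ℕ), MvPowerSeries.coeff α (τ n - MvPowerSeries.X n) ≠ 0 →
    α ≠ 0 ∧ ∀ m ∈ α.support, n < m

/-- `h(x, t) ↦ h(x, t̃(t))`: substitute the series `t̃_n = τ n` for the variables `t_n`. -/
def timeChange (τ : ℕ+ → MvPowerSeries ℕ+ A) (h : Fun A) : Fun A :=
  MvPowerSeries.subst (fun n => ofTimes (τ n)) h

/-- `∂f/∂t̃_n = f'` within the function ring `S`: expressing `f` through the new time variables
as `f(x, t) = h(x, t̃(t))` with `h ∈ S`, the function `f'` is the `n`-th partial derivative of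
`h`, evaluated at `t̃(t)`. When `timeChange τ` is a bijection of `S`, the function `h` exists and
is unique. -/
def HasNewTimeDeriv (S : Set (Fun A)) (τ : ℕ+ → MvPowerSeries ℕ+ A) (n : ℕ+) (f f' : Fun A) :
    Prop :=
  ∃ h ∈ S, timeChange τ h = f ∧ timeChange τ (tDeriv n h) = f'

/-- The Zakharov-Shabat equations `∂B_n/∂t_m - ∂B_m/∂t_n + [B_n, B_m] = 0`. -/
def ZakharovShabat (B : ℕ+ → MicroDiff (Fun A)) : Prop :=
  ∀ n m, opDeriv m (B n) - opDeriv n (B m) + (B n).comm (B m) = 0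

/-- The Lax equations `∂L/∂t̃_n = [(L^n)_+, L]` in the time variables `t̃ = τ`. -/
def LaxEquations (S : Set (Fun A)) (τ : ℕ+ → MvPowerSeries ℕ+ A) (L : MicroDiff (Fun A)) : Prop :=
  ∀ (n : ℕ+) (k : ℤ), HasNewTimeDeriv S τ n (L.coeff k) (((L ^ (n : ℕ)).plus.comm L).coeff k)

/-- `B̃_n = e^{f} (L^n)_+ e^{-f}`. -/
def tildeB [Algebra ℂ A] (f : Fun A) (L : MicroDiff (Fun A)) (n : ℕ+) : MicroDiff (Fun A) :=
  MicroDiff.ofFun (expFun f) * (L ^ (n : ℕ)).plus * MicroDiff.ofFun (expFun (-f))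

end Functions

end KP

end

/-! ### The associative ring of microdifferential operators. -/

noncomputable section

namespace KP

namespace MicroDiff

open Finset

section Ring

variable {R : Type*} [CommRing R]

/-! Put $D_nP=\partial P/\partial t_n-[B_n,P]$ (`zsDeriv`), a derivation of the operator ring. The
Zakharov–Shabat equations say $D_nB_m=\partial B_n/\partial t_m$, which has order at most $n-1$
however large $m$ is. Hence an $m$-th root $X$ of $B_m$, taken to sufficient accuracy, has
$\operatorname{ord}D_nX\le n-m$: it is an approximate common zero of all $D_n$
(`ZSSystem.exists_approx`).

To pass to the limit, the roots must be made compatible. If $X$ and $u$ are both approximate at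
level $m$, then $X=\sum a_ku^k$ up to order $1-m$, and counting orders forces $a_k'=0$ and $\partial
a_k/\partial t_n=0$ for $n<m+k$ (`ZSSystem.compare`). Freezing the $a_k$ at $t=0$ turns an
approximation $u$ of level $m+1$ into another one that differs from $X$, in the coefficient of
$\partial^k$, only by monomials containing some $t_n$ with $n\ge m+k$ (`ZSSystem.exists_next`). A
given monomial contains finitely many times, so coefficients stabilise, and the limit $M$ is monic
of order one with $D_nM=0$ for all $n$ (`ZSSystem.exists_solution`).

Now $[B_n,M]=\partial M/\partial t_n$ has order at most $0$. Therefore $B_n=\sum_{k=1}^n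
c_{n,k}M^k+Z_n$ with $c_{n,k}$ independent of $x$ and $\operatorname{ord}Z_n\le0$. Let $z_n$ be the
coefficient of $\partial^0$ in $Z_n$. The Zakharov–Shabat equations make the families $c_{\cdot,k}$
and $z$ closed in $t$ (`IsExpansion.closed`), so the formal Poincaré lemma `exists_pderiv_eq` gives
$c_{n,k}=\partial\tilde t_k/\partial t_n$ and $z_n=\partial f_0/\partial t_n$. Taking differential
parts, $B_n=\sum_k c_{n,k}(M^k)_++z_n$, and $L=e^{-f_0}Me^{f_0}$ satisfies $\partial L/\partial
t_n=\sum_{k\le n}(\partial\tilde t_k/\partial t_n)[(L^k)_+,L]$. Since $c_{n,n}=1$ and $c_{n,k}=0$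
for $k>n$, the new times are triangular: the substitution is invertible, and its chain rule
(`Triangular.pderiv_subst`) yields the Lax equations.

For the last claim, $M$ is first shifted by a scalar so that its coefficient $u_0$ has no constant
term. If $b_{n,n-1}=0$, then $(n+1)u_0+c_{n+1,n}=0$, which makes $u_0$ independent of $x$ and of all
times, hence zero. Then $\partial f_0=0$ and the conjugation is trivial.

Both choices of $\mathcal R$ are treated at once as `bddSubring A I`, with `I` equal to `⊥` or `⊤`.
-/

@[ext]
theorem ext {P Q : MicroDiff R} (h : ∀ k, P.coeff k = Q.coeff k) : P = Q :=
  Subtype.ext (funext h)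

@[simp] theorem coeff_add (P Q : MicroDiff R) (k : ℤ) :
    (P + Q).coeff k = P.coeff k + Q.coeff k := rfl

@[simp] theorem coeff_sub (P Q : MicroDiff R) (k : ℤ) :
    (P - Q).coeff k = P.coeff k - Q.coeff k := rfl

@[simp] theorem coeff_neg (P : MicroDiff R) (k : ℤ) : (-P).coeff k = -P.coeff k := rfl

@[simp] theorem coeff_zero (k : ℤ) : (0 : MicroDiff R).coeff k = 0 := rfl

theorem coeff_ofFun (c : R) (k : ℤ) : (ofFun c).coeff k = if k = 0 then c else 0 := rfl

theorem coeff_plus (P : MicroDiff R) (k : ℤ) :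
    P.plus.coeff k = if 0 ≤ k then P.coeff k else 0 := rfl

theorem coeff_map (φ : R →+ R) (P : MicroDiff R) (k : ℤ) :
    (P.map φ).coeff k = φ (P.coeff k) := rfl

/-- The coefficient of `∂^k` as an additive map. -/
def coeffHom (k : ℤ) : MicroDiff R →+ R where
  toFun P := P.coeff k
  map_zero' := rfl
  map_add' _ _ := rfl

theorem coeff_sum {ι : Type*} (s : Finset ι) (P : ι → MicroDiff R) (k : ℤ) :
    (∑ i ∈ s, P i).coeff k = ∑ i ∈ s, (P i).coeff k :=
  map_sum (coeffHom k) P s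

/-- `P` has order at most `N`. -/
def OrdLE (P : MicroDiff R) (N : ℤ) : Prop := ∀ k, N < k → P.coeff k = 0

theorem exists_ordLE (P : MicroDiff R) : ∃ N, P.OrdLE N := P.2

theorem OrdLE.mono {P : MicroDiff R} {N M : ℤ} (h : P.OrdLE N) (hNM : N ≤ M) : P.OrdLE M :=
  fun k hk => h k (hNM.trans_lt hk)

theorem OrdLE.add {P Q : MicroDiff R} {N : ℤ} (hP : P.OrdLE N) (hQ : Q.OrdLE N) :
    (P + Q).OrdLE N := fun k hk => by simp [hP k hk, hQ k hk]

theorem OrdLE.sub {P Q : MicroDiff R} {N : ℤ} (hP : P.OrdLE N) (hQ : Q.OrdLE N) :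
    (P - Q).OrdLE N := fun k hk => by simp [hP k hk, hQ k hk]

theorem OrdLE.neg {P : MicroDiff R} {N : ℤ} (hP : P.OrdLE N) : (-P).OrdLE N :=
  fun k hk => by simp [hP k hk]

theorem ordLE_zero (N : ℤ) : (0 : MicroDiff R).OrdLE N := fun _ _ => rfl

theorem ordLE_sum {ι : Type*} {s : Finset ι} {P : ι → MicroDiff R} {N : ℤ}
    (h : ∀ i ∈ s, (P i).OrdLE N) : (∑ i ∈ s, P i).OrdLE N := fun k hk => by
  rw [coeff_sum, Finset.sum_eq_zero fun i hi => h i hi k hk]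

theorem ordLE_ofFun (c : R) : (ofFun c).OrdLE 0 := fun k hk => by
  rw [coeff_ofFun, if_neg hk.ne']

theorem OrdLE.pred {P : MicroDiff R} {N : ℤ} (hP : P.OrdLE N) (h : P.coeff N = 0) :
    P.OrdLE (N - 1) := fun k hk => by
  rcases eq_or_ne k N with rfl | hne
  · exact h
  · exact hP k (by omega)

theorem eq_zero_of_forall_ordLE {P : MicroDiff R} (h : ∀ n : ℕ, P.OrdLE (-n)) : P = 0 := by
  ext k
  exact h (k.natAbs + 1) k (by omega)

/-- The operator `a ∂^l`. -/
def mono (a : R) (l : ℤ) : MicroDiff R :=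
  ⟨fun k => if k = l then a else 0, ⟨l, fun _ hk => if_neg hk.ne'⟩⟩

theorem coeff_mono (a : R) (l k : ℤ) : (mono a l).coeff k = if k = l then a else 0 := rfl

theorem ordLE_mono (a : R) (l : ℤ) : (mono a l).OrdLE l := fun _ hk => if_neg hk.ne'

theorem exists_sum_mono (P : MicroDiff R) (K : ℤ) :
    ∃ s : Finset ℤ, (P - ∑ l ∈ s, mono (P.coeff l) l).OrdLE K := by
  obtain ⟨N, hN⟩ := P.exists_ordLE
  refine ⟨Finset.Icc K N, fun k hk => ?_⟩
  simp only [coeff_sub, coeff_sum, coeff_mono, Finset.sum_ite_eq, Finset.mem_Icc]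
  split_ifs with h
  · simp
  · simp [hN k (by omega)]

/-- Modulo operators of order at most `K`, every operator is a finite sum of monomials. This allows
multilinear identities between infinite sums to be checked on monomials. -/
theorem map_sum_mono {φ : MicroDiff R →+ R} {K : ℤ} (hφ : ∀ P, P.OrdLE K → φ P = 0)
    (h : ∀ a l, φ (mono a l) = 0) (P : MicroDiff R) : φ P = 0 := by
  obtain ⟨s, hs⟩ := P.exists_sum_mono K
  have := hφ _ hs
  rwa [map_sub, map_sum, sum_eq_zero fun l _ => h _ l, sub_zero] at this

variable [Differential R]

variable (R) in
/-- The `r`-th derivative. -/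
def iterDeriv (r : ℕ) : R →+ R where
  toFun := (fun b : R => b′)^[r]
  map_zero' := by
    induction r with
    | zero => rfl
    | succ r ih => rw [Function.iterate_succ_apply', ih, map_zero]
  map_add' a b := by
    induction r with
    | zero => rfl
    | succ r ih => simp only [Function.iterate_succ_apply', ih, map_add]

@[simp] theorem iterDeriv_zero (a : R) : iterDeriv R 0 a = a := rfl

theorem iterDeriv_succ (r : ℕ) (a : R) : iterDeriv R (r + 1) a = (iterDeriv R r a)′ :=
  Function.iterate_succ_apply' _ _ _

@[simp] theorem iterDeriv_one (a : R) : iterDeriv R 1 a = a′ := rfl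

theorem iterDeriv_add (r s : ℕ) (a : R) :
    iterDeriv R (r + s) a = iterDeriv R r (iterDeriv R s a) :=
  Function.iterate_add_apply _ _ _ _

theorem iterDeriv_eq_zero {r : ℕ} (hr : r ≠ 0) {a : R} (ha : a′ = 0) : iterDeriv R r a = 0 := by
  obtain ⟨r, rfl⟩ := Nat.exists_eq_succ_of_ne_zero hr
  rw [Nat.succ_eq_add_one, iterDeriv_add, iterDeriv_one, ha, map_zero]

theorem iterDeriv_mul (r : ℕ) (a b : R) :
    iterDeriv R r (a * b) =
      ∑ p ∈ antidiagonal r, r.choose p.1 • (iterDeriv R p.1 a * iterDeriv R p.2 b) := by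
  induction r with
  | zero => simp
  | succ r ih =>
    rw [iterDeriv_succ, ih, map_sum,
      sum_antidiagonal_choose_succ_nsmul (fun i j => iterDeriv R i a * iterDeriv R j b),
      ← sum_add_distrib]
    refine sum_congr rfl fun p hp => ?_
    rw [HasAntidiagonal.mem_antidiagonal] at hp
    rw [map_nsmul, Derivation.leibniz, smul_eq_mul, smul_eq_mul, ← iterDeriv_succ,
      ← iterDeriv_succ, smul_add, mul_comm (iterDeriv R p.2 b), ← hp, Nat.choose_symm_add]

theorem coeff_mul (P Q : MicroDiff R) (k : ℤ) : (P * Q).coeff k =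
    ∑ᶠ p : ℤ × ℕ,
      Ring.choose p.1 p.2 • (P.coeff p.1 * iterDeriv R p.2 (Q.coeff (k - p.1 + p.2))) := rfl

theorem support_mul_subset {P Q : MicroDiff R} {N M : ℤ} (hP : P.OrdLE N) (hQ : Q.OrdLE M)
    (q : ℕ) :
    (Function.support fun p : ℤ × ℕ => Ring.choose p.1 p.2 •
      (P.coeff p.1 * iterDeriv R p.2 (Q.coeff (N + M - q - p.1 + p.2)))) ⊆
    ((antidiagonal q).sigma (fun v => antidiagonal v.2)).image
      (fun v => ((N - v.1.1, v.2.1) : ℤ × ℕ)) := by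
  rintro ⟨l, r⟩ h
  rw [Function.mem_support] at h
  have h1 : l ≤ N := not_lt.1 fun hl => h (by simp [hP l hl])
  have h2 : N + M - q - l + r ≤ M := not_lt.1 fun hl => h (by simp [hQ _ hl])
  simp only [coe_image, Set.mem_image, mem_coe, mem_sigma, HasAntidiagonal.mem_antidiagonal, Prod.mk.injEq]
  -- The deficit `q` splits into three parts: the drop `N - l` in the first factor, the number `r`
  -- of derivatives, and the drop from `M` in the second factor.
  exact ⟨⟨((N - l).toNat, q - (N - l).toNat), (r, q - (N - l).toNat - r)⟩,
    ⟨by simp only; omega, by simp only; omega⟩, by simp only; omega, rfl⟩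

theorem finite_support_mul (P Q : MicroDiff R) (k : ℤ) :
    (Function.support fun p : ℤ × ℕ => Ring.choose p.1 p.2 •
      (P.coeff p.1 * iterDeriv R p.2 (Q.coeff (k - p.1 + p.2)))).Finite := by
  obtain ⟨N, hN⟩ := P.exists_ordLE
  obtain ⟨M, hM⟩ := Q.exists_ordLE
  -- The bound `M` is enlarged so that `k` does not exceed the sum of the bounds and the deficit `q`
  -- is a natural number.
  have hM' : Q.OrdLE (max M (k - N)) := hM.mono (le_max_left _ _)
  obtain ⟨q, hq⟩ : ∃ q : ℕ, N + max M (k - N) - q = k :=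
    ⟨(N + max M (k - N) - k).toNat, by omega⟩
  have := support_mul_subset hN hM' q
  rw [hq] at this
  exact (Finset.finite_toSet _).subset this

/-- The product formula as a finite sum, for operators of order at most `N` and `M`. -/
theorem coeff_mul_sub {P Q : MicroDiff R} {N M : ℤ} (hP : P.OrdLE N) (hQ : Q.OrdLE M) (q : ℕ) :
    (P * Q).coeff (N + M - q) = ∑ v ∈ antidiagonal q, ∑ w ∈ antidiagonal v.2,
      Ring.choose (N - v.1) w.1 •
        (P.coeff (N - v.1) * iterDeriv R w.1 (Q.coeff (M - w.2))) := by
  rw [coeff_mul, finsum_eq_sum_of_support_subset _ (support_mul_subset hP hQ q),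
    sum_image, sum_sigma]
  · refine sum_congr rfl fun v hv => sum_congr rfl fun w hw => ?_
    rw [HasAntidiagonal.mem_antidiagonal] at hv hw
    rw [show N + M - (q : ℤ) - (N - (v.1 : ℤ)) + (w.1 : ℤ) = M - w.2 by omega]
  · rintro ⟨⟨a, b⟩, ⟨c, d⟩⟩ h ⟨⟨a', b'⟩, ⟨c', d'⟩⟩ h' e
    simp only [mem_coe, mem_sigma, HasAntidiagonal.mem_antidiagonal, Prod.mk.injEq] at h h' e
    obtain ⟨rfl, rfl⟩ : a = a' ∧ c = c' := by omega
    obtain rfl : b = b' := by omega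
    obtain rfl : d = d' := by omega
    rfl

theorem OrdLE.mul {P Q : MicroDiff R} {N M : ℤ} (hP : P.OrdLE N) (hQ : Q.OrdLE M) :
    (P * Q).OrdLE (N + M) := fun k hk => by
  rw [coeff_mul]
  refine finsum_eq_zero_of_forall_eq_zero fun p => ?_
  by_cases hp : N < p.1
  · simp [hP p.1 hp]
  · simp [hQ (k - p.1 + p.2) (by omega)]

theorem coeff_mul_top {P Q : MicroDiff R} {N M : ℤ} (hP : P.OrdLE N) (hQ : Q.OrdLE M) :
    (P * Q).coeff (N + M) = P.coeff N * Q.coeff M := by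
  simpa using coeff_mul_sub hP hQ 0

theorem coeff_mul_sub_one {P Q : MicroDiff R} {N M : ℤ} (hP : P.OrdLE N) (hQ : Q.OrdLE M) :
    (P * Q).coeff (N + M - 1) =
      P.coeff N * Q.coeff (M - 1) + N • (P.coeff N * (Q.coeff M)′) +
        P.coeff (N - 1) * Q.coeff M := by
  simpa [Nat.antidiagonal_succ] using coeff_mul_sub hP hQ 1

protected theorem mul_add (P Q Q' : MicroDiff R) : P * (Q + Q') = P * Q + P * Q' := by
  ext k
  rw [coeff_add, coeff_mul, coeff_mul, coeff_mul,
    ← finsum_add_distrib (finite_support_mul P Q k) (finite_support_mul P Q' k)]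
  exact finsum_congr fun p => by rw [coeff_add, map_add, mul_add, smul_add]

protected theorem add_mul (P P' Q : MicroDiff R) : (P + P') * Q = P * Q + P' * Q := by
  ext k
  rw [coeff_add, coeff_mul, coeff_mul, coeff_mul,
    ← finsum_add_distrib (finite_support_mul P Q k) (finite_support_mul P' Q k)]
  exact finsum_congr fun p => by rw [coeff_add, add_mul, smul_add]

theorem coeff_mono_mul_sub {Q : MicroDiff R} {M : ℤ} (hQ : Q.OrdLE M) (a : R) (l : ℤ) (q : ℕ) :
    (mono a l * Q).coeff (l + M - q) = ∑ w ∈ antidiagonal q,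
      Ring.choose l w.1 • (a * iterDeriv R w.1 (Q.coeff (M - w.2))) := by
  rw [coeff_mul_sub (ordLE_mono a l) hQ]
  rw [sum_eq_single (0, q)]
  · simp [coeff_mono]
  · rintro ⟨i, j⟩ hv hne
    rw [HasAntidiagonal.mem_antidiagonal] at hv
    have : i ≠ 0 := by
      rintro rfl
      exact hne (by simp_all)
    simp [coeff_mono, this]
  · simp

theorem coeff_mul_mono_sub {P : MicroDiff R} {N : ℤ} (hP : P.OrdLE N) (c : R) (m : ℤ) (q : ℕ) :
    (P * mono c m).coeff (N + m - q) = ∑ v ∈ antidiagonal q,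
      Ring.choose (N - v.1) v.2 • (P.coeff (N - v.1) * iterDeriv R v.2 c) := by
  rw [coeff_mul_sub hP (ordLE_mono c m)]
  refine sum_congr rfl fun v _ => ?_
  rw [sum_eq_single (v.2, 0)]
  · simp [coeff_mono]
  · rintro ⟨i, j⟩ hw hne
    rw [HasAntidiagonal.mem_antidiagonal] at hw
    have : j ≠ 0 := by
      rintro rfl
      exact hne (by simp_all)
    simp [coeff_mono, this]
  · simp

theorem coeff_mono_mul_mono (a b : R) (l m : ℤ) (q : ℕ) :
    (mono a l * mono b m).coeff (l + m - q) = Ring.choose l q • (a * iterDeriv R q b) := by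
  rw [coeff_mono_mul_sub (ordLE_mono b m), sum_eq_single (q, 0)]
  · simp [coeff_mono]
  · rintro ⟨i, j⟩ hw hne
    rw [HasAntidiagonal.mem_antidiagonal] at hw
    have : j ≠ 0 := by
      rintro rfl
      exact hne (by simp_all)
    simp [coeff_mono, this]
  · simp

/-- Chu–Vandermonde for $(l-r)+m$, combined with $\binom lr\binom{l-r}{i}=\binom
l{r+i}\binom{r+i}r$. This is the combinatorial content of associativity. -/
theorem choose_mul_choose_sum (l m : ℤ) (r s : ℕ) :
    Ring.choose (l + m - r) s * Ring.choose l r = ∑ p ∈ antidiagonal s,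
      Ring.choose l (r + p.1) * Ring.choose m p.2 * ((r + p.1).choose r : ℤ) := by
  rw [show l + m - r = (l - r) + m by ring, Ring.add_choose_eq s (Commute.all _ _), sum_mul]
  refine sum_congr rfl fun p _ => ?_
  have h := Ring.choose_smul_choose l (Nat.le_add_right r p.1)
  rw [Nat.add_sub_cancel_left, nsmul_eq_mul] at h
  linear_combination (-Ring.choose m p.2) * h

theorem mono_mul_assoc (a b c : R) (l m n : ℤ) :
    mono a l * mono b m * mono c n = mono a l * (mono b m * mono c n) := by
  have hlm := (ordLE_mono a l).mul (ordLE_mono b m)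
  have hmn := (ordLE_mono b m).mul (ordLE_mono c n)
  ext k
  by_cases hk : l + m + n < k
  · rw [hlm.mul (ordLE_mono c n) k hk, (ordLE_mono a l).mul hmn k (by omega)]
  obtain ⟨q, rfl⟩ : ∃ q : ℕ, k = l + m + n - q := ⟨(l + m + n - k).toNat, by omega⟩
  rw [coeff_mul_mono_sub hlm, show l + m + n - (q : ℤ) = l + (m + n) - q by ring,
    coeff_mono_mul_sub hmn]
  simp only [coeff_mono_mul_mono, map_zsmul, iterDeriv_mul, Finset.mul_sum, Finset.smul_sum,
    ← iterDeriv_add]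
  have hL : ∀ v ∈ antidiagonal q,
      Ring.choose (l + m - (v.1 : ℤ)) v.2 •
        (Ring.choose l v.1 • (a * iterDeriv R v.1 b) * iterDeriv R v.2 c) =
      ∑ p ∈ antidiagonal v.2, (Ring.choose l (v.1 + p.1) * Ring.choose m p.2 *
        ((v.1 + p.1).choose v.1 : ℤ)) • (a * iterDeriv R v.1 b * iterDeriv R (p.1 + p.2) c) := by
    intro v _
    rw [smul_mul_assoc, smul_smul, choose_mul_choose_sum, sum_smul]
    refine sum_congr rfl fun p hp => ?_
    rw [HasAntidiagonal.mem_antidiagonal.1 hp]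
  rw [sum_congr rfl hL]
  simp only [Finset.sum_sigma']
  -- Both sides run over triples: derivatives from $\partial^l$ falling on `b`, those from
  -- $\partial^l$ falling on `c`, and those from $\partial^m$ falling on `c`. Only the grouping
  -- differs.
  refine sum_nbij' (fun x => ⟨(x.1.1 + x.2.1, x.2.2), (x.1.1, x.2.1)⟩)
    (fun x => ⟨(x.2.1, x.2.2 + x.1.2), (x.2.2, x.1.2)⟩) ?_ ?_ ?_ ?_ ?_
  · rintro ⟨⟨i, j⟩, ⟨k, l⟩⟩ h
    simp only [mem_sigma, HasAntidiagonal.mem_antidiagonal] at h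
    obtain ⟨rfl, rfl⟩ := h
    simp [add_assoc]
  · rintro ⟨⟨i, j⟩, ⟨k, l⟩⟩ h
    simp only [mem_sigma, HasAntidiagonal.mem_antidiagonal] at h
    obtain ⟨rfl, rfl⟩ := h
    simp [add_assoc]
  · rintro ⟨⟨i, j⟩, ⟨k, l⟩⟩ h
    simp only [mem_sigma, HasAntidiagonal.mem_antidiagonal] at h
    obtain ⟨rfl, rfl⟩ := h
    rfl
  · rintro ⟨⟨i, j⟩, ⟨k, l⟩⟩ h
    simp only [mem_sigma, HasAntidiagonal.mem_antidiagonal] at h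
    obtain ⟨rfl, rfl⟩ := h
    rfl
  · rintro ⟨⟨i, j⟩, ⟨k, l⟩⟩ h
    simp only [zsmul_eq_mul, nsmul_eq_mul]
    push_cast
    ring

/-- Left multiplication as an additive map. -/
def mulHom : MicroDiff R →+ MicroDiff R →+ MicroDiff R :=
  AddMonoidHom.mk' (fun P => AddMonoidHom.mk' (fun Q => P * Q) (MicroDiff.mul_add P))
    fun P P' => AddMonoidHom.ext fun Q => MicroDiff.add_mul P P' Q

protected theorem mul_assoc (P Q T : MicroDiff R) : P * Q * T = P * (Q * T) := by
  let assocL : MicroDiff R →+ MicroDiff R →+ MicroDiff R →+ MicroDiff R :=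
    AddMonoidHom.mk' (fun P => mulHom.comp (mulHom P)) fun P P' => by
      rw [map_add, AddMonoidHom.comp_add]
  let assocR : MicroDiff R →+ MicroDiff R →+ MicroDiff R →+ MicroDiff R :=
    AddMonoidHom.mk' (fun P => AddMonoidHom.mk' (fun Q => (mulHom P).comp (mulHom Q))
      fun Q Q' => by rw [map_add, AddMonoidHom.comp_add]) fun P P' => by
        ext Q : 1
        simp only [AddMonoidHom.mk'_apply, map_add, AddMonoidHom.add_comp, AddMonoidHom.add_apply]
  have key : ∀ k P Q T, ((P * Q * T - P * (Q * T) : MicroDiff R)).coeff k =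
      coeffHom k ((assocL - assocR) P Q T) := fun _ _ _ _ => rfl
  ext k
  rw [← sub_eq_zero, ← coeff_sub]
  obtain ⟨N, hN⟩ := P.exists_ordLE
  obtain ⟨M, hM⟩ := Q.exists_ordLE
  have hord : ∀ {P Q T : MicroDiff R} {a b c : ℤ}, P.OrdLE a → Q.OrdLE b → T.OrdLE c →
      a + b + c < k → (P * Q * T - P * (Q * T)).coeff k = 0 := by
    intro P Q T a b c ha hb hc h
    rw [coeff_sub, (ha.mul hb).mul hc k h, ha.mul (hb.mul hc) k (by omega), sub_zero]
  rw [key]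
  -- The factors are reduced to monomials one at a time. Each threshold `K` makes the associator
  -- have order below `k` as soon as that factor has order at most `K`.
  refine map_sum_mono (φ := (coeffHom k).comp ((assocL - assocR) P Q)) (K := k - 1 - N - M)
    (fun T hT => hord hN hM hT (by omega)) (fun c n => ?_) T
  refine map_sum_mono (φ := (coeffHom k).comp (((assocL - assocR) P).flip (mono c n)))
    (K := k - 1 - N - n) (fun Q hQ => hord hN hQ (ordLE_mono c n) (by omega)) (fun b m => ?_) Q
  refine map_sum_mono (φ := (coeffHom k).comp ((((assocL - assocR)).flip (mono b m)).flip
    (mono c n))) (K := k - 1 - m - n)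
    (fun P hP => hord hP (ordLE_mono b m) (ordLE_mono c n) (by omega)) (fun a l => ?_) P
  refine (key k (mono a l) (mono b m) (mono c n)).symm.trans ?_
  rw [mono_mul_assoc, sub_self, coeff_zero]

theorem coeff_ofFun_mul (c : R) (Q : MicroDiff R) (k : ℤ) :
    (ofFun c * Q).coeff k = c * Q.coeff k := by
  rw [coeff_mul, finsum_eq_single _ (0, 0)]
  · simp [coeff_ofFun]
  · rintro ⟨l, r⟩ hne
    by_cases hl : l = 0
    · subst hl
      have hr : 0 < r := Nat.pos_of_ne_zero (by rintro rfl; exact hne rfl)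
      simp [Ring.choose_zero_pos ℤ hr]
    · simp [coeff_ofFun, hl]

protected theorem one_mul (Q : MicroDiff R) : 1 * Q = Q := by
  ext k
  exact (coeff_ofFun_mul 1 Q k).trans (one_mul _)

theorem coeff_mul_ofFun {c : R} (hc : c′ = 0) (P : MicroDiff R) (k : ℤ) :
    (P * ofFun c).coeff k = c * P.coeff k := by
  rw [coeff_mul, finsum_eq_single _ (k, 0)]
  · simp [coeff_ofFun, mul_comm]
  · rintro ⟨l, r⟩ hne
    by_cases hl : k - l + r = 0
    · have hr : r ≠ 0 := by
        rintro rfl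
        exact hne (by simp only [Prod.mk.injEq, and_true]; push_cast at hl; omega)
      simp [coeff_ofFun, hl, iterDeriv_eq_zero hr hc]
    · simp [coeff_ofFun, hl]

protected theorem mul_one (Q : MicroDiff R) : Q * 1 = Q := by
  ext k
  exact (coeff_mul_ofFun (Derivation.map_one_eq_zero _) Q k).trans (one_mul _)

variable (R) in
/-- Microdifferential operators form a ring. -/
abbrev ringStructure : Ring (MicroDiff R) :=
  { (inferInstance : AddCommGroup (MicroDiff R)) with
    mul := (· * ·)
    one := 1
    left_distrib := MicroDiff.mul_add
    right_distrib := MicroDiff.add_mul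
    zero_mul := fun P => map_zero (mulHom.flip P)
    mul_zero := fun P => map_zero (mulHom P)
    mul_assoc := MicroDiff.mul_assoc
    one_mul := MicroDiff.one_mul
    mul_one := MicroDiff.mul_one
    -- The monoid power is the given `Pow` instance, so ring lemmas apply to the powers $L^n$ of the
    -- statement.
    npow := fun n P => P ^ n
    npow_zero := fun _ => rfl
    npow_succ := fun _ _ => rfl }

end Ring

end MicroDiff

end KP

end

/-! ### Order filtration: inverses, derivations, expansions, roots and differential parts. -/

noncomputable section

namespace KP

namespace MicroDiff

open Finset

set_option linter.unusedSectionVars false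

section Algebra

variable {R : Type*} [CommRing R] [Differential R]

attribute [local instance] ringStructure

theorem coeff_one (k : ℤ) : (1 : MicroDiff R).coeff k = if k = 0 then 1 else 0 := rfl

theorem ordLE_one : (1 : MicroDiff R).OrdLE 0 := ordLE_ofFun 1

variable (R) in
/-- Multiplication operators, as a ring homomorphism. -/
def ofFunHom : R →+* MicroDiff R where
  toFun := ofFun
  map_zero' := by ext k; simp [coeff_ofFun]
  map_one' := rfl
  map_add' a b := by ext k; simp only [coeff_ofFun, coeff_add]; split_ifs <;> simp
  map_mul' a b := by
    ext k
    rw [coeff_ofFun_mul, coeff_ofFun, coeff_ofFun, mul_ite, mul_zero]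

theorem ofFun_mul (a b : R) : ofFun (a * b) = ofFun a * ofFun b := map_mul (ofFunHom R) a b

theorem ofFun_sub (a b : R) : ofFun (a - b) = ofFun a - ofFun b := map_sub (ofFunHom R) a b

theorem ofFun_zero : ofFun (0 : R) = 0 := map_zero (ofFunHom R)

theorem ofFun_one : ofFun (1 : R) = 1 := rfl

/-- Multiplication by a constant is central. -/
theorem ofFun_mul_comm {c : R} (hc : c′ = 0) (P : MicroDiff R) : ofFun c * P = P * ofFun c := by
  ext k
  rw [coeff_ofFun_mul, coeff_mul_ofFun hc]

theorem OrdLE.ofFun_mul {P : MicroDiff R} {N : ℤ} (hP : P.OrdLE N) (c : R) :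
    (ofFun c * P).OrdLE N := fun k hk => by rw [coeff_ofFun_mul, hP k hk, mul_zero]

theorem IsMonic.ordLE {P : MicroDiff R} {N : ℤ} (h : P.IsMonic N) : P.OrdLE N := h.2

theorem isMonic_one : (1 : MicroDiff R).IsMonic 0 := ⟨rfl, ordLE_one⟩

theorem IsMonic.mul {P Q : MicroDiff R} {N M : ℤ} (hP : P.IsMonic N) (hQ : Q.IsMonic M) :
    (P * Q).IsMonic (N + M) :=
  ⟨by rw [coeff_mul_top hP.ordLE hQ.ordLE, hP.1, hQ.1, mul_one], hP.ordLE.mul hQ.ordLE⟩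

theorem IsMonic.pow {P : MicroDiff R} (hP : P.IsMonic 1) (n : ℕ) : (P ^ n).IsMonic n := by
  induction n with
  | zero => simpa using isMonic_one
  | succ n ih =>
    rw [pow_succ]
    exact_mod_cast ih.mul hP

theorem IsMonic.coeff_pow_sub_one {P : MicroDiff R} (hP : P.IsMonic 1) (n : ℕ) :
    (P ^ n).coeff (n - 1) = n * P.coeff 0 := by
  induction n with
  | zero => simp [coeff_one]
  | succ n ih =>
    have h := coeff_mul_sub_one (hP.pow n).ordLE hP.ordLE
    rw [pow_succ, show ((n + 1 : ℕ) : ℤ) - 1 = n + 1 - 1 by push_cast; ring, h, ih, hP.1,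
      (hP.pow n).1]
    simp
    ring

/-- The leading coefficients lie in a commutative ring, so the top terms cancel. -/
theorem OrdLE.comm {P Q : MicroDiff R} {N M : ℤ} (hP : P.OrdLE N) (hQ : Q.OrdLE M) :
    (P * Q - Q * P).OrdLE (N + M - 1) := by
  refine OrdLE.pred ((hP.mul hQ).sub ((hQ.mul hP).mono (by omega))) ?_
  rw [coeff_sub, coeff_mul_top hP hQ, add_comm, coeff_mul_top hQ hP, mul_comm, sub_self]

theorem coeff_comm_top {P Q : MicroDiff R} {N M : ℤ} (hP : P.OrdLE N) (hQ : Q.OrdLE M) :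
    (P * Q - Q * P).coeff (N + M - 1) =
      N • (P.coeff N * (Q.coeff M)′) - M • (Q.coeff M * (P.coeff N)′) := by
  rw [coeff_sub, coeff_mul_sub_one hP hQ, add_comm N M, coeff_mul_sub_one hQ hP]
  simp only [zsmul_eq_mul]
  ring

/-- A lower bound for the order is propagated downwards. -/
theorem ordLE_of_step {P : MicroDiff R} {e : ℤ}
    (h : ∀ d, e < d → P.OrdLE d → P.coeff d = 0) : P.OrdLE e := by
  obtain ⟨N, hN⟩ := P.exists_ordLE
  have key : ∀ j : ℕ, P.OrdLE (max e (N - j)) := by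
    intro j
    induction j with
    | zero => exact hN.mono (by simp)
    | succ j ih =>
      by_cases hj : e < N - j
      · rw [max_eq_right hj.le] at ih
        exact (ih.pred (h _ hj ih)).mono (by push_cast; omega)
      · exact ih.mono (by push_cast; omega)
  exact (key (N - e).toNat).mono (by omega)

/-! ### Operators with coefficients in a differential subring -/

/-- The operators whose coefficients lie in a subring closed under derivation. -/
def opSubring (T : Subring R) (hT : ∀ a ∈ T, a′ ∈ T) : Subring (MicroDiff R) where
  carrier := {P | ∀ k, P.coeff k ∈ T}
  zero_mem' _ := T.zero_mem
  one_mem' k := by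
    rw [coeff_one]
    split_ifs
    exacts [T.one_mem, T.zero_mem]
  add_mem' hP hQ k := T.add_mem (hP k) (hQ k)
  neg_mem' hP k := T.neg_mem (hP k)
  mul_mem' {P Q} hP hQ k := by
    have hT' : ∀ (r : ℕ) (a : R), a ∈ T → iterDeriv R r a ∈ T := by
      intro r a ha
      induction r with
      | zero => exact ha
      | succ r ih => rw [iterDeriv_succ]; exact hT _ ih
    rw [coeff_mul]
    exact finsum_induction (· ∈ T) T.zero_mem (fun _ _ => T.add_mem)
      fun p => T.zsmul_mem (T.mul_mem (hP _) (hT' _ _ (hQ _))) _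

theorem mono_mem_opSubring {T : Subring R} {hT : ∀ a ∈ T, a′ ∈ T} {a : R} (ha : a ∈ T) (l : ℤ) :
    mono a l ∈ opSubring T hT := fun k => by
  rw [coeff_mono]
  split_ifs
  exacts [ha, T.zero_mem]

theorem ofFun_mem_opSubring {T : Subring R} {hT : ∀ a ∈ T, a′ ∈ T} {a : R} (ha : a ∈ T) :
    ofFun a ∈ opSubring T hT := mono_mem_opSubring ha 0

/-! ### Inverses -/

/-- Operators are complete with respect to the order filtration. -/
theorem exists_limit (F : ℕ → MicroDiff R) (hF : ∀ n, (F (n + 1) - F n).OrdLE (-n)) :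
    ∃ P : MicroDiff R, (∀ n, (P - F n).OrdLE (-n)) ∧ ∀ k, ∃ n, P.coeff k = (F n).coeff k := by
  have hmono : ∀ n m, n ≤ m → (F m - F n).OrdLE (-n) := by
    intro n m hnm
    induction m, hnm using Nat.le_induction with
    | base => rw [sub_self]; exact ordLE_zero _
    | succ m hm ih =>
      rw [← sub_add_sub_cancel]
      exact ((hF m).mono (by omega)).add ih
  have hst : ∀ (k : ℤ) (n m : ℕ), -(n : ℤ) < k → -(m : ℤ) < k → (F n).coeff k = (F m).coeff k := by
    intro k n m hn hm
    rcases le_total n m with h | h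
    · exact (sub_eq_zero.1 (hmono n m h k hn)).symm
    · exact sub_eq_zero.1 (hmono m n h k hm)
  obtain ⟨N, hN⟩ := (F 0).exists_ordLE
  refine ⟨⟨fun k => (F (k.natAbs + 1)).coeff k, max N 0, fun k hk => ?_⟩, fun n k hk => ?_,
    fun k => ⟨k.natAbs + 1, rfl⟩⟩
  · exact (hst k _ 0 (by omega) (by simp; omega)).trans (hN k (by omega))
  · exact sub_eq_zero.2 (hst k (k.natAbs + 1) n (by omega) hk)

theorem OrdLE.pow {X : MicroDiff R} {d : ℤ} (hX : X.OrdLE d) (n : ℕ) : (X ^ n).OrdLE (n * d) := by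
  induction n with
  | zero => simpa using ordLE_one
  | succ n ih =>
    rw [pow_succ]
    exact (ih.mul hX).mono (by push_cast; linarith)

/-- The geometric series converges because $X^n$ has order at most $-n$. Each coefficient of the
limit already occurs in a partial sum, which keeps it in any differential subring containing the
coefficients of `X`. -/
theorem exists_inv_one_sub {X : MicroDiff R} (hX : X.OrdLE (-1)) :
    ∃ G : MicroDiff R, (1 - X) * G = 1 ∧ G * (1 - X) = 1 ∧ (G - 1).OrdLE (-1) ∧
      ∀ T hT, X ∈ opSubring T hT → G ∈ opSubring T hT := by
  have hXn : ∀ n : ℕ, (X ^ n).OrdLE (-n) := fun n => (hX.pow n).mono (by omega)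
  have h1X : (1 - X).OrdLE 0 := ordLE_one.sub (hX.mono (by omega))
  obtain ⟨G, hG, hG'⟩ := exists_limit (fun n => ∑ i ∈ range n, X ^ i) fun n => by
    rw [sum_range_succ, add_sub_cancel_left]
    exact hXn n
  refine ⟨G, ?_, ?_, ?_, fun T hT hXT k => ?_⟩
  · refine sub_eq_zero.1 (eq_zero_of_forall_ordLE fun n => ?_)
    have : (1 - X) * G - 1 = (1 - X) * (G - ∑ i ∈ range n, X ^ i) - X ^ n := by
      rw [mul_sub (1 - X) G, mul_neg_geom_sum]
      abel
    rw [this]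
    exact ((h1X.mul (hG n)).mono (by omega)).sub (hXn n)
  · refine sub_eq_zero.1 (eq_zero_of_forall_ordLE fun n => ?_)
    have : G * (1 - X) - 1 = (G - ∑ i ∈ range n, X ^ i) * (1 - X) - X ^ n := by
      rw [sub_mul G, geom_sum_mul_neg]
      abel
    rw [this]
    exact (((hG n).mul h1X).mono (by omega)).sub (hXn n)
  · simpa using hG 1
  · obtain ⟨n, hn⟩ := hG' k
    rw [hn]
    exact (sum_mem fun i _ => pow_mem hXT i : ∑ i ∈ range n, X ^ i ∈ opSubring T hT) k

theorem mono_one_mul_mono_one (l m : ℤ) : mono (1 : R) l * mono 1 m = mono 1 (l + m) := by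
  ext k
  by_cases hk : l + m < k
  · rw [(ordLE_mono 1 l).mul (ordLE_mono 1 m) k hk, ordLE_mono 1 (l + m) k hk]
  obtain ⟨q, rfl⟩ : ∃ q : ℕ, k = l + m - q := ⟨(l + m - k).toNat, by omega⟩
  rw [coeff_mono_mul_mono, coeff_mono]
  rcases eq_or_ne q 0 with rfl | hq
  · simp
  · rw [iterDeriv_eq_zero hq (Derivation.map_one_eq_zero _), mul_zero, smul_zero, if_neg (by omega)]

/-- The operator $\partial^{-N}P$ is monic of order zero, hence of the form $1-X$ with $X$ of
negative order. -/
theorem IsMonic.exists_inv {P : MicroDiff R} {N : ℤ} (hP : P.IsMonic N) :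
    ∃ Q : MicroDiff R, P * Q = 1 ∧ Q * P = 1 ∧ Q.IsMonic (-N) ∧
      ∀ T hT, P ∈ opSubring T hT → Q ∈ opSubring T hT := by
  have hm : (mono (1 : R) (-N)).IsMonic (-N) := ⟨by simp [coeff_mono], ordLE_mono _ _⟩
  have hmP := hm.mul hP
  rw [neg_add_cancel] at hmP
  have hX : (1 - mono 1 (-N) * P).OrdLE (-1) :=
    OrdLE.pred (N := 0) (ordLE_one.sub hmP.ordLE) (by rw [coeff_sub, hmP.1]; simp [coeff_one])
  obtain ⟨G, h1, h2, h3, h4⟩ := exists_inv_one_sub hX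
  rw [sub_sub_cancel] at h1 h2
  have hG : G.IsMonic 0 := by
    rw [← sub_add_cancel G 1]
    exact ⟨by rw [coeff_add, h3 0 (by omega)]; simp [coeff_one],
      ((h3.mono (by omega)).add ordLE_one)⟩
  have e1 : mono (1 : R) N * mono 1 (-N) = 1 := by
    rw [mono_one_mul_mono_one, add_neg_cancel]; rfl
  refine ⟨G * mono 1 (-N), ?_, by rw [mul_assoc, h2], by simpa using hG.mul hm,
    fun T hT hPT => mul_mem (h4 T hT (sub_mem (one_mem _) (mul_mem (mono_mem_opSubring T.one_mem _)
      hPT))) (mono_mem_opSubring T.one_mem _)⟩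
  calc P * (G * mono 1 (-N)) = mono 1 N * mono 1 (-N) * P * (G * mono 1 (-N)) := by
        rw [e1, one_mul]
    _ = mono 1 N * (mono 1 (-N) * P * G) * mono 1 (-N) := by simp only [mul_assoc]
    _ = 1 := by rw [h1, mul_one, e1]

theorem IsMonic.exists_unit {P : MicroDiff R} {N : ℤ} (hP : P.IsMonic N) :
    ∃ u : (MicroDiff R)ˣ, (u : MicroDiff R) = P := by
  obtain ⟨Q, h1, h2, -⟩ := hP.exists_inv
  exact ⟨⟨P, Q, h1, h2⟩, rfl⟩

theorem isMonic_inv {u : (MicroDiff R)ˣ} {N : ℤ} (hu : (u : MicroDiff R).IsMonic N) :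
    ((u⁻¹ : (MicroDiff R)ˣ) : MicroDiff R).IsMonic (-N) := by
  obtain ⟨Q, h1, h2, h3, -⟩ := hu.exists_inv
  rwa [Units.inv_eq_of_mul_eq_one_right h1]

theorem inv_mem_opSubring {T : Subring R} {hT : ∀ a ∈ T, a′ ∈ T} {u : (MicroDiff R)ˣ} {N : ℤ}
    (hu : (u : MicroDiff R).IsMonic N) (huT : (u : MicroDiff R) ∈ opSubring T hT) :
    ((u⁻¹ : (MicroDiff R)ˣ) : MicroDiff R) ∈ opSubring T hT := by
  obtain ⟨Q, h1, h2, -, h4⟩ := hu.exists_inv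
  rw [Units.inv_eq_of_mul_eq_one_right h1]
  exact h4 T hT huT

theorem isMonic_zpow {u : (MicroDiff R)ˣ} (hu : (u : MicroDiff R).IsMonic 1) (k : ℤ) :
    ((u ^ k : (MicroDiff R)ˣ) : MicroDiff R).IsMonic k := by
  induction k with
  | zero => simpa using isMonic_one
  | succ k ih => rw [zpow_add_one, Units.val_mul]; exact ih.mul hu
  | pred k ih => rw [zpow_sub_one, Units.val_mul]; exact ih.mul (isMonic_inv hu)

theorem zpow_mem_opSubring {T : Subring R} {hT : ∀ a ∈ T, a′ ∈ T} {u : (MicroDiff R)ˣ}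
    (hu : (u : MicroDiff R).IsMonic 1) (huT : (u : MicroDiff R) ∈ opSubring T hT) (k : ℤ) :
    ((u ^ k : (MicroDiff R)ˣ) : MicroDiff R) ∈ opSubring T hT := by
  induction k with
  | zero => simp
  | succ k ih => rw [zpow_add_one, Units.val_mul]; exact mul_mem ih huT
  | pred k ih => rw [zpow_sub_one, Units.val_mul]; exact mul_mem ih (inv_mem_opSubring hu huT)

/-! ### Derivations of the operator ring -/

/-- The `n` summands $X^i(DX)X^{n-1-i}$ share one top coefficient. Without torsion, a bound on the
order of $D(X^n)$ can thus be converted back into a bound for $DX$. -/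
theorem ordLE_derivation_pow {D : MicroDiff R →+ MicroDiff R}
    (hD : ∀ P Q, D (P * Q) = D P * Q + P * D Q) {X : MicroDiff R} (hX : X.IsMonic 1) {d : ℤ}
    (hd : (D X).OrdLE d) (n : ℕ) :
    (D (X ^ n)).OrdLE (d + n - 1) ∧ (D (X ^ n)).coeff (d + n - 1) = n * (D X).coeff d := by
  induction n with
  | zero =>
    have h1 : D 1 = 0 := by simpa using hD 1 1
    simp only [pow_zero, h1]
    exact ⟨ordLE_zero _, by simp⟩
  | succ n ih =>
    have e1 : d + ((n + 1 : ℕ) : ℤ) - 1 = (d + n - 1) + 1 := by push_cast; ring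
    have e2 : d + n - 1 + 1 = n + d := by ring
    rw [pow_succ, hD, e1]
    refine ⟨(ih.1.mul hX.ordLE).add (((hX.pow n).ordLE.mul hd).mono e2.ge), ?_⟩
    rw [coeff_add, coeff_mul_top ih.1 hX.ordLE, e2, coeff_mul_top (hX.pow n).ordLE hd, hX.1,
      (hX.pow n).1, ih.2]
    push_cast
    ring

theorem ordLE_of_derivation_pow [IsAddTorsionFree R] {D : MicroDiff R →+ MicroDiff R}
    (hD : ∀ P Q, D (P * Q) = D P * Q + P * D Q) {X : MicroDiff R} (hX : X.IsMonic 1) {e : ℤ}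
    {n : ℕ} (hn : n ≠ 0) (h : (D (X ^ n)).OrdLE (e + n - 1)) : (D X).OrdLE e := by
  refine ordLE_of_step fun d hed hd => ?_
  have := (ordLE_derivation_pow hD hX hd n).2
  rw [h _ (by omega), ← nsmul_eq_mul] at this
  exact (nsmul_eq_zero_iff_right hn).1 this.symm

theorem ordLE_derivation_zpow {D : MicroDiff R →+ MicroDiff R}
    (hD : ∀ P Q, D (P * Q) = D P * Q + P * D Q) {u : (MicroDiff R)ˣ}
    (hu : (u : MicroDiff R).IsMonic 1) {d : ℤ} (hd : (D u).OrdLE d) (k : ℤ) :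
    (D ((u ^ k : (MicroDiff R)ˣ) : MicroDiff R)).OrdLE (d + k - 1) := by
  have h1 : D 1 = 0 := by simpa using hD 1 1
  have hinv : D ((u⁻¹ : (MicroDiff R)ˣ) : MicroDiff R) =
      -((u⁻¹ : (MicroDiff R)ˣ) * D u * (u⁻¹ : (MicroDiff R)ˣ) : MicroDiff R) := by
    have h := hD (u⁻¹ : (MicroDiff R)ˣ) u
    rw [Units.inv_mul, h1] at h
    have h' := congrArg (· * ((u⁻¹ : (MicroDiff R)ˣ) : MicroDiff R)) h
    simp only [zero_mul, add_mul, mul_assoc, Units.mul_inv, mul_one] at h'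
    rw [mul_assoc]
    exact eq_neg_of_add_eq_zero_left h'.symm
  have hinv' := isMonic_inv hu
  induction k with
  | zero => simp only [zpow_zero, Units.val_one, h1]; exact ordLE_zero _
  | succ k ih =>
    rw [zpow_add_one, Units.val_mul, hD]
    exact ((ih.mul hu.ordLE).mono (by omega)).add
      (((isMonic_zpow hu k).ordLE.mul hd).mono (by omega))
  | pred k ih =>
    rw [zpow_sub_one, Units.val_mul, hD, hinv]
    exact ((ih.mul hinv'.ordLE).mono (by omega)).add
      (((isMonic_zpow hu _).ordLE.mul ((hinv'.ordLE.mul hd).mul hinv'.ordLE).neg).mono (by omega))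

/-! ### Expansions -/

/-- Monic operators of distinct orders are independent: the largest index with `a k ≠ 0` would
supply the leading coefficient of the sum. -/
theorem eq_zero_of_sum_ordLE {Q : ℤ → MicroDiff R} (hQ : ∀ k, (Q k).IsMonic k) {a : ℤ → R}
    {s : Finset ℤ} {d : ℤ} (h : (∑ k ∈ s, ofFun (a k) * Q k).OrdLE d) :
    ∀ k ∈ s, d < k → a k = 0 := by
  classical
  by_contra! hcon
  obtain ⟨k₀, hk₀, hdk₀, hne₀⟩ := hcon
  obtain ⟨m, hm, hmax⟩ := exists_max_image (s.filter fun k => a k ≠ 0) id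
    ⟨k₀, mem_filter.2 ⟨hk₀, hne₀⟩⟩
  rw [mem_filter] at hm
  have hkm : d < m := hdk₀.trans_le (hmax k₀ (mem_filter.2 ⟨hk₀, hne₀⟩))
  apply hm.2
  have := h m hkm
  rw [coeff_sum, sum_eq_single m] at this
  · rwa [coeff_ofFun_mul, (hQ m).1, mul_one] at this
  · intro k hk hne
    rw [coeff_ofFun_mul]
    by_cases hak : a k = 0
    · rw [hak, zero_mul]
    · have : k ≤ m := hmax k (mem_filter.2 ⟨hk, hak⟩)
      rw [(hQ k).ordLE m (by omega), mul_zero]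
  · exact fun h => absurd hm.1 h

/-- Expansion of `P` with respect to a family of monic operators `Q k` of order `k`; any
property of the coefficients that holds for each remainder's leading coefficient is retained. -/
theorem exists_expansion {Q : ℤ → MicroDiff R} (hQ : ∀ k, (Q k).IsMonic k) {C : R → Prop}
    (hC : C 0) {P : MicroDiff R} {d N : ℤ} (hP : P.OrdLE N)
    (step : ∀ (j : ℤ) (a : ℤ → R), d < j → j ≤ N → (∀ k, C (a k)) →
      (P - ∑ k ∈ Ioc j N, ofFun (a k) * Q k).OrdLE j →
      C ((P - ∑ k ∈ Ioc j N, ofFun (a k) * Q k).coeff j)) :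
    ∃ a : ℤ → R, (∀ k, C (a k)) ∧ (P - ∑ k ∈ Ioc d N, ofFun (a k) * Q k).OrdLE d := by
  classical
  have key : ∀ i : ℕ, d ≤ N - i → ∃ a : ℤ → R, (∀ k, C (a k)) ∧
      (P - ∑ k ∈ Ioc (N - i) N, ofFun (a k) * Q k).OrdLE (N - i) := by
    intro i
    induction i with
    | zero => exact fun _ => ⟨fun _ => 0, fun _ => hC, by simpa using hP⟩
    | succ i ih =>
      intro hi
      push_cast at hi
      obtain ⟨a, ha, hord⟩ := ih (by omega)
      set c := (P - ∑ k ∈ Ioc (N - i : ℤ) N, ofFun (a k) * Q k).coeff (N - i) with hc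
      have hcC : C c := step _ a (by omega) (by omega) ha hord
      refine ⟨Function.update a (N - i) c, fun k => ?_, ?_⟩
      · rcases eq_or_ne k (N - i) with rfl | hk
        · rwa [Function.update_self]
        · rw [Function.update_of_ne hk]
          exact ha k
      · have hI : Ioc (N - ((i + 1 : ℕ) : ℤ)) N = insert (N - i : ℤ) (Ioc (N - i : ℤ) N) := by
          ext k
          simp only [mem_Ioc, mem_insert]
          push_cast
          omega
        have hs : ∑ k ∈ Ioc (N - i : ℤ) N, ofFun (Function.update a (N - i : ℤ) c k) * Q k =
            ∑ k ∈ Ioc (N - i : ℤ) N, ofFun (a k) * Q k := by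
          refine sum_congr rfl fun k hk => ?_
          rw [Function.update_of_ne]
          rw [mem_Ioc] at hk
          omega
        rw [hI, sum_insert (by simp), hs, Function.update_self, ← sub_sub, sub_right_comm,
          show N - ((i + 1 : ℕ) : ℤ) = N - i - 1 by push_cast; ring]
        refine (hord.sub ((hQ _).ordLE.ofFun_mul c)).pred ?_
        rw [coeff_sub, coeff_ofFun_mul, (hQ _).1, mul_one, ← hc, sub_self]
  by_cases hdN : d ≤ N
  · obtain ⟨a, ha, h⟩ := key (N - d).toNat (by omega)
    rw [show N - ((N - d).toNat : ℤ) = d by omega] at h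
    exact ⟨a, ha, h⟩
  · refine ⟨fun _ => 0, fun _ => hC, ?_⟩
    rw [Ioc_eq_empty (by omega), sum_empty, sub_zero]
    exact hP.mono (by omega)

/-! ### Approximate roots -/

theorem pow_sub_pow_ordLE {X Y : MicroDiff R} (hX : X.IsMonic 1) (hY : Y.IsMonic 1) {d : ℤ}
    (hd : (X - Y).OrdLE d) (n : ℕ) :
    (X ^ n - Y ^ n).OrdLE (d + n - 1) ∧
      (X ^ n - Y ^ n).coeff (d + n - 1) = n * (X - Y).coeff d := by
  induction n with
  | zero =>
    simp only [pow_zero, sub_self]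
    exact ⟨ordLE_zero _, by simp⟩
  | succ n ih =>
    have e1 : d + ((n + 1 : ℕ) : ℤ) - 1 = (d + n - 1) + 1 := by push_cast; ring
    have e2 : d + n - 1 + 1 = n + d := by ring
    have e3 : X ^ (n + 1) - Y ^ (n + 1) = (X ^ n - Y ^ n) * X + Y ^ n * (X - Y) := by
      rw [pow_succ, pow_succ]; noncomm_ring
    rw [e3, e1]
    refine ⟨(ih.1.mul hX.ordLE).add (((hY.pow n).ordLE.mul hd).mono e2.ge), ?_⟩
    rw [coeff_add, coeff_mul_top ih.1 hX.ordLE, e2, coeff_mul_top (hY.pow n).ordLE hd, hX.1,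
      (hY.pow n).1, ih.2]
    push_cast
    ring

theorem IsMonic.exists_approx_root {T : Subring R} {hT : ∀ a ∈ T, a′ ∈ T} {m : ℕ}
    (hdiv : ∀ a ∈ T, ∃ b ∈ T, (m : R) * b = a) {B : MicroDiff R} (hB : B.IsMonic m)
    (hBT : B ∈ opSubring T hT) (j : ℕ) :
    ∃ X ∈ opSubring T hT, X.IsMonic 1 ∧ (X ^ m - B).OrdLE (m - 1 - j) := by
  induction j with
  | zero =>
    have h1 : (mono (1 : R) 1).IsMonic 1 := ⟨by simp [coeff_mono], ordLE_mono _ _⟩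
    refine ⟨mono 1 1, mono_mem_opSubring T.one_mem _, h1, ?_⟩
    rw [Nat.cast_zero, sub_zero]
    exact ((h1.pow m).ordLE.sub hB.ordLE).pred (by rw [coeff_sub, hB.1, (h1.pow m).1, sub_self])
  | succ j ih =>
    obtain ⟨X, hXT, hX, hord⟩ := ih
    -- Replacing $X$ by $X-b\partial^{-j}$ changes $X^m$ by $-mb$ in order $m-1-j$, so `b` is the
    -- current error divided by `m`.
    obtain ⟨b, hbT, hb⟩ := hdiv _ (sub_mem (pow_mem hXT m) hBT (m - 1 - j : ℤ))
    have hY : (X - mono b (-j)).IsMonic 1 := by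
      refine ⟨?_, hX.ordLE.sub ((ordLE_mono b _).mono (by omega))⟩
      rw [coeff_sub, hX.1, coeff_mono, if_neg (by omega), sub_zero]
    have hd : (X - mono b (-j) - X).OrdLE (-j) := by
      rw [sub_sub_cancel_left]
      exact (ordLE_mono b _).neg
    obtain ⟨h1, h2⟩ := pow_sub_pow_ordLE hY hX hd m
    refine ⟨X - mono b (-j), sub_mem hXT (mono_mem_opSubring hbT _), hY, ?_⟩
    rw [show (m : ℤ) - 1 - ((j + 1 : ℕ) : ℤ) = m - 1 - j - 1 by push_cast; ring]
    rw [show (-j + m - 1 : ℤ) = m - 1 - j by ring] at h1 h2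
    rw [← sub_add_sub_cancel _ (X ^ m) B]
    refine (h1.add hord).pred ?_
    rw [coeff_add, h2, sub_sub_cancel_left, coeff_neg, coeff_mono, if_pos rfl, mul_neg, hb,
      neg_add_cancel]

/-! ### Differential operator parts -/

theorem plus_add (P Q : MicroDiff R) : (P + Q).plus = P.plus + Q.plus := by
  ext k
  simp only [coeff_plus, coeff_add]
  split_ifs <;> simp

theorem plus_ofFun_mul (c : R) (P : MicroDiff R) : (ofFun c * P).plus = ofFun c * P.plus := by
  ext k
  simp only [coeff_plus, coeff_ofFun_mul, mul_ite, mul_zero]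

theorem plus_sum {ι : Type*} (s : Finset ι) (P : ι → MicroDiff R) :
    (∑ i ∈ s, P i).plus = ∑ i ∈ s, (P i).plus :=
  map_sum (AddMonoidHom.mk' plus plus_add) P s

theorem IsDifferential.plus_eq {P : MicroDiff R} (hP : P.IsDifferential) : P.plus = P := by
  ext k
  rw [coeff_plus]
  split_ifs with h
  · rfl
  · exact (hP k (not_le.1 h)).symm

theorem OrdLE.plus_eq_zero {P : MicroDiff R} (hP : P.OrdLE (-1)) : P.plus = 0 := by
  ext k
  rw [coeff_plus]
  split_ifs with h
  · exact hP k (by omega)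
  · rfl

theorem isDifferential_plus (P : MicroDiff R) : P.plus.IsDifferential := fun k hk => by
  rw [coeff_plus, if_neg (not_le.2 hk)]

theorem ordLE_sub_plus (P : MicroDiff R) : (P - P.plus).OrdLE (-1) := fun k hk => by
  rw [coeff_sub, coeff_plus, if_pos (by omega), sub_self]

theorem isDifferential_ofFun (c : R) : (ofFun c).IsDifferential := fun k hk => by
  rw [coeff_ofFun, if_neg hk.ne]

theorem IsDifferential.mul {P Q : MicroDiff R} (hP : P.IsDifferential) (hQ : Q.IsDifferential) :
    (P * Q).IsDifferential := fun k hk => by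
  rw [coeff_mul]
  refine finsum_eq_zero_of_forall_eq_zero fun p => ?_
  by_cases h1 : p.1 < 0
  · rw [hP _ h1, zero_mul, smul_zero]
  by_cases h2 : k - p.1 + p.2 < 0
  · rw [hQ _ h2, map_zero, mul_zero, smul_zero]
  obtain ⟨l, hl⟩ := Int.eq_ofNat_of_zero_le (not_lt.1 h1)
  rw [hl, Ring.choose_natCast, Nat.choose_eq_zero_of_lt (by omega), Nat.cast_zero, zero_smul]

/-- Multiplication by functions on both sides preserves differential operators as well as operators
of order at most $-1$, hence the splitting into the two parts. -/
theorem plus_conj (a b : R) (P : MicroDiff R) :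
    (ofFun a * P * ofFun b).plus = ofFun a * P.plus * ofFun b := by
  have h : ofFun a * P * ofFun b =
      ofFun a * P.plus * ofFun b + ofFun a * (P - P.plus) * ofFun b := by noncomm_ring
  have h1 : (ofFun a * (P - P.plus) * ofFun b).OrdLE (-1) := by
    simpa using ((ordLE_ofFun a).mul (ordLE_sub_plus P)).mul (ordLE_ofFun b)
  rw [h, plus_add, h1.plus_eq_zero, add_zero]
  exact (((isDifferential_ofFun a).mul (isDifferential_plus P)).mul
    (isDifferential_ofFun b)).plus_eq

end Algebra

end MicroDiff

end KP

end

/-! ### The function rings as subrings with bounded poles, time derivatives, and integration in the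
times. -/

noncomputable section

namespace KP

open Finset

set_option linter.unusedSectionVars false

/-! ### Derivations of the coefficients -/

namespace MicroDiff

variable {R : Type*} [CommRing R] [Differential R]

/-- `MicroDiff.map` as an additive map. -/
def mapHom (φ : R →+ R) : MicroDiff R →+ MicroDiff R where
  toFun := map φ
  map_zero' := by ext k; exact map_zero φ
  map_add' P Q := by ext k; exact map_add φ _ _

theorem map_mul_of_derivation {φ : R →+ R} (hmul : ∀ a b, φ (a * b) = φ a * b + a * φ b)
    (hcomm : ∀ a, φ a′ = (φ a)′) (P Q : MicroDiff R) :
    map φ (P * Q) = map φ P * Q + P * map φ Q := by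
  have hiter : ∀ (r : ℕ) (a : R), φ (iterDeriv R r a) = iterDeriv R r (φ a) := by
    intro r a
    induction r with
    | zero => rfl
    | succ r ih => rw [iterDeriv_succ, iterDeriv_succ, hcomm, ih]
  ext k
  rw [coeff_add, coeff_map, coeff_mul, coeff_mul, coeff_mul,
    ← finsum_add_distrib (finite_support_mul _ _ k) (finite_support_mul _ _ k),
    map_finsum φ (finite_support_mul P Q k)]
  refine finsum_congr fun p => ?_
  rw [map_zsmul, hmul, hiter, smul_add]
  rfl

end MicroDiff

theorem isAddTorsionFree_of_complex (M : Type*) [AddCommGroup M] [Module ℂ M] :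
    IsAddTorsionFree M :=
  letI : Module ℚ M := Module.compHom M (algebraMap ℚ ℂ)
  IsAddTorsionFree.of_module_rat M

section Functions

variable {A : Type*} [CommRing A]

theorem deriv_eq_xDeriv (f : Fun A) : f′ = xDeriv A f := rfl

theorem coeff_coeff_xDeriv (f : Fun A) (α : ℕ+ →₀ ℕ) (n : ℤ) :
    (MvPowerSeries.coeff α (xDeriv A f)).coeff n =
      (n + 1) • (MvPowerSeries.coeff α f).coeff (n + 1) := by
  change (LaurentSeries.derivative ℤ (MvPowerSeries.coeff α f)).coeff n = _
  rw [LaurentSeries.derivative_apply, LaurentSeries.hasseDeriv_coeff]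
  simp

theorem coeff_tDeriv (n : ℕ+) (f : Fun A) (α : ℕ+ →₀ ℕ) :
    MvPowerSeries.coeff α (tDeriv n f) =
      (α n + 1) • MvPowerSeries.coeff (α + Finsupp.single n 1) f := by
  rw [tDeriv, MvPowerSeries.coeff_pderiv, nsmul_eq_mul, mul_comm]
  push_cast
  rfl

theorem tDeriv_xDeriv (n : ℕ+) (f : Fun A) : tDeriv n (xDeriv A f) = xDeriv A (tDeriv n f) := by
  ext α k
  rw [coeff_tDeriv, HahnSeries.coeff_smul, coeff_coeff_xDeriv, coeff_coeff_xDeriv, coeff_tDeriv,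
    HahnSeries.coeff_smul, smul_comm]

theorem tDeriv_mul (n : ℕ+) (f g : Fun A) : tDeriv n (f * g) = tDeriv n f * g + f * tDeriv n g := by
  rw [Derivation.leibniz, smul_eq_mul, smul_eq_mul, mul_comm g, add_comm]

theorem tDeriv_ofTimes (n : ℕ+) (g : MvPowerSeries ℕ+ A) :
    tDeriv n (ofTimes g) = ofTimes (MvPowerSeries.pderiv A n g) := by
  ext1 α
  rw [coeff_tDeriv, ofTimes, MvPowerSeries.coeff_map, MvPowerSeries.coeff_map,
    MvPowerSeries.coeff_pderiv, ← map_nsmul, nsmul_eq_mul, mul_comm]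
  push_cast
  rfl

/-- The coefficient of `x^n`, a series in the times. -/
def xCoeff (n : ℤ) (f : Fun A) : MvPowerSeries ℕ+ A := fun α => (MvPowerSeries.coeff α f).coeff n

theorem coeff_xCoeff (n : ℤ) (f : Fun A) (α : ℕ+ →₀ ℕ) :
    MvPowerSeries.coeff α (xCoeff n f) = (MvPowerSeries.coeff α f).coeff n := rfl

theorem coeff_coeff_ofTimes (g : MvPowerSeries ℕ+ A) (α : ℕ+ →₀ ℕ) (n : ℤ) :
    (MvPowerSeries.coeff α (ofTimes g)).coeff n =
      if n = 0 then MvPowerSeries.coeff α g else 0 := by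
  rw [ofTimes, MvPowerSeries.coeff_map, HahnSeries.C_apply, HahnSeries.coeff_single]
  congr

theorem xDeriv_ofTimes (g : MvPowerSeries ℕ+ A) : xDeriv A (ofTimes g) = 0 := by
  ext α n
  rw [coeff_coeff_xDeriv, coeff_coeff_ofTimes]
  split_ifs with h
  · rw [h, zero_smul]; rfl
  · rw [smul_zero]; rfl

theorem exists_eq_ofTimes [Algebra ℂ A] {f : Fun A} (hf : xDeriv A f = 0) :
    ∃ g, f = ofTimes g := by
  have := isAddTorsionFree_of_complex A
  refine ⟨xCoeff 0 f, ?_⟩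
  ext α n
  rw [coeff_coeff_ofTimes]
  split_ifs with h
  · rw [h, coeff_xCoeff]
  · have h1 : n • (MvPowerSeries.coeff α f).coeff n = 0 := by
      have := coeff_coeff_xDeriv f α (n - 1)
      rw [hf, sub_add_cancel] at this
      exact this.symm
    exact (smul_eq_zero.1 h1).resolve_left h

theorem ofTimes_injective : Function.Injective (ofTimes : MvPowerSeries ℕ+ A →+* Fun A) := by
  intro f g h
  ext α
  have := congrArg (fun u : Fun A => (MvPowerSeries.coeff α u).coeff 0) h
  simpa [coeff_coeff_ofTimes] using this

/-! ### The function rings -/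

/-- All coefficients of `f` have poles of order at most `N` in `x`. -/
def XBdd (N : ℕ) (f : Fun A) : Prop :=
  ∀ α, ∀ n < -(N : ℤ), (MvPowerSeries.coeff α f).coeff n = 0

theorem XBdd.mono {N M : ℕ} {f : Fun A} (h : XBdd N f) (hNM : N ≤ M) : XBdd M f :=
  fun α n hn => h α n (by omega)

theorem XBdd.add {N : ℕ} {f g : Fun A} (hf : XBdd N f) (hg : XBdd N g) : XBdd N (f + g) :=
  fun α n hn => by rw [map_add, HahnSeries.coeff_add, hf α n hn, hg α n hn, add_zero]

theorem XBdd.neg {N : ℕ} {f : Fun A} (hf : XBdd N f) : XBdd N (-f) :=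
  fun α n hn => by rw [map_neg, HahnSeries.coeff_neg, hf α n hn, neg_zero]

theorem XBdd.mul {N M : ℕ} {f g : Fun A} (hf : XBdd N f) (hg : XBdd M g) :
    XBdd (N + M) (f * g) := fun α n hn => by
  classical
  rw [MvPowerSeries.coeff_mul, HahnSeries.coeff_sum]
  refine sum_eq_zero fun p _ => ?_
  rw [laurent_coeff_mul _ _ (-N) (-M) n (hf _) (hg _), Icc_eq_empty (by push_cast at hn; omega),
    sum_empty]

/-- The pole order grows by one, but not when `N = 0`, since $x^{-1}$ is not a derivative. The bound
`N + N` covers both cases and stays in every additive submonoid containing `N`, including `⊥`. -/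
theorem XBdd.xDeriv {N : ℕ} {f : Fun A} (hf : XBdd N f) : XBdd (N + N) (xDeriv A f) :=
  fun α n hn => by
    rw [coeff_coeff_xDeriv]
    rcases eq_or_ne (n + 1) 0 with h | h
    · rw [h, zero_smul]
    · rw [hf α (n + 1) (by push_cast at hn; omega), smul_zero]

theorem xBdd_ofTimes (g : MvPowerSeries ℕ+ A) : XBdd 0 (ofTimes g) := fun α n hn => by
  rw [coeff_coeff_ofTimes, if_neg (by push_cast at hn; omega)]

theorem XBdd.sum {ι : Type*} {s : Finset ι} {N : ℕ} {f : ι → Fun A} (h : ∀ i ∈ s, XBdd N (f i)) :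
    XBdd N (∑ i ∈ s, f i) := fun α n hn => by
  rw [map_sum, HahnSeries.coeff_sum]
  exact sum_eq_zero fun i hi => h i hi α n hn

variable (A) in
/-- The functions whose pole order in `x` is bounded by an element of `I`. -/
def bddSubring (I : AddSubmonoid ℕ) : Subring (Fun A) where
  carrier := {f | ∃ N ∈ I, XBdd N f}
  zero_mem' := ⟨0, I.zero_mem, by simpa using xBdd_ofTimes (A := A) 0⟩
  one_mem' := ⟨0, I.zero_mem, by simpa using xBdd_ofTimes (A := A) 1⟩
  add_mem' := by
    rintro f g ⟨N, hN, hf⟩ ⟨M, hM, hg⟩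
    exact ⟨N + M, I.add_mem hN hM, (hf.mono (by omega)).add (hg.mono (by omega))⟩
  neg_mem' := by
    rintro f ⟨N, hN, hf⟩
    exact ⟨N, hN, hf.neg⟩
  mul_mem' := by
    rintro f g ⟨N, hN, hf⟩ ⟨M, hM, hg⟩
    exact ⟨N + M, I.add_mem hN hM, hf.mul hg⟩

variable {I : AddSubmonoid ℕ}

theorem mem_bddSubring {f : Fun A} : f ∈ bddSubring A I ↔ ∃ N ∈ I, XBdd N f := Iff.rfl

theorem deriv_mem_bddSubring (f : Fun A) (hf : f ∈ bddSubring A I) : f′ ∈ bddSubring A I := by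
  obtain ⟨N, hN, hf⟩ := hf
  exact ⟨N + N, I.add_mem hN hN, hf.xDeriv⟩

theorem ofTimes_mem_bddSubring (g : MvPowerSeries ℕ+ A) : ofTimes g ∈ bddSubring A I :=
  ⟨0, I.zero_mem, xBdd_ofTimes g⟩

theorem exists_natCast_mul_eq [Algebra ℂ A] {m : ℕ} (hm : m ≠ 0) (f : Fun A)
    (hf : f ∈ bddSubring A I) : ∃ g ∈ bddSubring A I, (m : Fun A) * g = f := by
  refine ⟨ofTimes (MvPowerSeries.C (algebraMap ℂ A (m : ℂ)⁻¹)) * f,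
    mul_mem (ofTimes_mem_bddSubring _) hf, ?_⟩
  have h : (m : Fun A) = ofTimes (MvPowerSeries.C (algebraMap ℂ A m)) := by simp
  rw [h, ← mul_assoc, ← map_mul, ← map_mul, ← map_mul, mul_inv_cancel₀ (by exact_mod_cast hm),
    map_one, map_one, map_one, one_mul]

variable (A) in
theorem powerFun_eq : powerFun A = bddSubring A ⊥ := by
  ext f
  simp only [SetLike.mem_coe, mem_bddSubring, AddSubmonoid.mem_bot, exists_eq_left]
  have hneg : ∀ (g : PowerSeries (MvPowerSeries ℕ+ A)) (n : ℤ), n < 0 →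
      (HahnSeries.ofPowerSeries ℤ _ g).coeff n = 0 := by
    intro g n hn
    rw [HahnSeries.ofPowerSeries_apply]
    refine HahnSeries.embDomain_of_notMem_range ?_
    rintro ⟨m, rfl⟩
    simp at hn
    omega
  constructor
  · rintro ⟨g, hg⟩ α n hn
    rw [hg, hneg g n (by simpa using hn), map_zero]
  · intro h
    refine ⟨PowerSeries.mk fun n => xCoeff n f, fun α n => ?_⟩
    by_cases hn : n < 0
    · rw [hneg _ n hn, map_zero, h α n (by simpa using hn)]
    · obtain ⟨m, rfl⟩ := Int.eq_ofNat_of_zero_le (not_lt.1 hn)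
      rw [HahnSeries.ofPowerSeries_apply_coeff, PowerSeries.coeff_mk, coeff_xCoeff]

variable (A) in
theorem laurentFun_eq : laurentFun A = bddSubring A ⊤ := by
  ext f
  simp only [SetLike.mem_coe, mem_bddSubring, AddSubmonoid.mem_top, true_and]
  constructor
  · rintro ⟨g, hg⟩
    refine ⟨g.order.natAbs, fun α n hn => ?_⟩
    rw [hg, HahnSeries.coeff_eq_zero_of_lt_order (by omega), map_zero]
  · rintro ⟨N, h⟩
    refine ⟨HahnSeries.ofSuppBddBelow (fun n => xCoeff n f)
      ⟨-N, fun n hn => ?_⟩, fun α n => rfl⟩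
    by_contra hlt
    exact hn (funext fun α => h α n (not_le.1 hlt))

/-! ### Time derivatives of operators -/

/-- `∂/∂t_n` as an additive map on operators. -/
def opDerivHom (n : ℕ+) : MicroDiff (Fun A) →+ MicroDiff (Fun A) :=
  MicroDiff.mapHom (tDeriv n).toLinearMap.toAddMonoidHom

theorem coeff_opDeriv (n : ℕ+) (P : MicroDiff (Fun A)) (k : ℤ) :
    (opDeriv n P).coeff k = tDeriv n (P.coeff k) := rfl

theorem opDeriv_mul (n : ℕ+) (P Q : MicroDiff (Fun A)) :
    opDeriv n (P * Q) = opDeriv n P * Q + P * opDeriv n Q :=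
  MicroDiff.map_mul_of_derivation (tDeriv_mul n) (tDeriv_xDeriv n) P Q

theorem opDeriv_ofFun (n : ℕ+) (c : Fun A) :
    opDeriv n (MicroDiff.ofFun c) = MicroDiff.ofFun (tDeriv n c) := by
  ext1 k
  rw [coeff_opDeriv, MicroDiff.coeff_ofFun, MicroDiff.coeff_ofFun]
  split_ifs <;> simp

theorem ordLE_opDeriv (n : ℕ+) {P : MicroDiff (Fun A)} {N : ℤ} (hP : P.OrdLE N) :
    (opDeriv n P).OrdLE N := fun k hk => by rw [coeff_opDeriv, hP k hk, map_zero]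

theorem ordLE_opDeriv_of_isMonic (n : ℕ+) {P : MicroDiff (Fun A)} {N : ℤ} (hP : P.IsMonic N) :
    (opDeriv n P).OrdLE (N - 1) :=
  (ordLE_opDeriv n hP.ordLE).pred (by rw [coeff_opDeriv, hP.1, Derivation.map_one_eq_zero])

/-! ### Integration with respect to the times -/

/-- Formal Poincaré lemma. The coefficient at `α` is obtained by integrating in one variable `ν α`
occurring in `α`, and closedness makes the choice irrelevant. The last clause ties each coefficient
of `f` to one of some `g n`, so that pole bounds pass from the `g n` to `f`. -/
theorem exists_pderiv_eq {σ K : Type*} [Nonempty σ] [CommRing K] [Algebra ℂ K] {g : σ → MvPowerSeries σ K}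
    (hg : ∀ m n, MvPowerSeries.pderiv K m (g n) = MvPowerSeries.pderiv K n (g m)) :
    ∃ f : MvPowerSeries σ K, MvPowerSeries.constantCoeff f = 0 ∧
      (∀ n, MvPowerSeries.pderiv K n f = g n) ∧
      ∀ α ≠ 0, ∃ m : ℕ, m ≠ 0 ∧ ∃ n β,
        m • MvPowerSeries.coeff α f = MvPowerSeries.coeff β (g n) := by
  classical
  have hex : ∀ α : σ →₀ ℕ, α ≠ 0 → ∃ n, α n ≠ 0 := fun α hα => Finsupp.ne_iff.1 hα
  choose! ν hν using hex
  let f : MvPowerSeries σ K := fun α =>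
    if α = 0 then 0 else
      ((α (ν α) : ℂ)⁻¹ • MvPowerSeries.coeff (α - Finsupp.single (ν α) 1) (g (ν α)))
  have hf : ∀ α, α ≠ 0 → MvPowerSeries.coeff α f =
      ((α (ν α) : ℂ)⁻¹ • MvPowerSeries.coeff (α - Finsupp.single (ν α) 1) (g (ν α))) :=
    fun α hα => if_neg hα
  have hsymm : ∀ (γ : σ →₀ ℕ) (m n : σ), γ m ≠ 0 → γ n ≠ 0 →
      MvPowerSeries.coeff (γ - Finsupp.single m 1) (g m) * (γ n : K) =
      MvPowerSeries.coeff (γ - Finsupp.single n 1) (g n) * (γ m : K) := by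
    intro γ m n hm hn
    rcases eq_or_ne m n with rfl | hmn
    · rfl
    have h := congrArg (MvPowerSeries.coeff (γ - Finsupp.single m 1 - Finsupp.single n 1))
      (hg n m)
    rw [MvPowerSeries.coeff_pderiv, MvPowerSeries.coeff_pderiv] at h
    have hn' : (γ - Finsupp.single m 1 : σ →₀ ℕ) n = γ n := by simp [hmn]
    have hm' : (γ - Finsupp.single n 1 : σ →₀ ℕ) m = γ m := by simp [hmn.symm]
    have e1 := tsub_add_cancel_of_le (Finsupp.single_le_iff.2 (show 1 ≤ _ by omega) :
      Finsupp.single n 1 ≤ γ - Finsupp.single m 1)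
    have e2 := tsub_add_cancel_of_le (Finsupp.single_le_iff.2 (show 1 ≤ _ by omega) :
      Finsupp.single m 1 ≤ γ - Finsupp.single n 1)
    rw [tsub_right_comm] at e2
    have e3 : (((γ - Finsupp.single m 1 - Finsupp.single n 1 : σ →₀ ℕ) n : ℕ) : K) + 1 =
        (γ n : K) := by
      rw [← Nat.cast_succ, Finsupp.tsub_apply, hn', Finsupp.single_eq_same, Nat.succ_eq_add_one,
        Nat.sub_add_cancel (by omega)]
    have e4 : (((γ - Finsupp.single m 1 - Finsupp.single n 1 : σ →₀ ℕ) m : ℕ) : K) + 1 =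
        (γ m : K) := by
      rw [tsub_right_comm, ← Nat.cast_succ, Finsupp.tsub_apply, hm', Finsupp.single_eq_same,
        Nat.succ_eq_add_one, Nat.sub_add_cancel (by omega)]
    rwa [e1, e2, e3, e4] at h
  refine ⟨f, (if_pos rfl : f 0 = 0), fun n => ?_, fun α hα => ?_⟩
  · ext α
    have h0 : α + Finsupp.single n 1 ≠ 0 := fun h => by
      have := DFunLike.congr_fun h n
      simp at this
    set γ := α + Finsupp.single n 1 with hγ
    have hγn : γ n = α n + 1 := by simp [hγ]
    have hc : ((γ (ν γ) : ℕ) : ℂ) ≠ 0 := by exact_mod_cast hν γ h0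
    have h := hsymm γ (ν γ) n (hν γ h0) (by omega)
    rw [MvPowerSeries.coeff_pderiv, ← hγ, hf γ h0, smul_mul_assoc, ← Nat.cast_succ,
      Nat.succ_eq_add_one, ← hγn, h, mul_comm, ← nsmul_eq_mul, ← Nat.cast_smul_eq_nsmul ℂ,
      smul_smul, inv_mul_cancel₀ hc, one_smul, hγ, add_tsub_cancel_right]
  · refine ⟨α (ν α), hν α hα, ν α, α - Finsupp.single (ν α) 1, ?_⟩
    rw [hf α hα, ← Nat.cast_smul_eq_nsmul ℂ, smul_smul,
      mul_inv_cancel₀ (by exact_mod_cast hν α hα), one_smul]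

end Functions

end KP

end

noncomputable section

namespace KP

open Finset

set_option linter.unusedSectionVars false

/-! ### The exponential -/

section Exponential

section Chain

variable {σ K : Type*} [CommRing K] [Algebra ℂ K]

theorem coeff_pow_eq_zero {f : MvPowerSeries σ K} (hf : MvPowerSeries.constantCoeff f = 0)
    {α : σ →₀ ℕ} {d : ℕ} (h : α.degree < d) : MvPowerSeries.coeff α (f ^ d) = 0 := by
  refine MvPowerSeries.coeff_of_lt_order ?_
  exact lt_of_lt_of_le (by exact_mod_cast h)
    (MvPowerSeries.le_order_pow_of_constantCoeff_eq_zero d hf)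

theorem coeff_subst_exp {f : MvPowerSeries σ K} (hf : MvPowerSeries.constantCoeff f = 0)
    {α : σ →₀ ℕ} {N : ℕ} (h : α.degree < N) :
    MvPowerSeries.coeff α (PowerSeries.subst f (PowerSeries.exp ℂ)) =
      MvPowerSeries.coeff α (∑ d ∈ range N, ((d.factorial : ℂ)⁻¹) • f ^ d) := by
  rw [PowerSeries.coeff_subst (PowerSeries.HasSubst.of_constantCoeff_zero hf),
    finsum_eq_sum_of_support_subset (s := range N), map_sum]
  · refine sum_congr rfl fun d _ => ?_
    have h : MvPowerSeries.coeff α (((d.factorial : ℂ)⁻¹) • f ^ d) =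
      ((d.factorial : ℂ)⁻¹) • MvPowerSeries.coeff α (f ^ d) := rfl
    rw [PowerSeries.coeff_exp, h]
    simp
  · intro d hd
    rw [Function.mem_support] at hd
    rw [mem_coe, mem_range]
    by_contra hdK
    exact hd (by rw [coeff_pow_eq_zero hf (by omega), smul_zero])

theorem constantCoeff_subst_exp {f : MvPowerSeries σ K}
    (hf : MvPowerSeries.constantCoeff f = 0) :
    MvPowerSeries.constantCoeff (PowerSeries.subst f (PowerSeries.exp ℂ)) = 1 := by
  rw [← MvPowerSeries.coeff_zero_eq_constantCoeff_apply, coeff_subst_exp hf (N := 1) (by simp)]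
  simp

/-- A derivation that lowers the degree by at most one satisfies the chain rule for the
exponential. -/
theorem derivation_subst_exp (D : MvPowerSeries σ K →+ MvPowerSeries σ K)
    (hmul : ∀ f g, D (f * g) = f * D g + g * D f)
    (hD : ∀ (g : MvPowerSeries σ K) (N : ℕ),
      (∀ β : σ →₀ ℕ, β.degree < N + 1 → MvPowerSeries.coeff β g = 0) →
      ∀ α : σ →₀ ℕ, α.degree < N → MvPowerSeries.coeff α (D g) = 0)
    {f : MvPowerSeries σ K} (hf : MvPowerSeries.constantCoeff f = 0) :
    D (PowerSeries.subst f (PowerSeries.exp ℂ)) =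
      D f * PowerSeries.subst f (PowerSeries.exp ℂ) := by
  classical
  have := isAddTorsionFree_of_complex (MvPowerSeries σ K)
  have h1 : D 1 = 0 := by simpa using hmul 1 1
  have hpow : ∀ d : ℕ, D (f ^ (d + 1)) = (d + 1) • (D f * f ^ d) := by
    intro d
    induction d with
    | zero => simp
    | succ d ih =>
      rw [pow_succ, hmul, ih]
      simp only [nsmul_eq_mul]
      push_cast
      ring
  have hfac : ∀ d : ℕ, D (((d.factorial : ℂ)⁻¹) • f ^ d) = ((d.factorial : ℂ)⁻¹) • D (f ^ d) := by
    intro d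
    have h0 : (d.factorial : ℂ) ≠ 0 := by exact_mod_cast d.factorial_ne_zero
    have h2 : d.factorial • D (((d.factorial : ℂ)⁻¹) • f ^ d) = D (f ^ d) := by
      rw [← map_nsmul, ← Nat.cast_smul_eq_nsmul ℂ, smul_smul, mul_inv_cancel₀ h0, one_smul]
    rw [← h2, ← Nat.cast_smul_eq_nsmul ℂ, smul_smul, inv_mul_cancel₀ h0, one_smul]
  have hsum : ∀ N : ℕ, D (∑ d ∈ range (N + 1), ((d.factorial : ℂ)⁻¹) • f ^ d) =
      D f * ∑ d ∈ range N, ((d.factorial : ℂ)⁻¹) • f ^ d := by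
    intro N
    rw [sum_range_succ', map_add, hfac, pow_zero, h1, smul_zero, add_zero, map_sum, mul_sum]
    refine sum_congr rfl fun d _ => ?_
    rw [hfac, hpow, ← Nat.cast_smul_eq_nsmul ℂ, smul_smul, mul_smul_comm]
    congr 1
    rw [Nat.factorial_succ]
    push_cast
    field_simp
  ext1 α
  -- The exponential is cut after the power $|\alpha|+1$: `D` costs one degree and one summand, and
  -- the result is still exact in degree $|\alpha|$.
  have h2 := hD (PowerSeries.subst f (PowerSeries.exp ℂ) -
    ∑ d ∈ range (α.degree + 1 + 1), ((d.factorial : ℂ)⁻¹) • f ^ d) (α.degree + 1)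
    (fun β hβ => by rw [map_sub, coeff_subst_exp hf hβ, sub_self]) α (by omega)
  rw [map_sub, map_sub, hsum, sub_eq_zero] at h2
  rw [h2, MvPowerSeries.coeff_mul, MvPowerSeries.coeff_mul]
  refine sum_congr rfl fun p hp => ?_
  rw [HasAntidiagonal.mem_antidiagonal] at hp
  have : α.degree = p.1.degree + p.2.degree := by rw [← hp, map_add]
  rw [coeff_subst_exp hf (N := α.degree + 1) (by omega)]

end Chain

variable {A : Type*} [CommRing A] [Algebra ℂ A]

theorem xDeriv_expFun {f : Fun A} (hf : MvPowerSeries.constantCoeff f = 0) :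
    (expFun f)′ = f′ * expFun f := by
  refine derivation_subst_exp (xDeriv A) xDeriv_mul (fun g K hg α hα => ?_) hf
  ext n
  rw [coeff_coeff_xDeriv, hg α (by omega)]
  simp

theorem tDeriv_expFun (n : ℕ+) {f : Fun A} (hf : MvPowerSeries.constantCoeff f = 0) :
    tDeriv n (expFun f) = tDeriv n f * expFun f := by
  refine derivation_subst_exp (tDeriv n).toLinearMap.toAddMonoidHom
    (Derivation.leibniz (tDeriv n)) (fun g K hg α hα => ?_) hf
  change MvPowerSeries.coeff α (tDeriv n g) = 0
  rw [coeff_tDeriv, hg _ (by simpa using hα), smul_zero]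

/-- All time derivatives of the product vanish and its constant term is `1`, which determines it in
the absence of torsion. -/
theorem expFun_mul_expFun_neg {f : Fun A} (hf : MvPowerSeries.constantCoeff f = 0) :
    expFun f * expFun (-f) = 1 := by
  have hf' : MvPowerSeries.constantCoeff (-f) = 0 := by rw [map_neg, hf, neg_zero]
  have := isAddTorsionFree_of_complex (LaurentSeries A)
  refine MvPowerSeries.pderiv.ext (fun n => ?_) ?_
  · change tDeriv n _ = tDeriv n _
    rw [tDeriv_mul, tDeriv_expFun n hf, tDeriv_expFun n hf', Derivation.map_one_eq_zero, map_neg]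
    ring
  · rw [map_mul, expFun, expFun, constantCoeff_subst_exp hf, constantCoeff_subst_exp hf', map_one,
      one_mul]

theorem deriv_mul (f g : Fun A) : (f * g)′ = f * g′ + g * f′ := xDeriv_mul f g

variable {I : AddSubmonoid ℕ}

open MicroDiff

/-- The poles of $e^f$ may be unbounded, so $e^f$ itself need not lie in the function ring. But
$g_r=e^{-f}(e^f)^{(r)}$ is a polynomial in the derivatives of $f$, by $g_{r+1}=g_r'+f'g_r$. -/
theorem expFun_neg_mul_iterDeriv_mem {f : Fun A} (hf : MvPowerSeries.constantCoeff f = 0)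
    (hfS : f ∈ bddSubring A I) (r : ℕ) :
    expFun (-f) * iterDeriv (Fun A) r (expFun f) ∈ bddSubring A I := by
  have hf' : MvPowerSeries.constantCoeff (-f) = 0 := by rw [map_neg, hf, neg_zero]
  induction r with
  | zero =>
    rw [iterDeriv_zero, mul_comm, expFun_mul_expFun_neg hf]
    exact one_mem _
  | succ r ih =>
    have h : expFun (-f) * iterDeriv (Fun A) (r + 1) (expFun f) =
        (expFun (-f) * iterDeriv (Fun A) r (expFun f))′ +
          f′ * (expFun (-f) * iterDeriv (Fun A) r (expFun f)) := by
      rw [iterDeriv_succ, deriv_mul, xDeriv_expFun hf', map_neg]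
      ring
    rw [h]
    exact add_mem (deriv_mem_bddSubring _ ih) (mul_mem (deriv_mem_bddSubring _ hfS) ih)

/-- Conjugation by an exponential preserves the operators with coefficients in a function ring. -/
theorem coeff_conj_expFun_mem {f : Fun A} (hf : MvPowerSeries.constantCoeff f = 0)
    (hfS : f ∈ bddSubring A I) {P : MicroDiff (Fun A)} (hP : ∀ k, P.coeff k ∈ bddSubring A I)
    (k : ℤ) : (ofFun (expFun (-f)) * (P * ofFun (expFun f))).coeff k ∈ bddSubring A I := by
  rw [coeff_ofFun_mul, coeff_mul, ← AddMonoidHom.coe_mulLeft,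
    map_finsum _ (finite_support_mul _ _ k)]
  refine finsum_induction (· ∈ bddSubring A I) (zero_mem _) (fun _ _ => add_mem) fun p => ?_
  rw [AddMonoidHom.coe_mulLeft, mul_smul_comm, mul_left_comm, coeff_ofFun]
  refine zsmul_mem (mul_mem (hP _) ?_) _
  split_ifs
  · exact expFun_neg_mul_iterDeriv_mem hf hfS _
  · rw [map_zero, mul_zero]
    exact zero_mem _

end Exponential

end KP

end

noncomputable section

namespace KP

open Finset

set_option linter.unusedSectionVars false

/-! ### Triangular substitutions -/

section Triangular

variable {K : Type*} [CommRing K]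

/-- The weight `∑ n α_n` of a monomial in the times. -/
def wt : (ℕ+ →₀ ℕ) →+ ℕ := Finsupp.weight fun n : ℕ+ => (n : ℕ)

theorem wt_single (n : ℕ+) (e : ℕ) : wt (Finsupp.single n e) = e * n := by
  rw [wt, Finsupp.weight_single, smul_eq_mul]

theorem le_wt (α : ℕ+ →₀ ℕ) (n : ℕ+) : α n * n ≤ wt α := by
  classical
  conv_rhs => rw [← Finsupp.single_add_erase n α]
  rw [map_add, wt_single]
  omega

/-- Because $t_n$ weighs $n$, both the indices and the exponents that occur are bounded. Truncation
by weight therefore produces polynomials. -/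
theorem finite_wt_lt (N : ℕ) : {α | wt α < N}.Finite := by
  refine (Set.finite_Iic (Finsupp.indicator (Icc 1 N.succPNat) fun _ _ => N)).subset ?_
  intro α hα n
  have h1 := le_wt α n
  rw [Set.mem_ofPred_eq] at hα
  rcases Nat.eq_zero_or_pos (α n) with h0 | h0
  · omega
  · have h2 : (n : ℕ) ≤ α n * n := Nat.le_mul_of_pos_left _ h0
    have h3 : α n ≤ α n * n := Nat.le_mul_of_pos_right _ n.pos
    have h4 : n ∈ Icc 1 N.succPNat := by
      rw [mem_Icc]
      refine ⟨one_le, ?_⟩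
      rw [← PNat.coe_le_coe, Nat.succPNat_coe]
      omega
    rw [Finsupp.indicator_of_mem h4]
    omega

/-- All monomials of `f` have weight at least `N`. -/
def WtGE (N : ℕ) (f : MvPowerSeries ℕ+ K) : Prop := ∀ α, wt α < N → MvPowerSeries.coeff α f = 0

theorem WtGE.mono {N M : ℕ} {f : MvPowerSeries ℕ+ K} (hf : WtGE N f) (h : M ≤ N) : WtGE M f :=
  fun α hα => hf α (by omega)

theorem WtGE.add {N : ℕ} {f g : MvPowerSeries ℕ+ K} (hf : WtGE N f) (hg : WtGE N g) :
    WtGE N (f + g) := fun α hα => by rw [map_add, hf α hα, hg α hα, add_zero]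

theorem WtGE.sub {N : ℕ} {f g : MvPowerSeries ℕ+ K} (hf : WtGE N f) (hg : WtGE N g) :
    WtGE N (f - g) := fun α hα => by rw [map_sub, hf α hα, hg α hα, sub_zero]

theorem wtGE_sum {ι : Type*} {s : Finset ι} {N : ℕ} {f : ι → MvPowerSeries ℕ+ K}
    (h : ∀ i ∈ s, WtGE N (f i)) : WtGE N (∑ i ∈ s, f i) := fun α hα => by
  rw [map_sum]
  exact sum_eq_zero fun i hi => h i hi α hα

theorem wtGE_zero_left (f : MvPowerSeries ℕ+ K) : WtGE 0 f := fun α hα => absurd hα (by omega)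

theorem WtGE.mul {N M : ℕ} {f g : MvPowerSeries ℕ+ K} (hf : WtGE N f) (hg : WtGE M g) :
    WtGE (N + M) (f * g) := fun α hα => by
  classical
  rw [MvPowerSeries.coeff_mul]
  refine sum_eq_zero fun p hp => ?_
  rw [HasAntidiagonal.mem_antidiagonal] at hp
  rw [← hp, map_add] at hα
  by_cases h : wt p.1 < N
  · rw [hf _ h, zero_mul]
  · rw [hg _ (by omega), mul_zero]

theorem WtGE.pderiv {N : ℕ} {f : MvPowerSeries ℕ+ K} (hf : WtGE N f) (n : ℕ+) :
    WtGE (N - n) (MvPowerSeries.pderiv K n f) := fun α hα => by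
  rw [MvPowerSeries.coeff_pderiv, hf _ (by rw [map_add, wt_single]; omega), zero_mul]

theorem eq_of_forall_wtGE {f g : MvPowerSeries ℕ+ K} (h : ∀ N, WtGE N (f - g)) : f = g := by
  ext α
  exact sub_eq_zero.1 (by simpa using h (wt α + 1) α (by omega))

theorem wtGE_monomial (α : ℕ+ →₀ ℕ) (c : K) : WtGE (wt α) (MvPowerSeries.monomial α c) :=
  fun β hβ => by
    classical
    rw [MvPowerSeries.coeff_monomial, if_neg]
    rintro rfl
    omega

/-- `a_n = t_n + O(t_{n+1}, t_{n+2}, …)`. -/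
def Triangular (a : ℕ+ → MvPowerSeries ℕ+ K) : Prop :=
  ∀ (n : ℕ+) (α : ℕ+ →₀ ℕ), MvPowerSeries.coeff α (a n - MvPowerSeries.X n) ≠ 0 →
    α ≠ 0 ∧ ∀ m ∈ α.support, n < m

namespace Triangular

variable {a : ℕ+ → MvPowerSeries ℕ+ K}

/-- A nonconstant monomial in the later times contains some $t_m$ with $m>n$ and so weighs at least
$n+1$. Triangularity thereby becomes a statement about the weight filtration. -/
theorem wtGE_sub (ha : Triangular a) (n : ℕ+) : WtGE (n + 1) (a n - MvPowerSeries.X n) := fun α hα => by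
  by_contra h
  obtain ⟨h0, hm⟩ := ha n α h
  obtain ⟨m, hm0⟩ := Finsupp.ne_iff.1 h0
  have h1 := hm m (Finsupp.mem_support_iff.2 hm0)
  rw [← PNat.coe_lt_coe] at h1
  have h2 : (m : ℕ) ≤ α m * m := Nat.le_mul_of_pos_left _ (Nat.pos_of_ne_zero hm0)
  have h3 := le_wt α m
  omega

theorem wtGE_prod (ha : Triangular a) (α : ℕ+ →₀ ℕ) :
    WtGE (wt α) (α.prod fun s e => a s ^ e) ∧
      WtGE (wt α + 1) ((α.prod fun s e => a s ^ e) - MvPowerSeries.monomial α 1) := by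
  have hadd : ∀ (α β : ℕ+ →₀ ℕ) (f g : MvPowerSeries ℕ+ K),
      (WtGE (wt α) f ∧ WtGE (wt α + 1) (f - MvPowerSeries.monomial α 1)) →
      (WtGE (wt β) g ∧ WtGE (wt β + 1) (g - MvPowerSeries.monomial β 1)) →
      WtGE (wt (α + β)) (f * g) ∧
        WtGE (wt (α + β) + 1) (f * g - MvPowerSeries.monomial (α + β) 1) := by
    intro α β f g hf hg
    rw [map_add]
    refine ⟨hf.1.mul hg.1, ?_⟩
    have h : f * g - MvPowerSeries.monomial (α + β) 1 =
        (f - MvPowerSeries.monomial α 1) * g +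
          MvPowerSeries.monomial α 1 * (g - MvPowerSeries.monomial β 1) := by
      rw [mul_sub, MvPowerSeries.monomial_mul_monomial, one_mul]
      ring
    rw [h]
    exact ((hf.2.mul hg.1).mono (by omega)).add
      (((wtGE_monomial α 1).mul hg.2).mono (by omega))
  have hzero : WtGE (wt 0) (1 : MvPowerSeries ℕ+ K) ∧
      WtGE (wt 0 + 1) ((1 : MvPowerSeries ℕ+ K) - MvPowerSeries.monomial 0 1) := by
    refine ⟨by rw [map_zero]; exact wtGE_zero_left _, ?_⟩
    rw [MvPowerSeries.monomial_zero_one, sub_self]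
    exact fun _ _ => map_zero _
  induction α using Finsupp.induction_linear with
  | zero => simpa using hzero
  | add α β hα hβ =>
    rw [Finsupp.prod_add_index' (fun _ => pow_zero _) fun _ _ _ => pow_add _ _ _]
    exact hadd α β _ _ hα hβ
  | single n e =>
    rw [Finsupp.prod_single_index (h := fun s e => a s ^ e) (pow_zero _)]
    induction e with
    | zero => simpa using hzero
    | succ e ih =>
      rw [pow_succ, Finsupp.single_add]
      refine hadd _ _ _ _ ih ⟨?_, ?_⟩
      · have h := (ha.wtGE_sub n).mono (Nat.le_succ _)
        have hX : WtGE (n : ℕ) (MvPowerSeries.X n : MvPowerSeries ℕ+ K) := by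
          have := wtGE_monomial (Finsupp.single n 1) (1 : K)
          rwa [wt_single, one_mul] at this
        rw [wt_single, one_mul, ← sub_add_cancel (a n) (MvPowerSeries.X n)]
        exact h.add hX
      · rw [wt_single, one_mul]
        exact ha.wtGE_sub n

theorem hasSubst (ha : Triangular a) : MvPowerSeries.HasSubst a := by
  have hw : ∀ n : ℕ+, WtGE (n : ℕ) (a n) := fun n => by
    simpa [wt_single] using (ha.wtGE_prod (Finsupp.single n 1)).1
  refine ⟨fun n => ?_, fun d => ?_⟩
  · rw [← MvPowerSeries.coeff_zero_eq_constantCoeff_apply,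
      hw n 0 (by rw [map_zero]; exact n.pos)]
    exact IsNilpotent.zero
  · refine (Set.finite_Iic (wt d).succPNat).subset fun n hn => ?_
    rw [Set.mem_Iic, ← PNat.coe_le_coe, Nat.succPNat_coe]
    by_contra h
    exact hn (hw n d (by omega))

theorem coeff_subst (ha : Triangular a) (h : MvPowerSeries ℕ+ K) (β : ℕ+ →₀ ℕ) :
    MvPowerSeries.coeff β (MvPowerSeries.subst a h) =
      ∑ᶠ α, MvPowerSeries.coeff α h * MvPowerSeries.coeff β (α.prod fun s e => a s ^ e) :=
  MvPowerSeries.coeff_subst ha.hasSubst h β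

theorem wtGE_subst (ha : Triangular a) {N : ℕ} {h : MvPowerSeries ℕ+ K} (hh : WtGE N h) :
    WtGE N (MvPowerSeries.subst a h) := fun β hβ => by
  rw [ha.coeff_subst]
  refine finsum_eq_zero_of_forall_eq_zero fun α => ?_
  by_cases hα : wt α < N
  · rw [hh α hα, zero_mul]
  · rw [(ha.wtGE_prod α).1 β (by omega), mul_zero]

/-- The substitution acts as the identity on the graded pieces for the weight. Both injectivity and
surjectivity rest on this. -/
theorem wtGE_subst_sub (ha : Triangular a) {N : ℕ} {h : MvPowerSeries ℕ+ K} (hh : WtGE N h) :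
    WtGE (N + 1) (MvPowerSeries.subst a h - h) := fun β hβ => by
  classical
  rw [map_sub, sub_eq_zero, ha.coeff_subst]
  have hd : ∀ α, wt β < wt α + 1 → MvPowerSeries.coeff β (α.prod fun s e => a s ^ e) =
      if β = α then 1 else 0 := by
    intro α hα
    have := (ha.wtGE_prod α).2 β hα
    rwa [map_sub, sub_eq_zero, MvPowerSeries.coeff_monomial] at this
  rw [finsum_eq_single _ β]
  · rw [hd β (by omega), if_pos rfl, mul_one]
  · intro α hα
    by_cases h : wt α < N
    · rw [hh α h, zero_mul]
    · rw [hd α (by omega), if_neg hα.symm, mul_zero]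

theorem subst_injective (ha : Triangular a) : Function.Injective (MvPowerSeries.subst (R := K) a) := by
  intro f g hfg
  refine eq_of_forall_wtGE fun N => ?_
  induction N with
  | zero => exact wtGE_zero_left _
  | succ N ih =>
    have := ha.wtGE_subst_sub ih
    rw [MvPowerSeries.subst_sub ha.hasSubst, hfg, sub_self, zero_sub] at this
    intro α hα
    have := this α hα
    rwa [map_neg, neg_eq_zero] at this

/-- Every series is a substitution instance; any property of series that is preserved by
substitution and by the limits involved is inherited. -/
theorem exists_subst_eq (ha : Triangular a) {C : MvPowerSeries ℕ+ K → Prop} (h0 : C 0)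
    (hadd : ∀ f g, C f → C g → C (f + g)) (hsub : ∀ f g, C f → C g → C (f - g))
    (hsubst : ∀ f, C f → C (MvPowerSeries.subst a f))
    (hlim : ∀ f, (∀ α, ∃ g, C g ∧ MvPowerSeries.coeff α f = MvPowerSeries.coeff α g) → C f)
    {f : MvPowerSeries ℕ+ K} (hf : C f) : ∃ h, C h ∧ MvPowerSeries.subst a h = f := by
  -- Successive approximation: the current error is added to `h`, and each round raises the weight
  -- of the new error by at least one.
  let H : ℕ → MvPowerSeries ℕ+ K :=
    fun N => Nat.rec 0 (fun _ h => h + (f - MvPowerSeries.subst a h)) N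
  have hsucc : ∀ N, H (N + 1) = H N + (f - MvPowerSeries.subst a (H N)) := fun _ => rfl
  have hC : ∀ N, C (H N) := by
    intro N
    induction N with
    | zero => exact h0
    | succ N ih => rw [hsucc]; exact hadd _ _ ih (hsub _ _ hf (hsubst _ ih))
  have happ : ∀ N, WtGE N (f - MvPowerSeries.subst a (H N)) := by
    intro N
    induction N with
    | zero => exact wtGE_zero_left _
    | succ N ih =>
      have h1 := ha.wtGE_subst_sub ih
      have h2 : f - MvPowerSeries.subst a (H (N + 1)) =
          0 - (MvPowerSeries.subst a (f - MvPowerSeries.subst a (H N)) -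
            (f - MvPowerSeries.subst a (H N))) := by
        rw [hsucc, MvPowerSeries.subst_add ha.hasSubst]
        ring
      rw [h2]
      exact WtGE.sub (fun _ _ => map_zero _) h1
  have hstep : ∀ N M, N ≤ M → WtGE N (H M - H N) := by
    intro N M hNM
    induction M, hNM using Nat.le_induction with
    | base => rw [sub_self]; exact fun _ _ => map_zero _
    | succ M hM ih =>
      rw [hsucc, add_sub_right_comm]
      exact ih.add ((happ M).mono hM)
  let h : MvPowerSeries ℕ+ K := fun α => MvPowerSeries.coeff α (H (wt α + 1))
  have hh : ∀ α, MvPowerSeries.coeff α h = MvPowerSeries.coeff α (H (wt α + 1)) := fun _ => rfl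
  have hlim' : ∀ N, WtGE N (h - H N) := by
    intro N α hα
    have := hstep (wt α + 1) N hα α (by omega)
    rw [map_sub, sub_eq_zero] at this
    rw [map_sub, hh, this, sub_self]
  refine ⟨h, hlim h fun α => ⟨_, hC (wt α + 1), hh α⟩, (eq_of_forall_wtGE fun N => ?_)⟩
  have h1 := (ha.wtGE_subst (hlim' N)).sub (happ N)
  rw [MvPowerSeries.subst_sub ha.hasSubst] at h1
  convert h1 using 1
  ring

theorem pderiv_eq_zero (ha : Triangular a) {m n : ℕ+} (hmn : m < n) : MvPowerSeries.pderiv K m (a n) = 0 := by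
  ext α
  have h1 : MvPowerSeries.coeff (α + Finsupp.single m 1) (a n - MvPowerSeries.X n) = 0 := by
    by_contra h
    have := (ha n _ h).2 m (by simp)
    exact absurd hmn this.not_gt
  have h2 : MvPowerSeries.pderiv K m (a n) =
      MvPowerSeries.pderiv K m (a n - MvPowerSeries.X n) := by
    rw [map_sub, MvPowerSeries.pderiv_X_of_ne hmn.ne', sub_zero]
  rw [h2, MvPowerSeries.coeff_pderiv, h1, zero_mul, map_zero]

/-- The chain rule for triangular substitutions. -/
theorem pderiv_subst (ha : Triangular a) (m : ℕ+) (h : MvPowerSeries ℕ+ K) :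
    MvPowerSeries.pderiv K m (MvPowerSeries.subst a h) =
      ∑ n ∈ Iic m, MvPowerSeries.pderiv K m (a n) *
        MvPowerSeries.subst a (MvPowerSeries.pderiv K n h) := by
  classical
  have hs := ha.hasSubst
  have hpoly : ∀ p : MvPolynomial ℕ+ K,
      MvPowerSeries.pderiv K m (MvPowerSeries.subst a (p : MvPowerSeries ℕ+ K)) =
      ∑ n ∈ Iic m, MvPowerSeries.pderiv K m (a n) *
        MvPowerSeries.subst a (MvPowerSeries.pderiv K n (p : MvPowerSeries ℕ+ K)) := by
    intro p
    induction p using MvPolynomial.induction_on with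
    | C c =>
      rw [MvPolynomial.coe_C, MvPowerSeries.subst_C, MvPowerSeries.pderiv_C]
      refine (sum_eq_zero fun n _ => ?_).symm
      rw [MvPowerSeries.pderiv_C, ← MvPowerSeries.coe_substAlgHom hs, map_zero, mul_zero]
    | add p q hp hq =>
      rw [MvPolynomial.coe_add, MvPowerSeries.subst_add hs, map_add, hp, hq, ← sum_add_distrib]
      refine sum_congr rfl fun n _ => ?_
      rw [map_add, MvPowerSeries.subst_add hs, mul_add]
    | mul_X p k hp =>
      have hX : MvPowerSeries.pderiv K m (a k) = ∑ n ∈ Iic m, MvPowerSeries.pderiv K m (a n) *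
          MvPowerSeries.subst a (MvPowerSeries.pderiv K n (MvPowerSeries.X k)) := by
        have hk : ∀ n, MvPowerSeries.subst a
            (MvPowerSeries.pderiv K n (MvPowerSeries.X k : MvPowerSeries ℕ+ K)) =
            if n = k then 1 else 0 := by
          intro n
          rw [← MvPowerSeries.coe_substAlgHom hs]
          split_ifs with hnk
          · rw [hnk, MvPowerSeries.pderiv_X_self, map_one]
          · rw [MvPowerSeries.pderiv_X_of_ne (Ne.symm hnk), map_zero]
        simp only [hk, mul_ite, mul_one, mul_zero, sum_ite_eq', mem_Iic]
        split_ifs with hkm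
        · rfl
        · exact ha.pderiv_eq_zero (not_le.1 hkm)
      rw [MvPolynomial.coe_mul, MvPolynomial.coe_X, MvPowerSeries.subst_mul hs,
        MvPowerSeries.subst_X hs, Derivation.leibniz, hp, hX, smul_eq_mul, smul_eq_mul, mul_sum,
        mul_sum, ← sum_add_distrib]
      refine sum_congr rfl fun n _ => ?_
      rw [Derivation.leibniz, MvPowerSeries.subst_add hs, smul_eq_mul, smul_eq_mul,
        MvPowerSeries.subst_mul hs, MvPowerSeries.subst_mul hs, MvPowerSeries.subst_X hs]
      ring
  refine eq_of_forall_wtGE fun N => ?_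
  -- The cut is at weight `N + m` because the derivatives involved, with index at most `m`, lower
  -- weights by at most `m`. The error on both sides then has weight at least `N`.
  let p : MvPolynomial ℕ+ K :=
    ∑ α ∈ (finite_wt_lt (N + m)).toFinset, MvPolynomial.monomial α (MvPowerSeries.coeff α h)
  have hp : WtGE (N + m) (h - (p : MvPowerSeries ℕ+ K)) := by
    intro α hα
    rw [map_sub, MvPolynomial.coeff_coe, sub_eq_zero]
    simp only [p, MvPolynomial.coeff_sum, MvPolynomial.coeff_monomial, sum_ite_eq']
    rw [if_pos ((finite_wt_lt (N + m)).mem_toFinset.2 hα)]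
  have h1 : WtGE N (MvPowerSeries.pderiv K m (MvPowerSeries.subst a (h - (p : MvPowerSeries ℕ+ K)))) :=
    ((ha.wtGE_subst hp).pderiv m).mono (by omega)
  have h2 : WtGE N (∑ n ∈ Iic m, MvPowerSeries.pderiv K m (a n) *
      MvPowerSeries.subst a (MvPowerSeries.pderiv K n (h - (p : MvPowerSeries ℕ+ K)))) := by
    refine wtGE_sum fun n hn => ?_
    rw [mem_Iic, ← PNat.coe_le_coe] at hn
    exact ((wtGE_zero_left _).mul (ha.wtGE_subst (hp.pderiv n))).mono (by omega)
  convert h1.sub h2 using 1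
  simp only [MvPowerSeries.subst_sub hs, map_sub, mul_sub, sum_sub_distrib, hpoly]
  ring

end Triangular

end Triangular

/-! ### The change of times acting on functions of x and t. -/

section TimeChange

variable {A : Type*} [CommRing A] {τ : ℕ+ → MvPowerSeries ℕ+ A}

theorem IsTriangular.triangular (hτ : IsTriangular τ) : Triangular fun n => ofTimes (τ n) := by
  intro n α h
  refine hτ n α fun h0 => h ?_
  have hX : (MvPowerSeries.X n : Fun A) = ofTimes (MvPowerSeries.X n) := by
    rw [ofTimes, MvPowerSeries.map_X]
  rw [hX, ← map_sub, ofTimes, MvPowerSeries.coeff_map, h0, map_zero]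

/-- The substituted series do not involve `x`, so every new coefficient is an `A`-linear combination
of old ones. -/
theorem XBdd.timeChange (hτ : IsTriangular τ) {N : ℕ} {f : Fun A} (hf : XBdd N f) :
    XBdd N (timeChange τ f) := fun β n hn => by
  rw [KP.timeChange, hτ.triangular.coeff_subst]
  refine finsum_induction (fun u : LaurentSeries A => u.coeff n = 0) HahnSeries.coeff_zero
    (fun u v hu hv => by rw [HahnSeries.coeff_add, hu, hv, add_zero]) fun α => ?_
  have h : (α.prod fun s e => ofTimes (τ s) ^ e) = ofTimes (α.prod fun s e => τ s ^ e) := by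
    rw [Finsupp.prod, Finsupp.prod, map_prod]
    simp only [map_pow]
  rw [h, ofTimes, MvPowerSeries.coeff_map, mul_comm, HahnSeries.C_mul_eq_smul,
    HahnSeries.coeff_smul, hf α n hn, smul_zero]

theorem xBdd_of_forall {N : ℕ} {f : Fun A}
    (h : ∀ α, ∃ g, XBdd N g ∧ MvPowerSeries.coeff α f = MvPowerSeries.coeff α g) : XBdd N f :=
  fun α n hn => by
    obtain ⟨g, hg, e⟩ := h α
    rw [e, hg α n hn]

theorem bijOn_timeChange (hτ : IsTriangular τ) (I : AddSubmonoid ℕ) :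
    Set.BijOn (timeChange τ) (bddSubring A I) (bddSubring A I) := by
  refine ⟨?_, hτ.triangular.subst_injective.injOn, ?_⟩
  · rintro f ⟨N, hN, hf⟩
    exact ⟨N, hN, hf.timeChange hτ⟩
  · rintro f ⟨N, hN, hf⟩
    obtain ⟨h, hh, e⟩ := hτ.triangular.exists_subst_eq (C := XBdd N)
      (by simpa using (xBdd_ofTimes (A := A) 0).mono (Nat.zero_le N)) (fun _ _ => XBdd.add)
      (fun f g hf hg => by rw [sub_eq_add_neg]; exact hf.add hg.neg)
      (fun f hf => hf.timeChange hτ) (fun f hf => xBdd_of_forall hf) hf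
    exact ⟨h, ⟨N, hN, hh⟩, e⟩

theorem tDeriv_timeChange (hτ : IsTriangular τ) (m : ℕ+) (h : Fun A) :
    tDeriv m (timeChange τ h) =
      ∑ n ∈ Iic m, tDeriv m (ofTimes (τ n)) * timeChange τ (tDeriv n h) :=
  hτ.triangular.pderiv_subst m h

end TimeChange

end KP

end

/-! ### Approximate common solutions of ∂X/∂t_n = [B_n, X] and their limit. -/

noncomputable section

namespace KP

open Finset MicroDiff

set_option linter.unusedSectionVars false

section Approximation

attribute [local instance] ringStructure

variable {A : Type*} [CommRing A]

theorem one_deriv : (1 : Fun A)′ = 0 := by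
  rw [deriv_eq_xDeriv, ← map_one (ofTimes (A := A)), xDeriv_ofTimes]

/-- The derivation `P ↦ ∂P/∂t_n - [B_n, P]`. -/
def zsDeriv (B : ℕ+ → MicroDiff (Fun A)) (n : ℕ+) : MicroDiff (Fun A) →+ MicroDiff (Fun A) :=
  opDerivHom n - (AddMonoidHom.mulLeft (B n) - AddMonoidHom.mulRight (B n))

variable {B : ℕ+ → MicroDiff (Fun A)}

theorem zsDeriv_apply (n : ℕ+) (P : MicroDiff (Fun A)) :
    zsDeriv B n P = opDeriv n P - (B n * P - P * B n) := rfl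

theorem zsDeriv_mul (n : ℕ+) (P Q : MicroDiff (Fun A)) :
    zsDeriv B n (P * Q) = zsDeriv B n P * Q + P * zsDeriv B n Q := by
  simp only [zsDeriv_apply, opDeriv_mul, sub_mul, mul_sub, mul_assoc]
  abel

theorem zsDeriv_ofFun (n : ℕ+) {c : Fun A} (hc : c′ = 0) :
    zsDeriv B n (ofFun c) = ofFun (tDeriv n c) := by
  rw [zsDeriv_apply, opDeriv_ofFun, ofFun_mul_comm hc, sub_self, sub_zero]

theorem zsDeriv_ofFun_mul (n : ℕ+) {c : Fun A} (hc : c′ = 0) (P : MicroDiff (Fun A)) :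
    zsDeriv B n (ofFun c * P) = ofFun (tDeriv n c) * P + ofFun c * zsDeriv B n P := by
  rw [zsDeriv_mul, zsDeriv_ofFun n hc]

/-- Monic differential operators `B_n` of order `n` that solve the Zakharov-Shabat equations, with
coefficients in a function ring. -/
structure ZSSystem (I : AddSubmonoid ℕ) (B : ℕ+ → MicroDiff (Fun A)) : Prop where
  mem : ∀ n k, (B n).coeff k ∈ bddSubring A I
  isDifferential : ∀ n, (B n).IsDifferential
  isMonic : ∀ n : ℕ+, (B n).IsMonic ((n : ℕ) : ℤ)
  zakharovShabat : ZakharovShabat B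

variable {I : AddSubmonoid ℕ}

namespace ZSSystem

/-- The gain is that the right-hand side has order at most $n-1$ for every $m$, whereas the general
estimate for the left-hand side only gives $n+m-1$. -/
theorem zsDeriv_B (hB : ZSSystem I B) (n m : ℕ+) : zsDeriv B n (B m) = opDeriv m (B n) := by
  have h := hB.zakharovShabat n m
  rw [MicroDiff.comm] at h
  rw [zsDeriv_apply, ← sub_eq_zero, ← neg_eq_zero, ← h]
  abel

theorem ordLE_zsDeriv (hB : ZSSystem I B) (n : ℕ+) {P : MicroDiff (Fun A)} {N : ℤ}
    (hP : P.OrdLE N) : (zsDeriv B n P).OrdLE (N + n - 1) := by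
  have hn : (1 : ℤ) ≤ (n : ℕ) := by exact_mod_cast n.pos
  exact ((ordLE_opDeriv n hP).mono (by omega)).sub
    (((hB.isMonic n).ordLE.comm hP).mono (by omega))

/-- For $n>1$ the order $N+n-1$ exceeds $N$, so only the commutator contributes. A vanishing top
coefficient then shows that the leading coefficient of `P` is independent of $x$. -/
theorem coeff_zsDeriv_top (hB : ZSSystem I B) {n : ℕ+} (hn : 1 < n) {P : MicroDiff (Fun A)} {N : ℤ}
    (hP : P.OrdLE N) : (zsDeriv B n P).coeff (N + n - 1) = -((n : ℕ) • (P.coeff N)′) := by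
  have hn' : (1 : ℤ) < (n : ℕ) := by exact_mod_cast hn
  have h := coeff_comm_top (hB.isMonic n).ordLE hP
  rw [(hB.isMonic n).1, one_deriv, mul_zero, smul_zero, sub_zero, one_mul,
    add_comm] at h
  rw [zsDeriv_apply, MicroDiff.coeff_sub, ordLE_opDeriv n hP _ (by omega), h, zero_sub,
    natCast_zsmul]

end ZSSystem

/-- Monic operators `X` of order one for which `∂X/∂t_n - [B_n, X]` has order at most `n - m`. -/
structure IsApprox (I : AddSubmonoid ℕ) (B : ℕ+ → MicroDiff (Fun A)) (m : ℕ)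
    (X : MicroDiff (Fun A)) : Prop where
  isMonic : X.IsMonic 1
  mem : ∀ k, X.coeff k ∈ bddSubring A I
  ordLE : ∀ n : ℕ+, (zsDeriv B n X).OrdLE (n - m)

theorem IsApprox.mono {m m' : ℕ} (h : m' ≤ m) {X : MicroDiff (Fun A)} (hX : IsApprox I B m X) :
    IsApprox I B m' X :=
  ⟨hX.isMonic, hX.mem, fun n => (hX.ordLE n).mono (by omega)⟩

theorem IsApprox.exists_unit {m : ℕ} {X : MicroDiff (Fun A)} (hX : IsApprox I B m X) :
    ∃ u : (MicroDiff (Fun A))ˣ, (u : MicroDiff (Fun A)) = X := hX.isMonic.exists_unit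

variable [Algebra ℂ A]

/-- Take $X$ with $X^m-B_m$ of order at most $0$. Then $D_n(X^m)$ has order at most $n-1$, and
dividing out the power loses $m-1$. -/
theorem ZSSystem.exists_approx (hB : ZSSystem I B) {m : ℕ} (hm : m ≠ 0) :
    ∃ X, IsApprox I B m X := by
  have := isAddTorsionFree_of_complex (Fun A)
  have hm1 : 1 ≤ m := Nat.one_le_iff_ne_zero.2 hm
  let b : ℕ+ := ⟨m, hm1⟩
  obtain ⟨X, hXS, hX, hord⟩ := IsMonic.exists_approx_root (T := bddSubring A I)
    (hT := deriv_mem_bddSubring) (m := m) (exists_natCast_mul_eq hm) (hB.isMonic b) (hB.mem b)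
    (m - 1)
  refine ⟨X, hX, hXS, fun n => ordLE_of_derivation_pow (zsDeriv_mul n) hX hm ?_⟩
  rw [← sub_add_cancel (X ^ m) (B b), map_add, hB.zsDeriv_B]
  refine ((hB.ordLE_zsDeriv n hord).mono ?_).add
    ((ordLE_opDeriv_of_isMonic b (hB.isMonic n)).mono ?_)
  · push_cast [hm1]
    omega
  · omega

/-- Two approximate solutions differ by an expansion whose coefficients are constants. -/
theorem ZSSystem.compare (hB : ZSSystem I B) {m : ℕ} (hm : m ≠ 0) {X : MicroDiff (Fun A)}
    {u : (MicroDiff (Fun A))ˣ} (hX : IsApprox I B m X) (hu : IsApprox I B m u) :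
    ∃ a : ℤ → Fun A, (∀ k, a k ∈ bddSubring A I ∧ (a k)′ = 0) ∧ a 1 = 1 ∧
      (X - ∑ k ∈ Ioc (1 - m : ℤ) 1, ofFun (a k) * (u ^ k : (MicroDiff (Fun A))ˣ)).OrdLE (1 - m) ∧
      ∀ (n : ℕ+), ∀ k ∈ Ioc (1 - m : ℤ) 1, n < m + k → tDeriv n (a k) = 0 := by
  have := isAddTorsionFree_of_complex (Fun A)
  have hQ := isMonic_zpow hu.isMonic
  have hDQ : ∀ (n : ℕ+) (k : ℤ), k ≤ 1 →
      (zsDeriv B n ((u ^ k : (MicroDiff (Fun A))ˣ) : MicroDiff (Fun A))).OrdLE (n - m) :=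
    fun n k hk => (ordLE_derivation_zpow (zsDeriv_mul n) hu.isMonic (hu.ordLE n) k).mono (by omega)
  have hsum : ∀ (n : ℕ+) (a : ℤ → Fun A) (s : Finset ℤ), (∀ k, (a k)′ = 0) →
      zsDeriv B n (∑ k ∈ s, ofFun (a k) * (u ^ k : (MicroDiff (Fun A))ˣ)) =
      ∑ k ∈ s, ofFun (tDeriv n (a k)) * (u ^ k : (MicroDiff (Fun A))ˣ) +
      ∑ k ∈ s, ofFun (a k) * zsDeriv B n (u ^ k : (MicroDiff (Fun A))ˣ) := by
    intro n a s ha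
    rw [map_sum, ← sum_add_distrib]
    exact sum_congr rfl fun k _ => zsDeriv_ofFun_mul n (ha k) _
  obtain ⟨a, ha, hord⟩ := exists_expansion hQ
    (C := fun c => c ∈ bddSubring A I ∧ c′ = 0) ⟨zero_mem _, map_zero _⟩ (d := 1 - m)
    hX.isMonic.ordLE (fun j a hj hj1 ha hord => by
      have hmem : X - ∑ k ∈ Ioc j 1, ofFun (a k) * (u ^ k : (MicroDiff (Fun A))ˣ) ∈
          opSubring (bddSubring A I) deriv_mem_bddSubring :=
        sub_mem hX.mem (sum_mem fun k _ => mul_mem (ofFun_mem_opSubring (ha k).1)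
          (zpow_mem_opSubring hu.isMonic hu.mem k))
      refine ⟨hmem j, ?_⟩
      -- For $n=m+1$ the level-$m$ bound is $n-m=1$, while $D_n$ takes a remainder of order $j>1-m$
      -- to order $j+m>1$ with top coefficient $-n$ times the derivative of its leading coefficient.
      -- That derivative must vanish.
      have hn1 : (1 : ℕ+) < m.succPNat := by
        rw [← PNat.coe_lt_coe, Nat.succPNat_coe]
        exact Nat.succ_lt_succ (Nat.pos_of_ne_zero hm)
      have htop := hB.coeff_zsDeriv_top hn1 hord
      rw [Nat.succPNat_coe] at htop
      have h0 : (zsDeriv B m.succPNat (X - ∑ k ∈ Ioc j 1,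
          ofFun (a k) * (u ^ k : (MicroDiff (Fun A))ˣ))).OrdLE 1 := by
        have h1 : (((m.succPNat : ℕ+) : ℕ) : ℤ) - m ≤ 1 := by rw [Nat.succPNat_coe]; omega
        rw [map_sub, hsum _ _ _ fun k => (ha k).2]
        refine ((hX.ordLE _).mono h1).sub (OrdLE.add ?_ ?_) <;>
          refine ordLE_sum fun k hk => ?_ <;> rw [mem_Ioc] at hk
        · exact ((hQ k).ordLE.mono hk.2).ofFun_mul _
        · exact ((hDQ _ k hk.2).mono h1).ofFun_mul _
      rw [h0 _ (by push_cast; omega)] at htop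
      exact (nsmul_eq_zero_iff_right (Nat.succ_ne_zero m)).1 (neg_eq_zero.1 htop.symm))
  refine ⟨a, ha, ?_, hord, fun n k hk hn => ?_⟩
  · have h1 := hord 1 (by omega)
    rw [MicroDiff.coeff_sub, hX.isMonic.1, coeff_sum, sum_eq_single 1, coeff_ofFun_mul, (hQ 1).1,
      mul_one, sub_eq_zero] at h1
    · exact h1.symm
    · intro k hk hne
      rw [mem_Ioc] at hk
      rw [coeff_ofFun_mul, (hQ k).ordLE 1 (by omega), mul_zero]
    · intro h
      exact absurd (mem_Ioc.2 ⟨by omega, le_rfl⟩) h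
  -- In $D_n$ of the expansion, everything except $\sum(\partial a_k/\partial t_n)u^k$ has order at
  -- most $n-m$, so the terms with $k>n-m$ drop out.
  · refine eq_zero_of_sum_ordLE hQ (a := fun k => tDeriv n (a k)) (d := n - m) ?_ k hk (by omega)
    have h1 := hsum n a (Ioc (1 - m : ℤ) 1) fun k => (ha k).2
    have h2 : ∑ k ∈ Ioc (1 - m : ℤ) 1, ofFun (tDeriv n (a k)) * (u ^ k : (MicroDiff (Fun A))ˣ) =
        zsDeriv B n X - zsDeriv B n (X - ∑ k ∈ Ioc (1 - m : ℤ) 1,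
          ofFun (a k) * (u ^ k : (MicroDiff (Fun A))ˣ)) -
        ∑ k ∈ Ioc (1 - m : ℤ) 1, ofFun (a k) * zsDeriv B n (u ^ k : (MicroDiff (Fun A))ˣ) := by
      rw [map_sub, h1]
      abel
    rw [h2]
    refine ((hX.ordLE n).sub ((hB.ordLE_zsDeriv n hord).mono (by omega))).sub
      (ordLE_sum fun k hk => ?_)
    rw [mem_Ioc] at hk
    exact (hDQ n k hk.2).ofFun_mul _

/-! ### Functions of the higher times -/

/-- `f` vanishes when `t_n = 0` for all `n ≥ N`. -/
def TailGE (N : ℤ) (f : Fun A) : Prop :=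
  ∀ α : ℕ+ →₀ ℕ, (∀ n ∈ α.support, ((n : ℕ) : ℤ) < N) → MvPowerSeries.coeff α f = 0

theorem TailGE.mono {N M : ℤ} {f : Fun A} (hf : TailGE N f) (h : M ≤ N) : TailGE M f :=
  fun α hα => hf α fun n hn => (hα n hn).trans_le h

theorem tailGE_zero (N : ℤ) : TailGE N (0 : Fun A) := fun _ _ => map_zero _

theorem TailGE.add {N : ℤ} {f g : Fun A} (hf : TailGE N f) (hg : TailGE N g) :
    TailGE N (f + g) := fun α hα => by rw [map_add, hf α hα, hg α hα, add_zero]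

theorem TailGE.neg {N : ℤ} {f : Fun A} (hf : TailGE N f) : TailGE N (-f) :=
  fun α hα => by rw [map_neg, hf α hα, neg_zero]

theorem TailGE.sub {N : ℤ} {f g : Fun A} (hf : TailGE N f) (hg : TailGE N g) :
    TailGE N (f - g) := by
  rw [sub_eq_add_neg]
  exact hf.add hg.neg

theorem tailGE_sum {ι : Type*} {s : Finset ι} {N : ℤ} {f : ι → Fun A}
    (h : ∀ i ∈ s, TailGE N (f i)) : TailGE N (∑ i ∈ s, f i) := fun α hα => by
  rw [map_sum]
  exact sum_eq_zero fun i hi => h i hi α hα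

theorem TailGE.zsmul {N : ℤ} {f : Fun A} (hf : TailGE N f) (z : ℤ) : TailGE N (z • f) :=
  fun α hα => by rw [map_zsmul, hf α hα, smul_zero]

theorem TailGE.mul_left {N : ℤ} {f : Fun A} (hf : TailGE N f) (g : Fun A) : TailGE N (g * f) :=
  fun α hα => by
    classical
    rw [MvPowerSeries.coeff_mul]
    refine sum_eq_zero fun p hp => ?_
    rw [HasAntidiagonal.mem_antidiagonal] at hp
    rw [hf p.2 fun n hn => hα n ?_, mul_zero]
    rw [Finsupp.mem_support_iff] at hn ⊢
    rw [← hp, Finsupp.add_apply]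
    omega

theorem TailGE.iterDeriv {N : ℤ} {f : Fun A} (hf : TailGE N f) (r : ℕ) :
    TailGE N (iterDeriv (Fun A) r f) := by
  induction r with
  | zero => exact hf
  | succ r ih =>
    intro α hα
    rw [iterDeriv_succ, deriv_eq_xDeriv]
    ext n
    rw [coeff_coeff_xDeriv, ih α hα]
    simp

theorem TailGE.tDeriv {N : ℤ} {f : Fun A} (hf : TailGE N f) {n : ℕ+} (hn : ((n : ℕ) : ℤ) < N) :
    TailGE N (tDeriv n f) := fun α hα => by
  classical
  rw [coeff_tDeriv, hf, smul_zero]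
  intro m hm
  rcases eq_or_ne m n with rfl | hne
  · exact hn
  · refine hα m ?_
    rw [Finsupp.mem_support_iff] at hm ⊢
    simpa [Finsupp.single_apply, hne.symm] using hm

theorem eq_zero_of_forall_tailGE {f : Fun A} {N₀ : ℤ} (h : ∀ N ≥ N₀, TailGE N f) : f = 0 := by
  ext1 α
  refine (h (max N₀ (wt α + 1)) (le_max_left _ _) α fun n hn => ?_).trans (map_zero _).symm
  have h1 := le_wt α n
  have h2 : (n : ℕ) ≤ α n * n :=
    Nat.le_mul_of_pos_left _ (Nat.pos_of_ne_zero (Finsupp.mem_support_iff.1 hn))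
  omega

/-- The value at `t = 0`, as a function independent of the times. -/
def initial (f : Fun A) : Fun A := MvPowerSeries.C (MvPowerSeries.constantCoeff f)

theorem coeff_initial (f : Fun A) {α : ℕ+ →₀ ℕ} (hα : α ≠ 0) :
    MvPowerSeries.coeff α (initial f) = 0 := by
  classical
  rw [initial, MvPowerSeries.coeff_C, if_neg hα]

theorem coeff_zero_initial (f : Fun A) :
    MvPowerSeries.coeff 0 (initial f) = MvPowerSeries.coeff 0 f := by
  rw [initial, MvPowerSeries.coeff_zero_C, MvPowerSeries.coeff_zero_eq_constantCoeff_apply]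

theorem initial_mem {f : Fun A} (hf : f ∈ bddSubring A I) : initial f ∈ bddSubring A I := by
  obtain ⟨N, hN, hf⟩ := hf
  refine ⟨N, hN, fun α n hn => ?_⟩
  rcases eq_or_ne α 0 with rfl | hα
  · rw [coeff_zero_initial, hf 0 n hn]
  · rw [coeff_initial f hα]
    rfl

theorem tDeriv_initial (n : ℕ+) (f : Fun A) : tDeriv n (initial f) = 0 :=
  MvPowerSeries.pderiv_C

theorem initial_one : initial (1 : Fun A) = 1 := by rw [initial, map_one, map_one]

theorem deriv_initial {f : Fun A} (hf : f′ = 0) : (initial f)′ = 0 := by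
  rw [deriv_eq_xDeriv] at hf ⊢
  ext α n
  rw [coeff_coeff_xDeriv]
  rcases eq_or_ne α 0 with rfl | hα
  · rw [coeff_zero_initial, ← coeff_coeff_xDeriv, hf]
  · rw [coeff_initial f hα]
    simp

/-- A nonconstant monomial in the times before `N` would be detected by one of the vanishing
derivatives. -/
theorem tailGE_sub_initial {f : Fun A} {N : ℤ}
    (hf : ∀ n : ℕ+, ((n : ℕ) : ℤ) < N → tDeriv n f = 0) : TailGE N (f - initial f) := by
  have := isAddTorsionFree_of_complex (LaurentSeries A)
  intro α hα
  rw [map_sub]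
  rcases eq_or_ne α 0 with rfl | h0
  · rw [coeff_zero_initial, sub_self]
  rw [coeff_initial f h0, sub_zero]
  obtain ⟨n, hn⟩ := Finsupp.ne_iff.1 h0
  rw [Finsupp.zero_apply] at hn
  have h1 := coeff_tDeriv n f (α - Finsupp.single n 1)
  rw [hf n (hα n (Finsupp.mem_support_iff.2 hn)), map_zero,
    tsub_add_cancel_of_le (Finsupp.single_le_iff.2 (Nat.one_le_iff_ne_zero.2 hn))] at h1
  exact (nsmul_eq_zero_iff_right (Nat.succ_ne_zero _)).1 h1.symm

/-- When `P` has order at most `n`, only the coefficients of `Z` in orders at least `k - n` reach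
$\partial^k$. -/
theorem coeff_mul_tailGE {P Z : MicroDiff (Fun A)} {n k N : ℤ} (hP : P.OrdLE n)
    (hZ : ∀ j, k - n ≤ j → TailGE N (Z.coeff j)) :
    TailGE N ((P * Z).coeff k) ∧ TailGE N ((Z * P).coeff k) := by
  constructor <;> rw [coeff_mul] <;>
    refine finsum_induction (TailGE N) (tailGE_zero N) (fun _ _ => TailGE.add) fun p => ?_
  · by_cases hp : n < p.1
    · rw [hP _ hp, zero_mul, smul_zero]
      exact tailGE_zero N
    · exact (((hZ _ (by omega)).iterDeriv _).mul_left _).zsmul _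
  · by_cases hp : n < k - p.1 + p.2
    · rw [hP _ hp, map_zero, mul_zero, smul_zero]
      exact tailGE_zero N
    · rw [mul_comm]
      exact ((hZ _ (by omega)).mul_left _).zsmul _

/-! ### Passage to the limit -/

/-- Expand `X` in powers of some approximation of level `m + 1` and freeze the coefficients at `t =
0`. Frozen coefficients are killed by every $D_n$, so the level is kept, and the error $a_j-a_j(0)$
involves only times from $m+j$ on. -/
theorem ZSSystem.exists_next (hB : ZSSystem I B) {m : ℕ} (hm : m ≠ 0) {X : MicroDiff (Fun A)}
    (hX : IsApprox I B m X) : ∃ Y, IsApprox I B (m + 1) Y ∧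
      ∀ k : ℤ, 2 - m ≤ k → TailGE (m + k) ((Y - X).coeff k) := by
  obtain ⟨Y, hY⟩ := hB.exists_approx (Nat.succ_ne_zero m)
  obtain ⟨u, rfl⟩ := hY.exists_unit
  have hQ := isMonic_zpow hY.isMonic
  obtain ⟨a, ha, ha1, hord, hta⟩ := hB.compare hm hX (hY.mono (Nat.le_succ m))
  have hconst : ∀ k, (initial (a k))′ = 0 := fun k => deriv_initial (ha k).2
  refine ⟨∑ k ∈ Ioc (1 - m : ℤ) 1, ofFun (initial (a k)) * (u ^ k : (MicroDiff (Fun A))ˣ),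
    ⟨⟨?_, ?_⟩, ?_, fun n => ?_⟩, fun k hk => ?_⟩
  · rw [coeff_sum, sum_eq_single 1, coeff_ofFun_mul, (hQ 1).1, mul_one, ha1, initial_one]
    · intro k hk hne
      rw [mem_Ioc] at hk
      rw [coeff_ofFun_mul, (hQ k).ordLE 1 (by omega), mul_zero]
    · intro h
      exact absurd (mem_Ioc.2 ⟨by omega, le_rfl⟩) h
  · refine ordLE_sum fun k hk => ?_
    rw [mem_Ioc] at hk
    exact ((hQ k).ordLE.mono hk.2).ofFun_mul _
  · exact sum_mem (S := opSubring (bddSubring A I) deriv_mem_bddSubring) fun k _ =>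
      mul_mem (ofFun_mem_opSubring (initial_mem (ha k).1)) (zpow_mem_opSubring hY.isMonic hY.mem k)
  · rw [map_sum]
    refine ordLE_sum fun k hk => ?_
    rw [mem_Ioc] at hk
    rw [zsDeriv_ofFun_mul n (hconst k), tDeriv_initial, ofFun_zero, zero_mul, zero_add]
    exact ((ordLE_derivation_zpow (zsDeriv_mul n) hY.isMonic (hY.ordLE n) k).mono
      (by omega)).ofFun_mul _
  · have h1 := hord k (by omega)
    rw [MicroDiff.coeff_sub, sub_eq_zero] at h1
    rw [MicroDiff.coeff_sub, h1, coeff_sum, coeff_sum, ← sum_sub_distrib]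
    refine tailGE_sum fun j hj => ?_
    rw [coeff_ofFun_mul, coeff_ofFun_mul, ← sub_mul, mul_comm, ← neg_sub]
    by_cases hjk : j < k
    · rw [(hQ j).ordLE k hjk, zero_mul]
      exact tailGE_zero _
    · exact ((tailGE_sub_initial (N := m + j) fun n hn => hta n j hj hn).mono
        (by omega)).neg.mul_left _

theorem ZSSystem.exists_seq (hB : ZSSystem I B) : ∃ X : ℕ → MicroDiff (Fun A),
    ∀ m ≠ 0, IsApprox I B m (X m) ∧
      ∀ k : ℤ, 2 - m ≤ k → TailGE (m + k) ((X (m + 1) - X m).coeff k) := by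
  obtain ⟨X₁, h₁⟩ := hB.exists_approx one_ne_zero
  choose! next hnext using fun (m : ℕ) (hm : m ≠ 0) (X : MicroDiff (Fun A)) =>
    hB.exists_next hm (X := X)
  let X : ℕ → MicroDiff (Fun A) := fun m => Nat.rec X₁ (fun i Y => next (i + 1) Y) (m - 1)
  have hX : ∀ i, X (i + 2) = next (i + 1) (X (i + 1)) := fun i => rfl
  have happ : ∀ i, IsApprox I B (i + 1) (X (i + 1)) := by
    intro i
    induction i with
    | zero => exact h₁
    | succ i ih => rw [hX]; exact (hnext (i + 1) (Nat.succ_ne_zero i) _ ih).1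
  refine ⟨X, fun m hm => ?_⟩
  obtain ⟨i, rfl⟩ := Nat.exists_eq_succ_of_ne_zero hm
  exact ⟨happ i, by rw [hX]; exact (hnext (i + 1) (Nat.succ_ne_zero i) _ (happ i)).2⟩

/-- There is a monic operator `M` of order one with `∂M/∂t_n = [B_n, M]` for all `n`. -/
theorem ZSSystem.exists_solution (hB : ZSSystem I B) : ∃ M : MicroDiff (Fun A), M.IsMonic 1 ∧
    (∀ k, M.coeff k ∈ bddSubring A I) ∧ ∀ n, zsDeriv B n M = 0 := by
  obtain ⟨X, hX⟩ := hB.exists_seq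
  have hstep : ∀ (k : ℤ) (m m' : ℕ), m ≠ 0 → 2 - m ≤ k → m ≤ m' →
      TailGE (m + k) ((X m' - X m).coeff k) := by
    intro k m m' hm hk hmm'
    induction m', hmm' using Nat.le_induction with
    | base => rw [sub_self]; exact tailGE_zero _
    | succ m' hm' ih =>
      rw [← sub_add_sub_cancel, MicroDiff.coeff_add]
      exact (((hX m' (by omega)).2 k (by omega)).mono (by omega)).add ih
  -- At this level the coefficient of $t^\alpha\partial^k$ is final: the times occurring in `α` have
  -- index at most `wt α`, which is less than `μ k α + k`.
  let μ : ℤ → (ℕ+ →₀ ℕ) → ℕ := fun k α => k.natAbs + 2 + wt α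
  let c : ℤ → Fun A := fun k α => MvPowerSeries.coeff α ((X (μ k α)).coeff k)
  have hc : ∀ k α, MvPowerSeries.coeff α (c k) = MvPowerSeries.coeff α ((X (μ k α)).coeff k) :=
    fun _ _ => rfl
  have happ : ∀ k α, IsApprox I B (μ k α) (X (μ k α)) := fun k α =>
    (hX _ (by simp only [μ]; omega)).1
  have hc1 : c 1 = 1 := by
    ext1 α
    rw [hc, (happ 1 α).isMonic.1]
  have hc2 : ∀ k, 1 < k → c k = 0 := by
    intro k hk
    ext1 α
    rw [hc, (happ k α).isMonic.2 k hk, map_zero]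
  obtain ⟨M, hM⟩ : ∃ M : MicroDiff (Fun A), ∀ k, M.coeff k = c k := ⟨⟨c, 1, hc2⟩, fun _ => rfl⟩
  have hsupp : ∀ (α : ℕ+ →₀ ℕ), ∀ n ∈ α.support, (n : ℕ) ≤ wt α := fun α n hn =>
    (Nat.le_mul_of_pos_left _ (Nat.pos_of_ne_zero (Finsupp.mem_support_iff.1 hn))).trans
      (le_wt α n)
  have hlim : ∀ (k : ℤ) (m : ℕ), m ≠ 0 → 2 - m ≤ k → TailGE (m + k) ((M - X m).coeff k) := by
    intro k m hm hk α hα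
    rw [MicroDiff.coeff_sub, hM, map_sub, hc, ← map_sub, ← MicroDiff.coeff_sub]
    rcases le_total m (μ k α) with h | h
    · exact hstep k m _ hm hk h α hα
    · have h1 := hstep k (μ k α) m (by simp only [μ]; omega) (by simp only [μ]; omega) h α
        fun n hn => by
          have := hsupp α n hn
          simp only [μ]
          omega
      rw [← neg_sub, MicroDiff.coeff_neg, map_neg, h1, neg_zero]
  refine ⟨M, ⟨by rw [hM, hc1], fun k hk => by rw [hM, hc2 k hk]⟩, fun k => ?_, fun n => ?_⟩
  · rw [hM]
    by_cases hk : 1 < k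
    · rw [hc2 k hk]
      exact zero_mem _
    -- Different `α` use different levels, yet the pole order must be bounded uniformly. All of them
    -- are compared with the single level $2-k$, whose remainder has order at most $k-1$. The
    -- coefficient of $\partial^k$ is then a sum, with factors independent of `x`, over finitely
    -- many fixed powers $u^j$.
    have hm0 : (2 - k).toNat ≠ 0 := by omega
    have h0 := (hX _ hm0).1
    obtain ⟨u, hu⟩ := h0.exists_unit
    rw [← hu] at h0
    have hmem : ∀ j : ℤ, ((u ^ j : (MicroDiff (Fun A))ˣ) : MicroDiff (Fun A)).coeff k ∈
        bddSubring A I := fun j =>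
      zpow_mem_opSubring (hT := deriv_mem_bddSubring) h0.isMonic h0.mem j k
    choose N hNI hN using fun j : ℤ => mem_bddSubring.1 (hmem j)
    refine ⟨∑ j ∈ Ioc (1 - ((2 - k).toNat : ℕ) : ℤ) 1, N j, sum_mem fun j _ => hNI j,
      xBdd_of_forall fun α => ⟨(X (μ k α)).coeff k, ?_, hc k α⟩⟩
    obtain ⟨a, ha, -, hord, -⟩ := hB.compare hm0
      ((happ k α).mono (m' := (2 - k).toNat) (by simp only [μ]; omega)) h0
    have h1 := hord k (by omega)
    rw [MicroDiff.coeff_sub, sub_eq_zero] at h1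
    rw [h1, coeff_sum]
    refine XBdd.sum fun j hj => ?_
    obtain ⟨g, hg⟩ := exists_eq_ofTimes (ha j).2
    rw [coeff_ofFun_mul, hg]
    exact ((xBdd_ofTimes g).mul (hN j)).mono
      (by rw [zero_add]; exact single_le_sum (fun _ _ => Nat.zero_le _) hj)
  · ext1 k
    rw [MicroDiff.coeff_zero]
    refine eq_zero_of_forall_tailGE (N₀ := n + k.natAbs + 2) fun N hN => ?_
    -- With this `m`, $D_nX_m$ has order $k-N<k$, and every $j\ge k-n$ satisfies $m+j\ge N$.
    set m : ℕ := (N + n - k).toNat with hm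
    have hm' : (m : ℤ) = N + n - k := by omega
    have hord := (hX m (by omega)).1.ordLE n
    have h1 : zsDeriv B n M = zsDeriv B n (X m) + zsDeriv B n (M - X m) := by
      rw [← map_add, add_sub_cancel]
    rw [h1, MicroDiff.coeff_add, hord k (by omega), zero_add, zsDeriv_apply, MicroDiff.coeff_sub,
      MicroDiff.coeff_sub, coeff_opDeriv]
    have h2 := coeff_mul_tailGE (N := N) (k := k) (hB.isMonic n).ordLE (Z := M - X m)
      fun j hj => (hlim j m (by omega) (by omega)).mono (by omega)
    exact (((hlim k m (by omega) (by omega)).tDeriv (by omega)).mono (by omega)).sub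
      (h2.1.sub h2.2)

end Approximation

end KP

end

/-! ### Expansion of the B_n in powers of a solution. -/

noncomputable section

namespace KP

open Finset MicroDiff

set_option linter.unusedSectionVars false

section Expansion

attribute [local instance] ringStructure

variable {A : Type*} [CommRing A] {B : ℕ+ → MicroDiff (Fun A)} {I : AddSubmonoid ℕ}

theorem commute_sum_zpow {u : (MicroDiff (Fun A))ˣ} {a b : ℤ → Fun A} (ha : ∀ k, (a k)′ = 0)
    (hb : ∀ k, (b k)′ = 0) (s t : Finset ℤ) :
    Commute (∑ k ∈ s, ofFun (a k) * (u ^ k : (MicroDiff (Fun A))ˣ))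
      (∑ k ∈ t, ofFun (b k) * (u ^ k : (MicroDiff (Fun A))ˣ)) := by
  refine Commute.sum_left _ _ _ fun i _ => Commute.sum_right _ _ _ fun j _ => ?_
  have h : Commute ((u ^ i : (MicroDiff (Fun A))ˣ) : MicroDiff (Fun A))
      (u ^ j : (MicroDiff (Fun A))ˣ) := Commute.units_val (Commute.zpow_zpow_self u i j)
  have hc : ∀ {c : Fun A}, c′ = 0 → ∀ P : MicroDiff (Fun A), Commute (ofFun c) P :=
    fun hc P => ofFun_mul_comm hc P
  exact ((hc (ha i) _).mul_left (((hc (hb j) _).symm).mul_right h))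

theorem commute_sum_zpow_self {u : (MicroDiff (Fun A))ˣ} {a : ℤ → Fun A} (ha : ∀ k, (a k)′ = 0)
    (s : Finset ℤ) :
    Commute (∑ k ∈ s, ofFun (a k) * (u ^ k : (MicroDiff (Fun A))ˣ)) (u : MicroDiff (Fun A)) := by
  refine Commute.sum_left _ _ _ fun i _ => ?_
  have h : Commute ((u ^ i : (MicroDiff (Fun A))ˣ) : MicroDiff (Fun A)) u :=
    Commute.units_val (Commute.zpow_self u i)
  exact Commute.mul_left (ofFun_mul_comm (ha i) _) h

/-- Monic operators `u` of order one with `∂u/∂t_n = [B_n, u]` for all `n`. -/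
structure IsSolution (I : AddSubmonoid ℕ) (B : ℕ+ → MicroDiff (Fun A)) (X : MicroDiff (Fun A)) :
    Prop where
  isMonic : X.IsMonic 1
  mem : ∀ k, X.coeff k ∈ bddSubring A I
  zsDeriv_eq : ∀ n, zsDeriv B n X = 0

theorem IsSolution.zsDeriv_zpow {u : (MicroDiff (Fun A))ˣ} (hu : IsSolution I B u) (n : ℕ+)
    (k : ℤ) : zsDeriv B n (u ^ k : (MicroDiff (Fun A))ˣ) = 0 :=
  eq_zero_of_forall_ordLE fun d =>
    (ordLE_derivation_zpow (zsDeriv_mul n) hu.isMonic (d := -d - k + 1)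
      -- Since $D_nu=0$ satisfies every order bound, the estimate for powers makes $D_n(u^k)$ of
      -- arbitrarily low order.
      (by rw [hu.zsDeriv_eq]; exact ordLE_zero _) k).mono (by omega)

/-- The expansion of `B_n` in powers of a solution, up to an operator of order zero. -/
structure IsExpansion (B : ℕ+ → MicroDiff (Fun A)) (u : (MicroDiff (Fun A))ˣ)
    (c : ℕ+ → ℤ → Fun A) (Z : ℕ+ → MicroDiff (Fun A)) : Prop where
  deriv_eq : ∀ n k, (c n k)′ = 0
  self_eq : ∀ n : ℕ+, c n n = 1
  eq_zero : ∀ (n : ℕ+) (k : ℤ), n < k → c n k = 0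
  ordLE : ∀ n, (Z n).OrdLE 0
  eq_add : ∀ (n : ℕ+) (N : ℤ), n ≤ N →
    B n = ∑ k ∈ Ioc (0 : ℤ) N, ofFun (c n k) * (u ^ k : (MicroDiff (Fun A))ˣ) + Z n

theorem IsSolution.comm_eq {X : MicroDiff (Fun A)} (hX : IsSolution I B X) (n : ℕ+) :
    B n * X - X * B n = opDeriv n X := by
  have := hX.zsDeriv_eq n
  rw [zsDeriv_apply, sub_eq_zero] at this
  exact this.symm

/-- The terms already split off commute with `u`, so the remainder has commutator $\partial
u/\partial t_n$ with `u`, of order at most $0$. In order $j>0$ this forces the remainder's leading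
coefficient to have zero $x$-derivative. Extending the coefficients by zero gives all $B_n$ a common
index range. -/
theorem ZSSystem.exists_isExpansion (hB : ZSSystem I B) {u : (MicroDiff (Fun A))ˣ}
    (hu : IsSolution I B u) : ∃ c Z, IsExpansion B u c Z := by
  have hQ := isMonic_zpow hu.isMonic
  have key : ∀ n : ℕ+, ∃ a : ℤ → Fun A, (∀ k, (a k)′ = 0) ∧
      (B n - ∑ k ∈ Ioc (0 : ℤ) n, ofFun (a k) * (u ^ k : (MicroDiff (Fun A))ˣ)).OrdLE 0 := by
    intro n
    refine exists_expansion hQ (C := fun c => c′ = 0) (map_zero _) (hB.isMonic n).ordLE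
      fun j a hj _ ha hord => ?_
    have h1 := coeff_comm_top hord hu.isMonic.ordLE
    rw [sub_mul, mul_sub, sub_sub_sub_comm, (commute_sum_zpow_self ha _).eq, sub_self, sub_zero,
      hu.comm_eq, ordLE_opDeriv_of_isMonic n hu.isMonic _ (by omega), hu.isMonic.1, one_deriv,
      mul_zero, smul_zero, zero_sub, one_mul, one_smul] at h1
    exact neg_eq_zero.1 h1.symm
  choose a ha hord using key
  have hself : ∀ n : ℕ+, a n n = 1 := by
    intro n
    have hn : (0 : ℤ) < (n : ℕ) := by exact_mod_cast n.pos
    have h1 := hord n n hn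
    rw [MicroDiff.coeff_sub, (hB.isMonic n).1, coeff_sum, sum_eq_single ((n : ℕ) : ℤ),
      coeff_ofFun_mul, (hQ _).1, mul_one, sub_eq_zero] at h1
    · exact h1.symm
    · intro k hk hne
      rw [mem_Ioc] at hk
      rw [coeff_ofFun_mul, (hQ k).ordLE _ (by omega), mul_zero]
    · intro h
      exact absurd (mem_Ioc.2 ⟨hn, le_rfl⟩) h
  refine ⟨fun n k => if k ≤ n then a n k else 0,
    fun n => B n - ∑ k ∈ Ioc (0 : ℤ) n, ofFun (a n k) * (u ^ k : (MicroDiff (Fun A))ˣ),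
    fun n k => ?_, fun n => ?_, fun n k hk => if_neg (by omega), hord, fun n N hN => ?_⟩
  · split_ifs
    · exact ha n k
    · exact map_zero _
  · rw [if_pos le_rfl, hself]
  · rw [← sum_subset (Ioc_subset_Ioc_right hN), add_comm, sub_add_eq_add_sub, eq_sub_iff_add_eq,
      add_right_inj]
    · refine sum_congr rfl fun k hk => ?_
      rw [if_pos (mem_Ioc.1 hk).2]
    · intro k hk hk'
      simp only [mem_Ioc] at hk hk'
      rw [if_neg (by omega), ofFun_zero, zero_mul]

variable {u : (MicroDiff (Fun A))ˣ} {c : ℕ+ → ℤ → Fun A} {Z : ℕ+ → MicroDiff (Fun A)}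

/-- Read off the coefficient of $\partial^0$ in $[Z_n,u]=\partial u/\partial t_n$. The relation will
control the poles of the potential $f_0$. -/
theorem IsExpansion.deriv_coeff (hc : IsExpansion B u c Z) (hu : IsSolution I B u) (n : ℕ+) :
    ((Z n).coeff 0)′ = -tDeriv n ((u : MicroDiff (Fun A)).coeff 0) := by
  have h1 := coeff_comm_top (hc.ordLE n) hu.isMonic.ordLE
  have h2 : Z n = B n - ∑ k ∈ Ioc (0 : ℤ) n, ofFun (c n k) * (u ^ k : (MicroDiff (Fun A))ˣ) :=
    eq_sub_of_add_eq' (hc.eq_add n n le_rfl).symm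
  have h3 : Z n * u - u * Z n = opDeriv n (u : MicroDiff (Fun A)) := by
    rw [h2, sub_mul, mul_sub, sub_sub_sub_comm, (commute_sum_zpow_self (hc.deriv_eq n) _).eq,
      sub_self, sub_zero, hu.comm_eq]
  rw [h3, coeff_opDeriv, hu.isMonic.1, one_deriv, mul_zero, smul_zero, zero_sub, one_mul, one_smul,
    zero_add, sub_self] at h1
  rw [h1, neg_neg]

/-- Inserting the expansions into the Zakharov–Shabat equations gives
$\sum(\partial_mc_{n,k}-\partial_nc_{m,k})u^k=\partial_nZ_m-\partial_mZ_n-[Z_n,Z_m]$. The right-hand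
side has order at most $0$, so the left-hand coefficients vanish. The commutator has order at most
$-1$, which leaves the second relation in order $0$. -/
theorem IsExpansion.closed (hc : IsExpansion B u c Z) (hB : ZSSystem I B) (hu : IsSolution I B u)
    (m n : ℕ+) : (∀ k, 0 < k → tDeriv m (c n k) = tDeriv n (c m k)) ∧
      tDeriv m ((Z n).coeff 0) = tDeriv n ((Z m).coeff 0) := by
  have hQ := isMonic_zpow hu.isMonic
  have hD : ∀ (m n : ℕ+) (N : ℤ),
      zsDeriv B m (∑ k ∈ Ioc (0 : ℤ) N, ofFun (c n k) * (u ^ k : (MicroDiff (Fun A))ˣ)) =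
      ∑ k ∈ Ioc (0 : ℤ) N, ofFun (tDeriv m (c n k)) * (u ^ k : (MicroDiff (Fun A))ˣ) := by
    intro m n N
    rw [map_sum]
    refine sum_congr rfl fun k _ => ?_
    rw [zsDeriv_ofFun_mul m (hc.deriv_eq n k), hu.zsDeriv_zpow, mul_zero, add_zero]
  have hmain : ∀ N : ℤ, m ≤ N → n ≤ N → ∑ k ∈ Ioc (0 : ℤ) N,
      ofFun (tDeriv m (c n k) - tDeriv n (c m k)) * (u ^ k : (MicroDiff (Fun A))ˣ) =
      opDeriv n (Z m) - opDeriv m (Z n) - (Z n * Z m - Z m * Z n) := by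
    intro N hm hn
    simp only [ofFun_sub, sub_mul, sum_sub_distrib]
    rw [← hD, ← hD]
    have hcomm := commute_sum_zpow (u := u) (hc.deriv_eq n) (hc.deriv_eq m) (Ioc (0 : ℤ) N)
      (Ioc (0 : ℤ) N)
    have hn' := hc.eq_add n N hn
    have hm' := hc.eq_add m N hm
    have h1 := hB.zsDeriv_B m n
    have h2 : opDeriv n (B m) = zsDeriv B n (B m) + (B n * B m - B m * B n) := by
      rw [zsDeriv_apply, sub_add_cancel]
    rw [h2] at h1
    set Y := ∑ k ∈ Ioc (0 : ℤ) N, ofFun (c n k) * (u ^ k : (MicroDiff (Fun A))ˣ)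
    set Y' := ∑ k ∈ Ioc (0 : ℤ) N, ofFun (c m k) * (u ^ k : (MicroDiff (Fun A))ˣ)
    have h3 : zsDeriv B m Y = zsDeriv B m (B n) - zsDeriv B m (Z n) := by
      rw [← map_sub, hn', add_sub_cancel_right]
    have h4 : zsDeriv B n Y' = zsDeriv B n (B m) - zsDeriv B n (Z m) := by
      rw [← map_sub, hm', add_sub_cancel_right]
    rw [h3, h4, h1, zsDeriv_apply m (Z n), zsDeriv_apply n (Z m), hn', hm']
    simp only [add_mul, mul_add, hcomm.eq]
    abel
  have hzero : ∀ N : ℤ, m ≤ N → n ≤ N → ∀ k ∈ Ioc (0 : ℤ) N,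
      tDeriv m (c n k) - tDeriv n (c m k) = 0 := by
    intro N hm hn k hk
    refine eq_zero_of_sum_ordLE hQ (a := fun k => tDeriv m (c n k) - tDeriv n (c m k)) (d := 0)
      ?_ k hk (mem_Ioc.1 hk).1
    rw [hmain N hm hn]
    exact ((ordLE_opDeriv n (hc.ordLE m)).sub (ordLE_opDeriv m (hc.ordLE n))).sub
      (((hc.ordLE n).comm (hc.ordLE m)).mono (by omega))
  constructor
  · intro k hk
    exact sub_eq_zero.1 (hzero (m + n + k) (by omega) (by omega) k (mem_Ioc.2 ⟨hk, by omega⟩))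
  · have h1 := hmain (m + n) (by omega) (by omega)
    rw [sum_eq_zero fun k hk => by
      rw [hzero (m + n) (by omega) (by omega) k hk, ofFun_zero, zero_mul]] at h1
    have h2 := congrArg (fun P => P.coeff 0) h1
    simp only [MicroDiff.coeff_sub, MicroDiff.coeff_zero, coeff_opDeriv] at h2
    rw [← MicroDiff.coeff_sub, (hc.ordLE n).comm (hc.ordLE m) 0 (by omega), sub_zero] at h2
    exact (sub_eq_zero.1 h2.symm).symm

theorem IsExpansion.coeff_sub_one (hc : IsExpansion B u c Z) (hu : IsSolution I B u) (n : ℕ+) :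
    (B (n + 1)).coeff n = ((n : ℕ) + 1 : ℕ) * (u : MicroDiff (Fun A)).coeff 0 + c (n + 1) n := by
  have hQ := isMonic_zpow hu.isMonic
  have hn : (0 : ℤ) < (n : ℕ) := by exact_mod_cast n.pos
  have hn1 : (((n + 1 : ℕ+) : ℕ) : ℤ) = (n : ℕ) + 1 := by push_cast; rfl
  have h1 := hu.isMonic.coeff_pow_sub_one (n + 1)
  rw [show (((n : ℕ) + 1 : ℕ) : ℤ) - 1 = (n : ℕ) by push_cast; ring] at h1
  have h2 := hc.self_eq (n + 1)
  rw [hn1] at h2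
  rw [hc.eq_add (n + 1) ((n : ℕ) + 1) (by omega), MicroDiff.coeff_add, hc.ordLE _ _ hn, add_zero,
    coeff_sum, sum_eq_add_of_mem ((n : ℕ) + 1 : ℤ) (n : ℕ) (mem_Ioc.2 (by omega))
      (mem_Ioc.2 (by omega)) (by omega), coeff_ofFun_mul, coeff_ofFun_mul, (hQ _).1, mul_one, h2,
    one_mul, ← h1]
  · norm_cast
  · intro k hk hne
    rw [mem_Ioc] at hk
    rw [coeff_ofFun_mul, (hQ k).ordLE _ (by omega), mul_zero]

/-- As $B_n$ is differential, it equals its own differential part, and all of $Z_n$ below order $0$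
disappears. -/
theorem IsExpansion.eq_plus_add (hc : IsExpansion B u c Z) (hB : ZSSystem I B) (n : ℕ+) :
    B n = ∑ k ∈ Iic n, ofFun (c n k) * ((u : MicroDiff (Fun A)) ^ (k : ℕ)).plus +
      ofFun ((Z n).coeff 0) := by
  have hZ : (Z n).plus = ofFun ((Z n).coeff 0) := by
    ext1 k
    rw [coeff_plus, coeff_ofFun]
    rcases lt_trichotomy k 0 with h | rfl | h
    · rw [if_neg (by omega), if_neg (by omega)]
    · rw [if_pos le_rfl, if_pos rfl]
    · rw [if_pos h.le, if_neg h.ne', hc.ordLE n k h]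
  conv_lhs => rw [← (hB.isDifferential n).plus_eq, hc.eq_add n n le_rfl, plus_add, plus_sum, hZ]
  congr 1
  symm
  refine sum_bij (fun k _ => ((k : ℕ) : ℤ)) (fun k hk => ?_) (fun k _ j _ h => ?_)
    (fun k hk => ?_) fun k _ => ?_
  · rw [mem_Iic, ← PNat.coe_le_coe] at hk
    exact mem_Ioc.2 ⟨by exact_mod_cast k.pos, by exact_mod_cast hk⟩
  · exact PNat.coe_injective (by exact_mod_cast h)
  · rw [mem_Ioc] at hk
    refine ⟨Nat.toPNat' k.toNat, ?_, ?_⟩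
    · rw [mem_Iic, ← PNat.coe_le_coe, PNat.toPNat'_coe (by omega)]
      omega
    · rw [PNat.toPNat'_coe (by omega)]
      omega
  · rw [plus_ofFun_mul, zpow_natCast, Units.val_pow_eq_pow_val]

end Expansion

end KP

end

/-! ### Integration of the expansion coefficients to new times and a gauge potential. -/

noncomputable section

namespace KP

open Finset MicroDiff

set_option linter.unusedSectionVars false

section Integration

variable {A : Type*} [CommRing A] [Algebra ℂ A]

theorem eq_initial_of_tDeriv {f : Fun A} (hf : ∀ n, tDeriv n f = 0) : f = initial f :=
  sub_eq_zero.1 (eq_zero_of_forall_tailGE (N₀ := 0) fun _ _ => tailGE_sub_initial fun n _ => hf n)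

theorem isTriangular_of_pderiv {τ : ℕ+ → MvPowerSeries ℕ+ A}
    (h0 : ∀ n, MvPowerSeries.constantCoeff (τ n) = 0)
    (hself : ∀ n, MvPowerSeries.pderiv A n (τ n) = 1)
    (hlt : ∀ m n, m < n → MvPowerSeries.pderiv A m (τ n) = 0) : IsTriangular τ := by
  classical
  have := isAddTorsionFree_of_complex A
  intro n α hα
  refine ⟨?_, fun m hm => ?_⟩
  · rintro rfl
    apply hα
    rw [map_sub, MvPowerSeries.coeff_zero_eq_constantCoeff_apply,
      MvPowerSeries.coeff_zero_eq_constantCoeff_apply, h0, MvPowerSeries.constantCoeff_X, sub_zero]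
  · by_contra hmn
    have h1 : MvPowerSeries.pderiv A m (τ n - MvPowerSeries.X n) = 0 := by
      rw [map_sub]
      rcases (not_lt.1 hmn).eq_or_lt with rfl | h
      · rw [hself, MvPowerSeries.pderiv_X_self, sub_self]
      · rw [hlt m n h, MvPowerSeries.pderiv_X_of_ne h.ne', sub_zero]
    have h2 := MvPowerSeries.coeff_pderiv (R := A) (i := m) (τ n - MvPowerSeries.X n)
      (α - Finsupp.single m 1)
    rw [h1, map_zero, tsub_add_cancel_of_le (Finsupp.single_le_iff.2
      (Nat.one_le_iff_ne_zero.2 (Finsupp.mem_support_iff.1 hm)))] at h2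
    apply hα
    have h3 : ((α - Finsupp.single m 1 : ℕ+ →₀ ℕ) m + 1) •
        MvPowerSeries.coeff α (τ n - MvPowerSeries.X n) = 0 := by
      rw [nsmul_eq_mul, mul_comm]
      push_cast
      exact h2.symm
    exact (nsmul_eq_zero_iff_right (Nat.succ_ne_zero _)).1 h3

theorem exists_times {c : ℕ+ → ℕ+ → Fun A} (hderiv : ∀ n k, (c n k)′ = 0)
    (hself : ∀ n, c n n = 1) (hlt : ∀ n k, n < k → c n k = 0)
    (hclosed : ∀ m n k, tDeriv m (c n k) = tDeriv n (c m k)) :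
    ∃ τ : ℕ+ → MvPowerSeries ℕ+ A, IsTriangular τ ∧ ∀ n k, tDeriv n (ofTimes (τ k)) = c n k := by
  choose γ hγ using fun n k => exists_eq_ofTimes (hderiv n k)
  choose τ h0 hτ _ using fun k => exists_pderiv_eq (g := fun n => γ n k) fun m n =>
    ofTimes_injective (by rw [← tDeriv_ofTimes, ← tDeriv_ofTimes, ← hγ, ← hγ, hclosed])
  refine ⟨τ, isTriangular_of_pderiv h0 (fun n => ?_) (fun m n h => ?_), fun n k => ?_⟩
  · exact ofTimes_injective (by rw [hτ, ← hγ, hself, map_one])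
  · exact ofTimes_injective (by rw [hτ, ← hγ, hlt m n h, map_zero])
  · rw [tDeriv_ofTimes, hτ, ← hγ]

/-- The relation $g_n'=-\partial v/\partial t_n$ bounds the poles of every $g_n$ by those of `v`,
uniformly in `n`. Integration in the times preserves this bound. -/
theorem exists_potential {I : AddSubmonoid ℕ} {g : ℕ+ → Fun A} {v : Fun A}
    (hclosed : ∀ m n, tDeriv m (g n) = tDeriv n (g m)) (hv : v ∈ bddSubring A I)
    (hg : ∀ n, (g n)′ = -tDeriv n v) :
    ∃ f ∈ bddSubring A I, MvPowerSeries.constantCoeff f = 0 ∧ ∀ n, tDeriv n f = g n := by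
  have := isAddTorsionFree_of_complex A
  obtain ⟨N, hN, hv⟩ := hv
  obtain ⟨f, h0, hf, hcoeff⟩ := exists_pderiv_eq hclosed
  have hgN : ∀ n, XBdd N (g n) := by
    intro n α i hi
    have h1 := coeff_coeff_xDeriv (g n) α (i - 1)
    rw [← deriv_eq_xDeriv, hg, map_neg, HahnSeries.coeff_neg, coeff_tDeriv, HahnSeries.coeff_smul,
      hv _ _ (by omega), smul_zero, neg_zero, sub_add_cancel] at h1
    exact (smul_eq_zero.1 h1.symm).resolve_left (by omega)
  refine ⟨f, ⟨N, hN, fun α i hi => ?_⟩, h0, hf⟩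
  rcases eq_or_ne α 0 with rfl | hα
  · rw [MvPowerSeries.coeff_zero_eq_constantCoeff_apply, h0]
    rfl
  · obtain ⟨m, hm, n, β, e⟩ := hcoeff α hα
    refine (nsmul_eq_zero_iff_right hm).1 ?_
    rw [← HahnSeries.coeff_smul, e, hgN n β i hi]

end Integration

/-! ### Gauge transformation by the exponential of the potential, and the conclusion. -/

section Main

attribute [local instance] ringStructure

variable {A : Type*} [CommRing A] [Algebra ℂ A] {B : ℕ+ → MicroDiff (Fun A)} {I : AddSubmonoid ℕ}

theorem ofFun_expFun_mul {f : Fun A} (hf : MvPowerSeries.constantCoeff f = 0) :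
    ofFun (expFun f) * ofFun (expFun (-f)) = 1 ∧ ofFun (expFun (-f)) * ofFun (expFun f) = 1 := by
  constructor
  · rw [← ofFun_mul, expFun_mul_expFun_neg hf, ofFun_one]
  · rw [← ofFun_mul, mul_comm, expFun_mul_expFun_neg hf, ofFun_one]

/-- The gauge transform `e^{-f} P e^{f}`. -/
def gauge (f : Fun A) (P : MicroDiff (Fun A)) : MicroDiff (Fun A) :=
  ofFun (expFun (-f)) * (P * ofFun (expFun f))

theorem gauge_mul {f : Fun A} (hf : MvPowerSeries.constantCoeff f = 0)
    (P Q : MicroDiff (Fun A)) : gauge f (P * Q) = gauge f P * gauge f Q := by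
  have h : ofFun (expFun (-f)) * (P * ofFun (expFun f)) *
      (ofFun (expFun (-f)) * (Q * ofFun (expFun f))) = ofFun (expFun (-f)) * (P *
      (ofFun (expFun f) * ofFun (expFun (-f))) * (Q * ofFun (expFun f))) := by
    simp only [mul_assoc]
  rw [gauge, gauge, gauge, h, (ofFun_expFun_mul hf).1, mul_one, mul_assoc]

theorem gauge_one {f : Fun A} (hf : MvPowerSeries.constantCoeff f = 0) :
    gauge f (1 : MicroDiff (Fun A)) = 1 := by
  rw [gauge, one_mul, (ofFun_expFun_mul hf).2]

theorem gauge_pow {f : Fun A} (hf : MvPowerSeries.constantCoeff f = 0) (P : MicroDiff (Fun A))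
    (n : ℕ) : gauge f (P ^ n) = gauge f P ^ n := by
  induction n with
  | zero => rw [pow_zero, pow_zero, gauge_one hf]
  | succ n ih => rw [pow_succ, pow_succ, gauge_mul hf, ih]

theorem gauge_sub (f : Fun A) (P Q : MicroDiff (Fun A)) :
    gauge f (P - Q) = gauge f P - gauge f Q := by
  simp only [gauge, sub_mul, mul_sub]

theorem gauge_sum (f : Fun A) {ι : Type*} (s : Finset ι) (P : ι → MicroDiff (Fun A)) :
    gauge f (∑ i ∈ s, P i) = ∑ i ∈ s, gauge f (P i) := by
  simp only [gauge, sum_mul, mul_sum]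

theorem gauge_ofFun_mul (f g : Fun A) (P : MicroDiff (Fun A)) :
    gauge f (ofFun g * P) = ofFun g * gauge f P := by
  rw [gauge, gauge, mul_assoc, ← mul_assoc, ← ofFun_mul, mul_comm, ofFun_mul, mul_assoc]

theorem plus_gauge (f : Fun A) (P : MicroDiff (Fun A)) : (gauge f P).plus = gauge f P.plus := by
  rw [gauge, ← mul_assoc, plus_conj, mul_assoc, gauge]

theorem gauge_of_deriv_eq_zero {f : Fun A} (hf : MvPowerSeries.constantCoeff f = 0) (hf' : f′ = 0)
    (P : MicroDiff (Fun A)) : gauge f P = P := by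
  have h : (expFun f)′ = 0 := by rw [xDeriv_expFun hf, hf', zero_mul]
  rw [gauge, ← ofFun_mul_comm h, ← mul_assoc, (ofFun_expFun_mul hf).2, one_mul]

theorem conj_gauge {f : Fun A} (hf : MvPowerSeries.constantCoeff f = 0) (P : MicroDiff (Fun A)) :
    ofFun (expFun f) * gauge f P * ofFun (expFun (-f)) = P := by
  have h : ofFun (expFun f) * gauge f P * ofFun (expFun (-f)) =
      (ofFun (expFun f) * ofFun (expFun (-f))) * P * (ofFun (expFun f) * ofFun (expFun (-f))) := by
    simp only [gauge, mul_assoc]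
  rw [h, (ofFun_expFun_mul hf).1, one_mul, mul_one]

theorem isMonic_gauge {f : Fun A} (hf : MvPowerSeries.constantCoeff f = 0)
    {P : MicroDiff (Fun A)} {N : ℤ} (hP : P.IsMonic N) : (gauge f P).IsMonic N := by
  have h1 : (P * ofFun (expFun f)).OrdLE N := by simpa using hP.ordLE.mul (ordLE_ofFun _)
  have h2 := coeff_mul_top hP.ordLE (ordLE_ofFun (expFun f))
  rw [add_zero] at h2
  refine ⟨?_, h1.ofFun_mul _⟩
  rw [gauge, coeff_ofFun_mul, h2, hP.1, one_mul, coeff_ofFun, if_pos rfl, mul_comm,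
    expFun_mul_expFun_neg hf]

theorem tildeB_gauge {f : Fun A} (hf : MvPowerSeries.constantCoeff f = 0) (P : MicroDiff (Fun A))
    (n : ℕ+) : tildeB f (gauge f P) n = (P ^ (n : ℕ)).plus := by
  change ofFun (expFun f) * (gauge f P ^ (n : ℕ)).plus * ofFun (expFun (-f)) = _
  rw [← gauge_pow hf, plus_gauge, conj_gauge hf]

theorem constantCoeff_neg_eq_zero {f : Fun A} (hf : MvPowerSeries.constantCoeff f = 0) :
    MvPowerSeries.constantCoeff (-f) = 0 := by rw [map_neg, hf, neg_zero]

theorem opDeriv_gauge {f : Fun A} (hf : MvPowerSeries.constantCoeff f = 0) (n : ℕ+)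
    (P : MicroDiff (Fun A)) :
    opDeriv n (gauge f P) = gauge f (opDeriv n P - (ofFun (tDeriv n f) * P -
      P * ofFun (tDeriv n f))) := by
  have h1 : ofFun (tDeriv n f * expFun f) = ofFun (tDeriv n f) * ofFun (expFun f) := ofFun_mul _ _
  have h2 : ofFun (tDeriv n (-f) * expFun (-f)) =
      0 - ofFun (expFun (-f)) * ofFun (tDeriv n f) := by
    rw [map_neg, ← ofFun_mul, ← ofFun_zero, ← ofFun_sub, zero_sub, neg_mul, mul_comm]
  rw [gauge, opDeriv_mul, opDeriv_mul, opDeriv_ofFun, opDeriv_ofFun, tDeriv_expFun n hf,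
    tDeriv_expFun n (constantCoeff_neg_eq_zero hf), h1, h2, gauge]
  simp only [sub_mul, mul_sub, zero_mul, mul_add, mul_assoc]
  abel

/-- Subtracting a scalar from a solution leaves a solution. This freedom is spent on the constant
term of $u_0$, which the condition $b_{n,n-1}=0$ alone would not determine. -/
theorem ZSSystem.exists_normalized (hB : ZSSystem I B) : ∃ X, IsSolution I B X ∧
    (MvPowerSeries.constantCoeff (X.coeff 0)).coeff 0 = 0 := by
  obtain ⟨M, hM, hmem, hD⟩ := hB.exists_solution
  let g : MvPowerSeries ℕ+ A :=
    MvPowerSeries.C ((MvPowerSeries.constantCoeff (M.coeff 0)).coeff 0)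
  have hg : (ofTimes g)′ = 0 := xDeriv_ofTimes g
  refine ⟨M - ofFun (ofTimes g), ⟨⟨?_, ?_⟩, fun k => ?_, fun n => ?_⟩, ?_⟩
  · rw [MicroDiff.coeff_sub, coeff_ofFun, if_neg one_ne_zero, hM.1, sub_zero]
  · exact hM.ordLE.sub ((ordLE_ofFun _).mono (by omega))
  · rw [MicroDiff.coeff_sub, coeff_ofFun]
    refine sub_mem (hmem k) ?_
    split_ifs
    · exact ofTimes_mem_bddSubring g
    · exact zero_mem _
  · rw [map_sub, hD, zsDeriv_ofFun n hg, tDeriv_ofTimes, MvPowerSeries.pderiv_C, map_zero,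
      ofFun_zero, sub_zero]
  · have h := coeff_coeff_ofTimes g 0 0
    rw [if_pos rfl, MvPowerSeries.coeff_zero_C,
      MvPowerSeries.coeff_zero_eq_constantCoeff_apply] at h
    rw [MicroDiff.coeff_sub, coeff_ofFun, if_pos rfl, map_sub, HahnSeries.coeff_sub, h, sub_self]

/-- Differentiating the exponentials contributes $-[\partial f/\partial t_n,u]$, which cancels the
order-zero term of $B_n$ in $\partial u/\partial t_n=[B_n,u]$. -/
theorem IsExpansion.opDeriv_gauge {u : (MicroDiff (Fun A))ˣ} {c : ℕ+ → ℤ → Fun A}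
    {Z : ℕ+ → MicroDiff (Fun A)} (hc : IsExpansion B u c Z) (hB : ZSSystem I B)
    (hu : IsSolution I B u) {f : Fun A} (hf : MvPowerSeries.constantCoeff f = 0)
    (hfZ : ∀ n, tDeriv n f = (Z n).coeff 0) (n : ℕ+) :
    opDeriv n (gauge f u) =
      ∑ k ∈ Iic n, ofFun (c n k) * ((gauge f u ^ (k : ℕ)).plus.comm (gauge f u)) := by
  have h : opDeriv n (u : MicroDiff (Fun A)) - (ofFun (tDeriv n f) * u - u * ofFun (tDeriv n f)) =
      ∑ k ∈ Iic n, ofFun (c n k) * (((u : MicroDiff (Fun A)) ^ (k : ℕ)).plus * u -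
        u * ((u : MicroDiff (Fun A)) ^ (k : ℕ)).plus) := by
    rw [← hu.comm_eq, hfZ, hc.eq_plus_add hB n, add_mul, mul_add, add_sub_add_comm,
      add_sub_cancel_right, sum_mul, mul_sum, ← sum_sub_distrib]
    refine sum_congr rfl fun k _ => ?_
    rw [mul_sub, ← mul_assoc (u : MicroDiff (Fun A)), ← ofFun_mul_comm (hc.deriv_eq n k), mul_assoc,
      mul_assoc]
  rw [KP.opDeriv_gauge hf, h, gauge_sum]
  refine sum_congr rfl fun k _ => ?_
  rw [gauge_ofFun_mul, gauge_sub, gauge_mul hf, gauge_mul hf, ← plus_gauge, gauge_pow hf,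
    MicroDiff.comm]

/-- The chain rule expresses $\partial L/\partial t_n$ by the new derivatives with the same
unitriangular matrix, so induction on `n` identifies the terms one by one. -/
theorem laxEquations_of_opDeriv {τ : ℕ+ → MvPowerSeries ℕ+ A} (hτ : IsTriangular τ)
    {L : MicroDiff (Fun A)} (hL : ∀ k, L.coeff k ∈ bddSubring A I)
    (hself : ∀ n, tDeriv n (ofTimes (τ n)) = 1)
    (h : ∀ n, opDeriv n L =
      ∑ k ∈ Iic n, ofFun (tDeriv n (ofTimes (τ k))) * ((L ^ (k : ℕ)).plus.comm L)) :
    LaxEquations (bddSubring A I) τ L := by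
  intro n k
  obtain ⟨φ, hφ, e⟩ := (bijOn_timeChange hτ I).surjOn (hL k)
  refine ⟨φ, hφ, e, ?_⟩
  induction n using WellFoundedLT.induction with
  | ind n ih =>
    have h1 := tDeriv_timeChange hτ n φ
    rw [e, ← coeff_opDeriv, h n, coeff_sum, ← Iio_insert, sum_insert (by simp),
      sum_insert (by simp), hself, coeff_ofFun_mul, one_mul, one_mul,
      sum_congr rfl fun j hj => ?_, add_left_inj] at h1
    · exact h1.symm
    · rw [coeff_ofFun_mul, ih j (mem_Iio.1 hj)]

/-- From $(n+1)u_0=-c_{n+1,n}$ it follows that $u_0$ is independent of $x$. By closedness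
$\partial_nc_{n+1,n}=\partial_{n+1}c_{n,n}=0$, so it is independent of each $t_n$ too, and the
normalisation makes it zero. -/
theorem IsExpansion.coeff_zero_eq_zero {u : (MicroDiff (Fun A))ˣ} {c : ℕ+ → ℤ → Fun A}
    {Z : ℕ+ → MicroDiff (Fun A)} (hc : IsExpansion B u c Z) (hB : ZSSystem I B)
    (hu : IsSolution I B u)
    (h0 : (MvPowerSeries.constantCoeff ((u : MicroDiff (Fun A)).coeff 0)).coeff 0 = 0)
    (hBn : ∀ n : ℕ+, (B n).coeff (((n : ℕ) : ℤ) - 1) = 0) :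
    (u : MicroDiff (Fun A)).coeff 0 = 0 := by
  have := isAddTorsionFree_of_complex A
  have := isAddTorsionFree_of_complex (Fun A)
  set v := (u : MicroDiff (Fun A)).coeff 0
  have h1 : ∀ n : ℕ+, ((n : ℕ) + 1) • v = -c (n + 1) n := by
    intro n
    have h := hBn (n + 1)
    rw [show (((n + 1 : ℕ+) : ℕ) : ℤ) - 1 = (n : ℕ) by push_cast; ring, hc.coeff_sub_one hu] at h
    rw [nsmul_eq_mul]
    exact eq_neg_of_add_eq_zero_left h
  have hv : v′ = 0 := by
    have h := congrArg (fun f => f′) (h1 1)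
    simp only [map_nsmul, map_neg] at h
    rw [hc.deriv_eq, neg_zero] at h
    exact (nsmul_eq_zero_iff_right (Nat.succ_ne_zero _)).1 h
  have ht : ∀ n, tDeriv n v = 0 := by
    intro n
    have h := congrArg (tDeriv n) (h1 n)
    rw [map_nsmul, map_neg, (hc.closed hB hu n (n + 1)).1 n (by exact_mod_cast n.pos), hc.self_eq,
      Derivation.map_one_eq_zero, neg_zero] at h
    exact (nsmul_eq_zero_iff_right (Nat.succ_ne_zero _)).1 h
  rw [eq_initial_of_tDeriv ht]
  ext α i
  rcases eq_or_ne α 0 with rfl | hα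
  · rw [coeff_zero_initial]
    rcases eq_or_ne i 0 with rfl | hi
    · rw [MvPowerSeries.coeff_zero_eq_constantCoeff_apply, h0, map_zero]
      rfl
    · have h := coeff_coeff_xDeriv v 0 (i - 1)
      rw [← deriv_eq_xDeriv, hv, sub_add_cancel] at h
      rw [(smul_eq_zero.1 (h.symm.trans (by simp))).resolve_left hi]
      simp
  · rw [coeff_initial v hα, map_zero]

theorem ZSSystem.exists_lax (hB : ZSSystem I B) :
    ∃ (L : MicroDiff (Fun A)) (τ : ℕ+ → MvPowerSeries ℕ+ A) (f₀ : Fun A),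
      (∀ k, L.coeff k ∈ bddSubring A I) ∧ L.IsMonic 1 ∧
      IsTriangular τ ∧ f₀ ∈ bddSubring A I ∧ MvPowerSeries.constantCoeff f₀ = 0 ∧
      LaxEquations (bddSubring A I) τ L ∧
      (∀ n : ℕ+, B n = tildeB f₀ L n
        + ∑ k ∈ Iio n, ofFun (tDeriv n (ofTimes (τ k))) * tildeB f₀ L k
        + ofFun (tDeriv n f₀)) ∧
      ((∀ n : ℕ+, (B n).coeff (((n : ℕ) : ℤ) - 1) = 0) →
        L.coeff 0 = 0 ∧ xDeriv A f₀ = 0 ∧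
          ∀ n : ℕ+, tildeB f₀ L n = (L ^ (n : ℕ)).plus) := by
  obtain ⟨X, hX, hX0⟩ := hB.exists_normalized
  obtain ⟨u, rfl⟩ := hX.isMonic.exists_unit
  obtain ⟨c, Z, hc⟩ := hB.exists_isExpansion hX
  obtain ⟨τ, hτ, hτc⟩ := exists_times (c := fun n k => c n k) (fun n k => hc.deriv_eq n k)
    hc.self_eq (fun n k h => hc.eq_zero n k (by exact_mod_cast h))
    fun m n k => (hc.closed hB hX m n).1 k (by exact_mod_cast k.pos)
  obtain ⟨f, hfS, hf0, hf⟩ := exists_potential (fun m n => (hc.closed hB hX m n).2) (hX.mem 0)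
    (hc.deriv_coeff hX)
  have hself : ∀ n, tDeriv n (ofTimes (τ n)) = 1 := fun n => by rw [hτc, hc.self_eq]
  have hL := coeff_conj_expFun_mem hf0 hfS hX.mem
  refine ⟨gauge f u, τ, f, hL, isMonic_gauge hf0 hX.isMonic, hτ, hfS, hf0,
    laxEquations_of_opDeriv hτ hL hself fun n => ?_, fun n => ?_, fun hBn => ?_⟩
  · rw [hc.opDeriv_gauge hB hX hf0 hf]
    exact sum_congr rfl fun k _ => by rw [hτc]
  · rw [hc.eq_plus_add hB n, ← Iio_insert, sum_insert (by simp), hc.self_eq, ofFun_one, one_mul,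
      tildeB_gauge hf0, hf]
    congr 2
    exact sum_congr rfl fun k _ => by rw [hτc, tildeB_gauge hf0]
  · have hv := hc.coeff_zero_eq_zero hB hX hX0 hBn
    -- The time derivatives of $f'$ are $z_n'=-\partial u_0/\partial t_n=0$, and $f'$ vanishes at
    -- $t=0$ together with $f$.
    have hf' : f′ = 0 := by
      have h1 : ∀ n, tDeriv n (xDeriv A f) = 0 := fun n => by
        rw [tDeriv_xDeriv, hf, ← deriv_eq_xDeriv, hc.deriv_coeff hX, hv, map_zero, neg_zero]
      rw [deriv_eq_xDeriv, eq_initial_of_tDeriv h1, initial]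
      have h2 : MvPowerSeries.constantCoeff (xDeriv A f) = 0 := by
        ext i
        rw [← MvPowerSeries.coeff_zero_eq_constantCoeff_apply, coeff_coeff_xDeriv,
          MvPowerSeries.coeff_zero_eq_constantCoeff_apply, hf0]
        simp
      rw [h2, map_zero]
    refine ⟨by rw [gauge_of_deriv_eq_zero hf0 hf', hv], hf', fun n => ?_⟩
    rw [tildeB_gauge hf0, gauge_of_deriv_eq_zero hf0 hf']

end Main

end KP

end

theorem mainTheorem1 {A : Type*} [CommRing A] [Algebra ℂ A]
    (S : Set (KP.Fun A)) (hS : S = KP.powerFun A ∨ S = KP.laurentFun A)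
    (B : ℕ+ → KP.MicroDiff (KP.Fun A))
    (hBS : ∀ n k, (B n).coeff k ∈ S)
    (hBdiff : ∀ n, (B n).IsDifferential)
    (hBmonic : ∀ n : ℕ+, (B n).IsMonic ((n : ℕ) : ℤ))
    (hZS : KP.ZakharovShabat B) :
    ∃ (L : KP.MicroDiff (KP.Fun A)) (τ : ℕ+ → MvPowerSeries ℕ+ A) (f₀ : KP.Fun A),
      (∀ k, L.coeff k ∈ S) ∧ L.IsMonic 1 ∧
      KP.IsTriangular τ ∧ Set.BijOn (KP.timeChange τ) S S ∧
      f₀ ∈ S ∧ MvPowerSeries.constantCoeff f₀ = 0 ∧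
      KP.LaxEquations S τ L ∧
      (∀ n : ℕ+, B n = KP.tildeB f₀ L n
        + ∑ k ∈ Finset.Iio n,
            KP.MicroDiff.ofFun (KP.tDeriv n (KP.ofTimes (τ k))) * KP.tildeB f₀ L k
        + KP.MicroDiff.ofFun (KP.tDeriv n f₀)) ∧
      ((∀ n : ℕ+, (B n).coeff (((n : ℕ) : ℤ) - 1) = 0) →
        L.coeff 0 = 0 ∧ KP.xDeriv A f₀ = 0 ∧
          ∀ n : ℕ+, KP.tildeB f₀ L n = (L ^ (n : ℕ)).plus) := by
  obtain ⟨I, rfl⟩ : ∃ I : AddSubmonoid ℕ, S = KP.bddSubring A I := by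
    rcases hS with rfl | rfl
    · exact ⟨⊥, KP.powerFun_eq A⟩
    · exact ⟨⊤, KP.laurentFun_eq A⟩
  obtain ⟨L, τ, f₀, hL, hL1, hτ, h⟩ :=
    KP.ZSSystem.exists_lax (I := I) ⟨hBS, hBdiff, hBmonic, hZS⟩
  exact ⟨L, τ, f₀, hL, hL1, hτ, KP.bijOn_timeChange hτ I, h⟩
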